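/- Let $p$ be an odd prime, $\mathcal K$ a field of characteristic $p$, $n\ge 1$, $q\in\mathcal K$, and let $1\le k\ne m\le n$. *Notation.* Let $\mathcal O(n;\underline 1)$ be the restricted divided power algebra, with basis $x^{(\alpha)}$, $0\le\alpha\le\tau=(p-1,\dots,p-1)$, and product $x^{(\alpha)}x^{(\beta)}=\binom{\alpha+\beta}{\alpha}x^{(\alpha+\beta)}$ (where $x^{(\gamma)}=0$ if some $\gamma_j\ge p$); equivalently $\mathcal O(n;\underline 1)=\mathcal K[x_1,\dots,x_n]/(x_1^p,\dots,x_n^p)$ with $x^{(\alpha)}=x^\alpha/\alpha!$. Let $D_i=\partial/\partial x_i$, and let $\mathbf W(n;\underline 1)=\mathrm{Der}_{\mathcal K}\,\mathcal O(n;\underline 1)$, with basis $x^{(\alpha)}D_i$ ($0\le\alpha\le\tau$, $1\le i\le n$), be the Jacobson–Witt algebra. Let $\mathbf u(\mathbf W(n;\underline 1))$ be the quotient of $U(\mathbf W(n;\underline 1))$ by the ideal generated by all $(x^{(\epsilon_i)}D_i)^p-x^{(\epsilon_i)}D_i$ and all $(x^{(\alpha)}D_i)^p$ with $\alpha\neq\epsilon_i$.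 Put $\mathcal K[t]_p^{(q)}=\mathcal K[t]/(t^p-qt)$ and $\mathbf u_{t,q}(\mathbf W(n;\underline 1))=\mathbf u(\mathbf W(n;\underline 1))\otimes_{\mathcal K}\mathcal K[t]_p^{(q)}$, a Hopf algebra over $\mathcal K[t]_p^{(q)}$ with the standard structure $\Delta_0,S_0,\varepsilon_0$ in which the elements of $\mathbf W(n;\underline 1)$ are primitive. For $j\in\{k,m\}$ let $$h(j)=x^{(\epsilon_j)}D_j,\qquad e(j)=2x^{(2\epsilon_j)}D_j,\qquad d_j^{(\ell)}=\tfrac1{\ell!}(\mathrm{ad}\,e(j))^\ell\quad(0\le\ell\le p-1),$$ $$\mathcal F(j)=\sum_{r=0}^{p-1}\frac{(-1)^r}{r!}\,h(j)^{[r]}\otimes e(j)^rt^r .$$ Here $x_a^{\langle r\rangle}=(x+a)(x+a+1)\cdots(x+a+r-1)$, $x^{\langle r\rangle}=x_0^{\langle r\rangle}$ and $x^{[r]}=x(x-1)\cdots(x-r+1)$. In $\mathbf u_{t,q}(\mathbf W(n;\underline 1))$ one has $e(j)^p=0$, so that $1-e(j)t$ is invertible. **Theorem 3.11.** One has $[h(k),e(k)]=e(k)$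 and $[h(m),e(m)]=e(m)$. The element $\mathcal F=\mathcal F(m)\mathcal F(k)$ is a Drinfel'd twist on the standard Hopf algebra $\mathbf u_{t,q}(\mathbf W(n;\underline 1))$ over $\mathcal K[t]_p^{(q)}$. Twisting by $\mathcal F$, that is, $\Delta(a)=\mathcal F\Delta_0(a)\mathcal F^{-1}$, $S(a)=wS_0(a)w^{-1}$ with $w=m(\mathrm{Id}\otimes S_0)(\mathcal F)$ (here $m$ is the product map) invertible, and $\varepsilon=\varepsilon_0$, gives a noncommutative and noncocommutative Hopf algebra over $\mathcal K[t]_p^{(q)}$ with the algebra structure of $\mathbf u_{t,q}(\mathbf W(n;\underline 1))$ undeformed. For all $0\le\alpha\le\tau$ and $1\le i\le n$, $$\Delta(x^{(\alpha)}D_i)=x^{(\alpha)}D_i\otimes(1-e(k)t)^{\alpha_k-\delta_{ik}}(1-e(m)t)^{\alpha_m-\delta_{im}}$$ $$\qquad+\sum_{\ell,s=0}^{p-1}(-1)^{\ell+s}\,h(k)^{\langle\ell\rangle}h(m)^{\langle s\rangle}\otimes(1-e(k)t)^{-\ell}(1-e(m)t)^{-s}\,d_k^{(\ell)}d_m^{(s)}(x^{(\alpha)}D_i)\,t^{\ell+s},$$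 $$S(x^{(\alpha)}D_i)=-(1-e(k)t)^{\delta_{ik}-\alpha_k}(1-e(m)t)^{\delta_{im}-\alpha_m}\sum_{\ell,s=0}^{p-1}d_k^{(\ell)}d_m^{(s)}(x^{(\alpha)}D_i)\,h(k)_1^{\langle\ell\rangle}h(m)_1^{\langle s\rangle}\,t^{\ell+s},$$ $$\varepsilon(x^{(\alpha)}D_i)=0 .$$ Moreover $\mathbf u_{t,q}(\mathbf W(n;\underline 1))$ is finite dimensional over $\mathcal K$, of dimension $p^{1+np^n}$. -/

import Mathlib

open scoped TensorProduct Nat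

noncomputable section

namespace JacobsonWitt

/-! ### Hopf algebra structures on a fixed algebra, and Drinfel'd twists -/

/-- A Hopf algebra structure over `R` on a given `R`-algebra `A`, with the product and unit of `A`:
comultiplication, counit and antipode together with the Hopf algebra axioms. -/
structure HopfStructure (R A : Type*) [CommRing R] [Ring A] [Algebra R A] where
  comul : A →ₐ[R] A ⊗[R] A
  counit : A →ₐ[R] R
  antipode : A →ₗ[R] A
  coassoc : (Algebra.TensorProduct.assoc R R R A A A).toAlgHom.comp
      ((Algebra.TensorProduct.map comul (.id R A)).comp comul)
      = (Algebra.TensorProduct.map (.id R A) comul).comp comul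
  rTensor_counit : (Algebra.TensorProduct.map counit (.id R A)).comp comul
      = (Algebra.TensorProduct.lid R A).symm
  lTensor_counit : (Algebra.TensorProduct.map (.id R A) counit).comp comul
      = (Algebra.TensorProduct.rid R R A).symm
  mul_antipode_rTensor : LinearMap.mul' R A ∘ₗ antipode.rTensor A ∘ₗ comul.toLinearMap
      = Algebra.linearMap R A ∘ₗ counit.toLinearMap
  mul_antipode_lTensor : LinearMap.mul' R A ∘ₗ antipode.lTensor A ∘ₗ comul.toLinearMap
      = Algebra.linearMap R A ∘ₗ counit.toLinearMap

/-- A `HopfStructure` is the same thing as a Mathlib Hopf algebra extending the given algebra. -/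
abbrev HopfStructure.toHopfAlgebra {R A : Type*} [CommRing R] [Ring A] [Algebra R A]
    (H : HopfStructure R A) : HopfAlgebra R A :=
  { Bialgebra.ofAlgHom H.comul H.counit H.coassoc H.rTensor_counit H.lTensor_counit with
    antipode := H.antipode
    mul_antipode_rTensor_comul := H.mul_antipode_rTensor
    mul_antipode_lTensor_comul := H.mul_antipode_lTensor }

/-- `F` is a Drinfel'd twist on the Hopf algebra `A`: it is invertible, satisfies the cocycle
identity `(F ⊗ 1)(Δ ⊗ id)(F) = (1 ⊗ F)(id ⊗ Δ)(F)` and is normalized by the counit. -/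
structure IsDrinfeldTwist (R : Type*) {A : Type*} [CommRing R] [Ring A] [HopfAlgebra R A]
    (F : A ⊗[R] A) : Prop where
  isUnit : IsUnit F
  cocycle : Algebra.TensorProduct.assoc R R R A A A ((F ⊗ₜ[R] (1 : A)) *
        Algebra.TensorProduct.map (Bialgebra.comulAlgHom R A) (.id R A) F)
      = ((1 : A) ⊗ₜ[R] F) *
        Algebra.TensorProduct.map (.id R A) (Bialgebra.comulAlgHom R A) F
  counit_left : Algebra.TensorProduct.lid R A
      (Algebra.TensorProduct.map (Bialgebra.counitAlgHom R A) (.id R A) F) = 1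
  counit_right : Algebra.TensorProduct.rid R R A
      (Algebra.TensorProduct.map (.id R A) (Bialgebra.counitAlgHom R A) F) = 1

/-- The element `w = m (id ⊗ S₀)(F)` attached to `F`. -/
def twistElement (R : Type*) {A : Type*} [CommRing R] [Ring A] [HopfAlgebra R A]
    (F : A ⊗[R] A) : A :=
  LinearMap.mul' R A ((HopfAlgebra.antipode R (A := A)).lTensor A F)

/-- `H` is the twisting of the Hopf algebra `A` by the Drinfel'd twist `F`:
`Δ(a) = F Δ₀(a) F⁻¹`, `ε = ε₀`, and `S(a) = w S₀(a) w⁻¹` with `w = m (id ⊗ S₀)(F)`. -/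
structure IsTwisting {R A : Type*} [CommRing R] [Ring A] [HopfAlgebra R A]
    (H : HopfStructure R A) (F : A ⊗[R] A) : Prop where
  isDrinfeldTwist : IsDrinfeldTwist R F
  comul_eq (a : A) : H.comul a = F * Coalgebra.comul (R := R) a * Ring.inverse F
  counit_eq (a : A) : H.counit a = Coalgebra.counit (R := R) a
  isUnit_twistElement : IsUnit (twistElement R F)
  antipode_eq (a : A) : H.antipode a =
    twistElement R F * HopfAlgebra.antipode R a * Ring.inverse (twistElement R F)

/-- `x_a^{⟨r⟩} = (x + a)(x + a + 1)⋯(x + a + r - 1)`. -/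
def rising {A : Type*} [Ring A] (x a : A) (r : ℕ) : A :=
  ((List.range r).map fun j : ℕ => x + a + (j : A)).prod

/-- `x_a^{[r]} = (x + a)(x + a - 1)⋯(x + a - r + 1)`. -/
def falling {A : Type*} [Ring A] (x a : A) (r : ℕ) : A :=
  ((List.range r).map fun j : ℕ => x + a - (j : A)).prod

/-! ### The restricted divided power algebra and the Jacobson-Witt algebra -/

section Witt

variable (K : Type*) [Field K] (p n : ℕ)

/-- `O(n; 1)`, realized for `char K = p` as the truncated polynomial algebra
`K[x₁, …, xₙ] / (x₁ᵖ, …, xₙᵖ)`, with divided powers `x^(α) = x^α / α!` (see `dp`, `dp_mul_dp`). -/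
abbrev O : Type _ :=
  MvPolynomial (Fin n) K ⧸
    Ideal.span (Set.range fun i : Fin n => (MvPolynomial.X i : MvPolynomial (Fin n) K) ^ p)

/-- The divided power `x^(α) = x^α / α!`; it is `0` as soon as some `α j ≥ p`. -/
def dp (α : Fin n → ℕ) : O K p n :=
  (∏ j, ((α j)! : K))⁻¹ • Ideal.Quotient.mk _ (∏ j, MvPolynomial.X j ^ α j)

/-- `W(n; 1) = Der_K O(n; 1)`, with the commutator bracket. -/
abbrev W : Type _ := Derivation K (O K p n) (O K p n)

/-- The multiplication rule `x^(α) x^(β) = binom(α + β, α) x^(α + β)` of divided powers. -/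
theorem dp_mul_dp [CharP K p] [Fact p.Prime] (α β : Fin n → ℕ) (hα : ∀ j, α j < p)
    (hβ : ∀ j, β j < p) :
    dp K p n α * dp K p n β = (∏ j, ((α j + β j).choose (α j) : K)) • dp K p n (α + β) := by
  have key : ∀ m < p, (m ! : K) ≠ 0 := fun m hm h => by
    rw [CharP.cast_eq_zero_iff K p, (Fact.out : p.Prime).dvd_factorial] at h
    omega
  have hmon : Ideal.Quotient.mk (Ideal.span (Set.range fun i : Fin n =>
      (MvPolynomial.X i : MvPolynomial (Fin n) K) ^ p)) (∏ j, MvPolynomial.X j ^ (α + β) j) =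
      Ideal.Quotient.mk _ (∏ j, MvPolynomial.X j ^ α j) *
        Ideal.Quotient.mk _ (∏ j, MvPolynomial.X j ^ β j) := by
    rw [← map_mul, ← Finset.prod_mul_distrib]
    simp only [Pi.add_apply, pow_add]
  unfold dp
  rw [smul_mul_smul_comm, ← hmon]
  by_cases h : ∀ j, α j + β j < p
  · rw [smul_smul]
    congr 1
    rw [← mul_inv, ← Finset.prod_mul_distrib, ← div_eq_mul_inv, eq_div_iff, inv_mul_eq_iff_eq_mul₀,
      ← Finset.prod_mul_distrib]
    · refine Finset.prod_congr rfl fun j _ => ?_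
      rw [Pi.add_apply, ← Nat.add_choose_mul_factorial_mul_factorial (α j) (β j),
        ← Nat.choose_symm_add]
      push_cast
      ring
    · exact Finset.prod_ne_zero_iff.2 fun j _ => mul_ne_zero (key _ (hα j)) (key _ (hβ j))
    · exact Finset.prod_ne_zero_iff.2 fun j _ => key _ (h j)
  · push Not at h
    obtain ⟨j, hj⟩ := h
    have h0 : Ideal.Quotient.mk (Ideal.span (Set.range fun i : Fin n =>
      (MvPolynomial.X i : MvPolynomial (Fin n) K) ^ p)) (∏ j, MvPolynomial.X j ^ (α + β) j) = 0 := by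
      rw [Ideal.Quotient.eq_zero_iff_mem]
      refine Ideal.mem_of_dvd _ (Finset.dvd_prod_of_mem _ (Finset.mem_univ j)) ?_
      exact Ideal.mem_of_dvd _ (pow_dvd_pow _ hj) (Ideal.subset_span ⟨j, rfl⟩)
    rw [h0, smul_zero, smul_zero, smul_zero]

variable [CharP K p]

theorem mk_pderiv_eq_zero (j : Fin n) (f : MvPolynomial (Fin n) K)
    (hf : Ideal.Quotient.mkₐ K (Ideal.span (Set.range fun i : Fin n =>
      (MvPolynomial.X i : MvPolynomial (Fin n) K) ^ p)) f = 0) :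
    Ideal.Quotient.mkₐ K (Ideal.span (Set.range fun i : Fin n =>
      (MvPolynomial.X i : MvPolynomial (Fin n) K) ^ p)) (MvPolynomial.pderiv j f) = 0 := by
  simp only [Ideal.Quotient.mkₐ_eq_mk, Ideal.Quotient.eq_zero_iff_mem] at hf ⊢
  induction hf using Submodule.span_induction with
  | mem x hx =>
    obtain ⟨i, rfl⟩ := hx
    have : (p : MvPolynomial (Fin n) K) = 0 := CharP.cast_eq_zero _ p
    simp
  | zero => simp
  | add x y _ _ hx hy => simpa using Ideal.add_mem _ hx hy
  | smul a x hx' hx =>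
    rw [smul_eq_mul, MvPolynomial.pderiv_mul]
    exact Ideal.add_mem _ (Ideal.mul_mem_left _ _ hx') (Ideal.mul_mem_left _ _ hx)

/-- The derivation `D_j = ∂/∂x_j` of `O(n; 1)`. -/
def D (j : Fin n) : W K p n :=
  Derivation.liftOfSurjective (d := MvPolynomial.pderiv j)
    (Ideal.Quotient.mkₐ_surjective K (Ideal.span (Set.range fun i : Fin n =>
      (MvPolynomial.X i : MvPolynomial (Fin n) K) ^ p)))
    (mk_pderiv_eq_zero K p n j)

theorem D_mk (j : Fin n) (g : MvPolynomial (Fin n) K) :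
    D K p n j (Ideal.Quotient.mk _ g) = Ideal.Quotient.mk _ (MvPolynomial.pderiv j g) :=
  Derivation.liftOfSurjective_apply
    (Ideal.Quotient.mkₐ_surjective K (Ideal.span (Set.range fun i : Fin n =>
      (MvPolynomial.X i : MvPolynomial (Fin n) K) ^ p)))
    (mk_pderiv_eq_zero K p n j) g

/-- The basis element `x^(α) D_i` of `W(n; 1)`. -/
def xD (α : Fin n → ℕ) (i : Fin n) : W K p n := dp K p n α • D K p n i

/-- `h(k) = x^(ε_k) D_k`. -/
def hW (k : Fin n) : W K p n := xD K p n (Pi.single k 1) k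

/-- `e(k) = 2 x^(2 ε_k) D_k`. -/
def eW (k : Fin n) : W K p n := (2 : K) • xD K p n (Pi.single k 2) k

/-- `d_k^(ℓ) = (ad e(k))^ℓ / ℓ!`, used for `ℓ < p`. -/
def dW (k : Fin n) (l : ℕ) : Module.End K (W K p n) :=
  ((l ! : K)⁻¹) • (LieAlgebra.ad K (W K p n) (eW K p n k)) ^ l

/-! ### The restricted universal enveloping algebra -/

/-- The defining relations of `u(W(n; 1))` as a quotient of `U(W(n; 1))`:
`(x^(ε_i) D_i)^p = x^(ε_i) D_i`, and `(x^(α) D_i)^p = 0` for `α ≠ ε_i`, `0 ≤ α ≤ τ`. -/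
inductive Rel : UniversalEnvelopingAlgebra K (W K p n) →
    UniversalEnvelopingAlgebra K (W K p n) → Prop
  | toral (i : Fin n) :
      Rel (UniversalEnvelopingAlgebra.ι K (xD K p n (Pi.single i 1) i) ^ p)
        (UniversalEnvelopingAlgebra.ι K (xD K p n (Pi.single i 1) i))
  | nilp (α : Fin n → ℕ) (i : Fin n) (hα : ∀ j, α j ≤ p - 1) (hne : α ≠ Pi.single i 1) :
      Rel (UniversalEnvelopingAlgebra.ι K (xD K p n α i) ^ p) 0

/-- The restricted universal enveloping algebra `u(W(n; 1)) = U(W(n; 1)) / I`. -/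
def u : Type _ := RingQuot (Rel K p n)

instance : Ring (u K p n) := inferInstanceAs (Ring (RingQuot (Rel K p n)))

instance : Algebra K (u K p n) := inferInstanceAs (Algebra K (RingQuot (Rel K p n)))

/-- The quotient map `U(W(n; 1)) → u(W(n; 1))`. -/
def mkU : UniversalEnvelopingAlgebra K (W K p n) →ₐ[K] u K p n :=
  RingQuot.mkAlgHom K (Rel K p n)

attribute [local instance 100] LieRing.ofAssociativeRing

/-- The canonical map `W(n; 1) → u(W(n; 1))`. -/
def ι : W K p n →ₗ[K] u K p n :=
  (mkU K p n).toLinearMap ∘ₗ (UniversalEnvelopingAlgebra.ι K (L := W K p n)).toLinearMap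

theorem ι_lie (x y : W K p n) :
    ι K p n ⁅x, y⁆ = ι K p n x * ι K p n y - ι K p n y * ι K p n x := by
  change mkU K p n (UniversalEnvelopingAlgebra.ι K ⁅x, y⁆) = _
  rw [LieHom.map_lie, LieRing.of_associative_ring_bracket, map_sub, map_mul, map_mul]
  rfl

theorem ι_toral (i : Fin n) :
    ι K p n (xD K p n (Pi.single i 1) i) ^ p = ι K p n (xD K p n (Pi.single i 1) i) := by
  change mkU K p n _ ^ p = mkU K p n _
  rw [← map_pow]
  exact RingQuot.mkAlgHom_rel K (Rel.toral i)

theorem ι_nilp (α : Fin n → ℕ) (i : Fin n) (hα : ∀ j, α j ≤ p - 1) (hne : α ≠ Pi.single i 1) :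
    ι K p n (xD K p n α i) ^ p = 0 := by
  change mkU K p n _ ^ p = 0
  rw [← map_pow, ← map_zero (mkU K p n)]
  exact RingQuot.mkAlgHom_rel K (Rel.nilp α i hα hne)

section Lift

variable {K p n} {B : Type*} [Ring B] [Algebra K B]

/-- The universal property of `u(W(n; 1))`. -/
def lift (f : W K p n →ₗ[K] B) (hf : ∀ x y, f ⁅x, y⁆ = f x * f y - f y * f x)
    (ht : ∀ i, f (xD K p n (Pi.single i 1) i) ^ p = f (xD K p n (Pi.single i 1) i))
    (hn : ∀ (α : Fin n → ℕ) (i : Fin n), (∀ j, α j ≤ p - 1) → α ≠ Pi.single i 1 →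
      f (xD K p n α i) ^ p = 0) : u K p n →ₐ[K] B :=
  RingQuot.liftAlgHom K (s := Rel K p n)
    ⟨UniversalEnvelopingAlgebra.lift K { f with map_lie' := fun {x y} => hf x y }, by
      intro x y h
      induction h with
      | toral i =>
        rw [map_pow, UniversalEnvelopingAlgebra.lift_ι_apply]
        exact ht i
      | nilp α i hα hne =>
        rw [map_pow, UniversalEnvelopingAlgebra.lift_ι_apply, map_zero]
        exact hn α i hα hne⟩

theorem lift_ι (f : W K p n →ₗ[K] B) (hf) (ht) (hn) (x : W K p n) :
    lift f hf ht hn (ι K p n x) = f x := by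
  refine (RingQuot.liftAlgHom_mkAlgHom_apply K _ _ _).trans ?_
  exact UniversalEnvelopingAlgebra.lift_ι_apply K _ x

theorem algHom_ext {f g : u K p n →ₐ[K] B} (h : ∀ x, f (ι K p n x) = g (ι K p n x)) : f = g := by
  refine RingQuot.ringQuot_ext' K _ _ ?_
  refine UniversalEnvelopingAlgebra.hom_ext K ?_
  ext x
  exact h x

theorem mem_of_ι_mem (S : Subalgebra K (u K p n)) (h : ∀ x, ι K p n x ∈ S) (a : u K p n) :
    a ∈ S := by
  let f : u K p n →ₐ[K] S := lift ((ι K p n).codRestrict (Subalgebra.toSubmodule S) h)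
    (fun x y => Subtype.ext (ι_lie K p n x y)) (fun i => Subtype.ext (ι_toral K p n i))
    (fun α i hα hne => Subtype.ext (ι_nilp K p n α i hα hne))
  have hf : S.val.comp f = AlgHom.id K _ := algHom_ext fun x => by
    change ((f (ι K p n x) : S) : u K p n) = ι K p n x
    rw [lift_ι]
    rfl
  rw [← AlgHom.id_apply (R := K) a, ← hf]
  exact (f a).2

end Lift

section Hopf

variable [Fact p.Prime]

theorem primitive_pow (a : u K p n) :
    (a ⊗ₜ[K] (1 : u K p n) + (1 : u K p n) ⊗ₜ[K] a) ^ p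
      = (a ^ p) ⊗ₜ[K] (1 : u K p n) + (1 : u K p n) ⊗ₜ[K] (a ^ p) := by
  nontriviality u K p n ⊗[K] u K p n
  have : CharP (u K p n ⊗[K] u K p n) p :=
    charP_of_injective_algebraMap (algebraMap K _).injective p
  rw [add_pow_char_of_commute]
  · simp [Algebra.TensorProduct.tmul_pow]
  · simp [Commute, SemiconjBy]

theorem prime_ne_zero : p ≠ 0 := (Fact.out : p.Prime).ne_zero

/-- The standard coproduct, `x ↦ x ⊗ 1 + 1 ⊗ x` on `W(n; 1)`. -/
def comul₀ : u K p n →ₐ[K] u K p n ⊗[K] u K p n :=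
  lift ((Algebra.TensorProduct.includeLeft (R := K) (S := K)).toLinearMap ∘ₗ ι K p n +
      (Algebra.TensorProduct.includeRight (R := K)).toLinearMap ∘ₗ ι K p n)
    (fun x y => by
      simp only [LinearMap.add_apply, LinearMap.comp_apply, AlgHom.toLinearMap_apply,
        Algebra.TensorProduct.includeLeft_apply, Algebra.TensorProduct.includeRight_apply, ι_lie,
        TensorProduct.sub_tmul, TensorProduct.tmul_sub, mul_add, add_mul,
        Algebra.TensorProduct.tmul_mul_tmul, mul_one, one_mul]
      abel)
    (fun i => by
      simp only [LinearMap.add_apply, LinearMap.comp_apply, AlgHom.toLinearMap_apply,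
        Algebra.TensorProduct.includeLeft_apply, Algebra.TensorProduct.includeRight_apply,
        primitive_pow, ι_toral])
    (fun α i hα hne => by
      simp only [LinearMap.add_apply, LinearMap.comp_apply, AlgHom.toLinearMap_apply,
        Algebra.TensorProduct.includeLeft_apply, Algebra.TensorProduct.includeRight_apply,
        primitive_pow, ι_nilp K p n α i hα hne, TensorProduct.zero_tmul, TensorProduct.tmul_zero,
        add_zero])

theorem comul₀_ι (x : W K p n) : comul₀ K p n (ι K p n x)
    = ι K p n x ⊗ₜ[K] (1 : u K p n) + (1 : u K p n) ⊗ₜ[K] ι K p n x :=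
  lift_ι _ _ _ _ x

/-- The standard counit, zero on `W(n; 1)`. -/
def counit₀ : u K p n →ₐ[K] K :=
  lift 0 (fun x y => by simp) (fun i => by simp [prime_ne_zero p])
    (fun α i hα hne => by simp [prime_ne_zero p])

theorem counit₀_ι (x : W K p n) : counit₀ K p n (ι K p n x) = 0 :=
  lift_ι _ _ _ _ x

theorem neg_pow_prime (a : u K p n) : (-a) ^ p = -a ^ p := by
  nontriviality u K p n
  have : CharP (u K p n) p := charP_of_injective_algebraMap (algebraMap K _).injective p
  have h := add_pow_char_of_commute (p := p) (Commute.neg_right (Commute.refl a))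
  rw [add_neg_cancel, zero_pow (prime_ne_zero p)] at h
  exact eq_neg_of_add_eq_zero_right h.symm

/-- The standard antipode as an algebra map to the opposite algebra. -/
def antipodeOp₀ : u K p n →ₐ[K] (u K p n)ᵐᵒᵖ :=
  lift (-((MulOpposite.opLinearEquiv K).toLinearMap ∘ₗ ι K p n))
    (fun x y => by
      apply MulOpposite.unop_injective
      simp [ι_lie])
    (fun i => by
      apply MulOpposite.unop_injective
      simp [neg_pow_prime, ι_toral])
    (fun α i hα hne => by
      apply MulOpposite.unop_injective
      simp [neg_pow_prime, ι_nilp K p n α i hα hne])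

/-- The standard antipode: the anti-automorphism that is `x ↦ -x` on `W(n; 1)`. -/
def antipode₀ : u K p n →ₗ[K] u K p n :=
  (MulOpposite.opLinearEquiv K).symm.toLinearMap ∘ₗ (antipodeOp₀ K p n).toLinearMap

theorem antipode₀_ι (x : W K p n) : antipode₀ K p n (ι K p n x) = -ι K p n x := by
  apply MulOpposite.op_injective
  exact lift_ι _ _ _ _ x

theorem antipode₀_mul (a b : u K p n) :
    antipode₀ K p n (a * b) = antipode₀ K p n b * antipode₀ K p n a := by
  simp [antipode₀]

theorem antipode₀_one : antipode₀ K p n 1 = 1 := by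
  simp [antipode₀]

theorem antipode₀_rTensor (a : u K p n) :
    LinearMap.mul' K _ ((antipode₀ K p n).rTensor _ (comul₀ K p n a))
      = algebraMap K _ (counit₀ K p n a) := by
  let T : Subalgebra K (u K p n) :=
    { carrier := {a | ∀ z, LinearMap.mul' K _ ((antipode₀ K p n).rTensor _ (comul₀ K p n a * z))
        = counit₀ K p n a • LinearMap.mul' K _ ((antipode₀ K p n).rTensor _ z)}
      mul_mem' := fun {a b} ha hb z => by
        rw [map_mul (comul₀ K p n), mul_assoc, ha, hb, smul_smul, map_mul]
      add_mem' := fun {a b} ha hb z => by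
        rw [map_add, add_mul, map_add, map_add, ha, hb, map_add, add_smul]
      algebraMap_mem' := fun r z => by
        rw [AlgHom.commutes, AlgHom.commutes, ← Algebra.smul_def, map_smul, map_smul]
        rfl }
  have h := mem_of_ι_mem T (fun x z => by
    rw [comul₀_ι, counit₀_ι, zero_smul]
    induction z with
    | zero => simp
    | add z w hz hw => rw [mul_add, map_add, map_add, hz, hw, add_zero]
    | tmul b c =>
      simp [add_mul, antipode₀_mul, antipode₀_ι, mul_assoc]) a 1
  rw [mul_one] at h
  rw [h, Algebra.algebraMap_eq_smul_one, Algebra.TensorProduct.one_def]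
  simp [antipode₀_one]

theorem antipode₀_lTensor (a : u K p n) :
    LinearMap.mul' K _ ((antipode₀ K p n).lTensor _ (comul₀ K p n a))
      = algebraMap K _ (counit₀ K p n a) := by
  let T : Subalgebra K (u K p n) :=
    { carrier := {a | ∀ z, LinearMap.mul' K _ ((antipode₀ K p n).lTensor _ (z * comul₀ K p n a))
        = counit₀ K p n a • LinearMap.mul' K _ ((antipode₀ K p n).lTensor _ z)}
      mul_mem' := fun {a b} ha hb z => by
        rw [map_mul (comul₀ K p n), ← mul_assoc, hb, ha, smul_smul, map_mul, mul_comm]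
      add_mem' := fun {a b} ha hb z => by
        rw [map_add, mul_add, map_add, map_add, ha, hb, map_add, add_smul]
      algebraMap_mem' := fun r z => by
        rw [AlgHom.commutes, AlgHom.commutes, ← Algebra.commutes, ← Algebra.smul_def, map_smul,
          map_smul]
        rfl }
  have h := mem_of_ι_mem T (fun x z => by
    rw [comul₀_ι, counit₀_ι, zero_smul]
    induction z with
    | zero => simp
    | add z w hz hw => rw [add_mul, map_add, map_add, hz, hw, add_zero]
    | tmul b c =>
      simp [mul_add, antipode₀_mul, antipode₀_ι, mul_assoc]) a 1
  rw [one_mul] at h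
  rw [h, Algebra.algebraMap_eq_smul_one, Algebra.TensorProduct.one_def]
  simp [antipode₀_one]

/-- The standard Hopf algebra structure of `u(W(n; 1))`: elements of `W(n; 1)` are primitive. -/
instance : HopfAlgebra K (u K p n) :=
  { Bialgebra.ofAlgHom (comul₀ K p n) (counit₀ K p n)
      (algHom_ext fun x => by
        simp [comul₀_ι, TensorProduct.add_tmul, TensorProduct.tmul_add,
          Algebra.TensorProduct.one_def, add_assoc])
      (algHom_ext fun x => by simp [comul₀_ι, counit₀_ι])
      (algHom_ext fun x => by simp [comul₀_ι, counit₀_ι]) with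
    antipode := antipode₀ K p n
    mul_antipode_rTensor_comul := LinearMap.ext fun a => antipode₀_rTensor K p n a
    mul_antipode_lTensor_comul := LinearMap.ext fun a => antipode₀_lTensor K p n a }

/-! ### The algebra `u_{t,q}(W(n; 1))` and the basic twists -/

/-- `K[t]_p^(q) = K[t] / (t^p - q t)`. -/
abbrev Kt (q : K) : Type _ :=
  AdjoinRoot ((Polynomial.X : Polynomial K) ^ p - Polynomial.C q * Polynomial.X)

/-- `u_{t,q}(W(n; 1)) = K[t]_p^(q) ⊗_K u(W(n; 1))`, with its standard Hopf algebra structure over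
`K[t]_p^(q)`, extended from `u(W(n; 1))` by scalars. -/
abbrev utq (q : K) : Type _ := Kt K p q ⊗[K] u K p n

variable (q : K)

/-- The element `t` of `u_{t,q}(W(n; 1))`. -/
def tA : utq K p n q :=
  algebraMap (Kt K p q) (utq K p n q) (AdjoinRoot.root _)

/-- The inclusion of `W(n; 1)` in `u_{t,q}(W(n; 1))`. -/
def ιA : W K p n →ₗ[K] utq K p n q :=
  (Algebra.TensorProduct.includeRight (R := K) (A := Kt K p q) (B := u K p n)).toLinearMap ∘ₗ
    ι K p n

/-- `h(k)` in `u_{t,q}(W(n; 1))`. -/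
def hA (k : Fin n) : utq K p n q := ιA K p n q (hW K p n k)

/-- `e(k)` in `u_{t,q}(W(n; 1))`. -/
def eA (k : Fin n) : utq K p n q := ιA K p n q (eW K p n k)

theorem eA_mul_tA_pow (k : Fin n) : (eA K p n q k * tA K p n q) ^ p = 0 := by
  have hc : Commute (eA K p n q k) (tA K p n q) := (Algebra.commutes _ _).symm
  have he : ι K p n (eW K p n k) ^ p = 0 := by
    by_cases hp : p = 2
    · have : (2 : K) = 0 := by
        have := CharP.cast_eq_zero K p
        rw [hp] at this
        exact_mod_cast this
      rw [eW, this, zero_smul, map_zero, zero_pow (prime_ne_zero p)]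
    · rw [eW, map_smul, smul_pow, ι_nilp, smul_zero]
      · intro i
        have := (Fact.out : p.Prime).two_le
        rcases eq_or_ne i k with rfl | hi
        · rw [Pi.single_eq_same]
          omega
        · rw [Pi.single_eq_of_ne hi]
          omega
      · intro hh
        have := congrFun hh k
        simp at this
  rw [hc.mul_pow]
  have : eA K p n q k ^ p = 0 := by
    change ((1 : Kt K p q) ⊗ₜ[K] ι K p n (eW K p n k)) ^ p = 0
    rw [Algebra.TensorProduct.tmul_pow, he, TensorProduct.tmul_zero]
  rw [this, zero_mul]

/-- The invertible element `1 - e(k) t`. -/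
def oneSub (k : Fin n) : (utq K p n q)ˣ :=
  (IsNilpotent.isUnit_one_sub ⟨p, eA_mul_tA_pow K p n q k⟩).unit

theorem oneSub_val (k : Fin n) : (oneSub K p n q k : utq K p n q) = 1 - eA K p n q k * tA K p n q := rfl

/-- The basic twist `F(k) = ∑_r (-1)^r / r! h(k)^[r] ⊗ e(k)^r t^r`; the sum stops at `r = p - 1`
because `e(k)^p = 0`. -/
def basicTwist (k : Fin n) : utq K p n q ⊗[Kt K p q] utq K p n q :=
  ∑ r ∈ Finset.range p, (((-1) ^ r * (r ! : K)⁻¹) • falling (hA K p n q k) 0 r)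
    ⊗ₜ[Kt K p q] (eA K p n q k ^ r * tA K p n q ^ r)

end Hopf

end Witt

end JacobsonWitt

end

open JacobsonWitt

/-! Fix one pair `h, e` and put `g = 1 - e t`. Because `h ^ p = h`, the elements `π_i = 1 - (h -
i)^(p-1)`, for `i` modulo `p`, are orthogonal idempotents with sum `1` and `h π_i = i π_i`. On `π_i`
the element `h^[r] / r!` acts as `binom(i, r)`, so the binomial theorem rewrites the basic twist as
`F = ∑ π_i ⊗ g^i` (`sum_falling_tmul_pow`). Since `g ^ p = 1`, exponents matter only modulo `p`, and
every identity can be checked one eigenvalue at a time.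

In this form `F⁻¹ = ∑ π_i ⊗ g^(-i)`, and the cocycle identity reduces to `F Δ₀(g) = (g ⊗ g) F`
(`IsTwistPair.twistSum_mul_comul`). If `x` has weight `c` under `ad h`, conjugation by `F` sends `x
⊗ 1` to `x ⊗ g^c`. For `1 ⊗ x` one expands `g^(-j) x` in divided powers of `ad (e t)`; the
coefficients are, up to sign, the eigenvalues of the rising factorials of `h`
(`IsTwistPair.twistSum_mul_one_tmul`). For the antipode, `w = ∑ π_i (1 + e t)^i` satisfies `g w (1 +
e t) = w`, and the same expansion computes `w x w⁻¹` (`IsTwistPair.antipodeSum_mul`). The pairs for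
`k ≠ m` commute, so the product of the two twists is again a twist and the formulas compose.

That a Drinfel'd twist yields a Hopf algebra is proved in general: `w = m(id ⊗ S)(F)` has inverse
`m(S ⊗ id)(F⁻¹)`, by contracting the cocycle identity with antipodes.

The dimension is a restricted Poincaré-Birkhoff-Witt theorem. Straightening of words gives spanning.
For independence, the natural representation on `O(n; 1)` embeds `W(n; 1)` in `u(W(n; 1))`; its
elements are primitive, and applying `(f ⊗ id) Δ` for functionals `f` with `f 1 = 0` lowers the
degree of a linear relation between ordered monomials. Coefficient functionals of the same
representation show that `Δ(h(k))` is not symmetric. -/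

noncomputable section

namespace JacobsonWitt

/-! ### Twisting a Hopf algebra by a general Drinfel'd twist. -/

section Twisting

open HopfAlgebra Algebra.TensorProduct

variable {R A : Type*} [CommRing R] [Ring A] [HopfAlgebra R A]

variable (R A) in
/-- `Δ ⊗ id` followed by the associator, as an algebra map to `A ⊗ (A ⊗ A)`. -/
def comulLeft : A ⊗[R] A →ₐ[R] A ⊗[R] (A ⊗[R] A) :=
  (Algebra.TensorProduct.assoc R R R A A A).toAlgHom.comp
    (Algebra.TensorProduct.map (Bialgebra.comulAlgHom R A) (.id R A))

variable (R A) in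
/-- `id ⊗ Δ`, as an algebra map to `A ⊗ (A ⊗ A)`. -/
def comulRight : A ⊗[R] A →ₐ[R] A ⊗[R] (A ⊗[R] A) :=
  Algebra.TensorProduct.map (.id R A) (Bialgebra.comulAlgHom R A)

variable (R A) in
/-- `z ↦ z ⊗ 1`, as an algebra map to `A ⊗ (A ⊗ A)`. -/
def inclLeft : A ⊗[R] A →ₐ[R] A ⊗[R] (A ⊗[R] A) :=
  Algebra.TensorProduct.map (.id R A) includeLeft

variable (R A) in
/-- `z ↦ 1 ⊗ z`, as an algebra map to `A ⊗ (A ⊗ A)`. -/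
def inclRight : A ⊗[R] A →ₐ[R] A ⊗[R] (A ⊗[R] A) :=
  includeRight

theorem inclLeft_tmul (a b : A) : inclLeft R A (a ⊗ₜ b) = a ⊗ₜ[R] (b ⊗ₜ[R] (1 : A)) := rfl

theorem inclRight_apply (z : A ⊗[R] A) : inclRight R A z = (1 : A) ⊗ₜ[R] z := rfl

theorem comulRight_tmul (a b : A) :
    comulRight R A (a ⊗ₜ b) = a ⊗ₜ[R] Bialgebra.comulAlgHom R A b := rfl

/-- Isolating `Δ(a)` inside `inclLeft` lets later inductions replace it by an arbitrary tensor. -/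
theorem comulLeft_tmul (a b : A) :
    comulLeft R A (a ⊗ₜ b) = inclLeft R A (Bialgebra.comulAlgHom R A a) *
      inclRight R A ((1 : A) ⊗ₜ[R] b) := by
  change Algebra.TensorProduct.assoc R R R A A A (Bialgebra.comulAlgHom R A a ⊗ₜ[R] b) = _
  induction Bialgebra.comulAlgHom R A a with
  | zero => simp
  | add x y hx hy => rw [TensorProduct.add_tmul, map_add, map_add, hx, hy, add_mul]
  | tmul x y => simp [inclLeft_tmul, inclRight_apply]

theorem assoc_tmul_one (z : A ⊗[R] A) :
    Algebra.TensorProduct.assoc R R R A A A (z ⊗ₜ[R] (1 : A)) = inclLeft R A z := by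
  induction z with
  | zero => simp
  | add x y hx hy => rw [TensorProduct.add_tmul, map_add, map_add, hx, hy]
  | tmul x y => rfl

/-- Phrases the cocycle identity through four algebra maps, so that products and inverses of twists
are handled by `map_mul`. -/
theorem cocycle_iff (F : A ⊗[R] A) :
    Algebra.TensorProduct.assoc R R R A A A ((F ⊗ₜ[R] (1 : A)) *
        Algebra.TensorProduct.map (Bialgebra.comulAlgHom R A) (.id R A) F)
      = ((1 : A) ⊗ₜ[R] F) *
        Algebra.TensorProduct.map (.id R A) (Bialgebra.comulAlgHom R A) F ↔
    inclLeft R A F * comulLeft R A F = inclRight R A F * comulRight R A F := by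
  rw [map_mul, assoc_tmul_one]
  rfl

theorem comulLeft_comul (a : A) :
    comulLeft R A (Bialgebra.comulAlgHom R A a) = comulRight R A (Bialgebra.comulAlgHom R A a) :=
  Coalgebra.coassoc_apply a

variable (R A) in
/-- `a ⊗ b ↦ S(a) b`. -/
def mulAntipodeLeft : A ⊗[R] A →ₗ[R] A := LinearMap.mul' R A ∘ₗ (antipode R).rTensor A

variable (R A) in
/-- `a ⊗ b ↦ a S(b)`. -/
def mulAntipodeRight : A ⊗[R] A →ₗ[R] A := LinearMap.mul' R A ∘ₗ (antipode R).lTensor A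

@[simp] theorem mulAntipodeLeft_tmul (a b : A) :
    mulAntipodeLeft R A (a ⊗ₜ b) = antipode R a * b := rfl

@[simp] theorem mulAntipodeRight_tmul (a b : A) :
    mulAntipodeRight R A (a ⊗ₜ b) = a * antipode R b := rfl

theorem mulAntipodeLeft_comul (a : A) :
    mulAntipodeLeft R A (Bialgebra.comulAlgHom R A a) = algebraMap R A (Coalgebra.counit a) :=
  mul_antipode_rTensor_comul_apply a

theorem mulAntipodeRight_comul (a : A) :
    mulAntipodeRight R A (Bialgebra.comulAlgHom R A a) = algebraMap R A (Coalgebra.counit a) :=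
  mul_antipode_lTensor_comul_apply a

/-- `S(z₁ y₁) z₂ y₂ = S(y₁) (S(z₁) z₂) y₂`. -/
theorem mulAntipodeLeft_mul_tmul (z : A ⊗[R] A) (a b : A) :
    mulAntipodeLeft R A (z * (a ⊗ₜ b)) = antipode R a * mulAntipodeLeft R A z * b := by
  induction z with
  | zero => simp
  | add x y hx hy => rw [add_mul, map_add, map_add, hx, hy, mul_add, add_mul]
  | tmul x y => simp [antipode_mul_antidistrib, mul_assoc]

theorem mulAntipodeRight_tmul_mul (z : A ⊗[R] A) (a b : A) :
    mulAntipodeRight R A ((a ⊗ₜ b) * z) = a * mulAntipodeRight R A z * antipode R b := by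
  induction z with
  | zero => simp
  | add x y hx hy => rw [mul_add, map_add, map_add, hx, hy, mul_add, add_mul]
  | tmul x y => simp [antipode_mul_antidistrib, mul_assoc]

/-- `S(a₁ z₁) a₂ z₂ = S(z₁) (S(a₁) a₂) z₂`: the antipode reverses products, so the two legs of
`Δ(a)` meet and collapse to `ε(a)`. -/
theorem mulAntipodeLeft_comul_mul (a : A) (z : A ⊗[R] A) :
    mulAntipodeLeft R A (Bialgebra.comulAlgHom R A a * z) =
      Coalgebra.counit (R := R) a • mulAntipodeLeft R A z := by
  induction z with
  | zero => simp
  | add x y hx hy => rw [mul_add, map_add, map_add, hx, hy, smul_add]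
  | tmul x y =>
    rw [mulAntipodeLeft_mul_tmul, mulAntipodeLeft_comul, mulAntipodeLeft_tmul,
      ← Algebra.commutes, mul_assoc, ← Algebra.smul_def]

theorem mulAntipodeRight_mul_comul (a : A) (z : A ⊗[R] A) :
    mulAntipodeRight R A (z * Bialgebra.comulAlgHom R A a) =
      Coalgebra.counit (R := R) a • mulAntipodeRight R A z := by
  induction z with
  | zero => simp
  | add x y hx hy => rw [add_mul, map_add, map_add, hx, hy, smul_add]
  | tmul x y =>
    rw [mulAntipodeRight_tmul_mul, mulAntipodeRight_comul, mulAntipodeRight_tmul,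
      ← Algebra.commutes, mul_assoc, ← Algebra.smul_def]

variable (R A) in
/-- `(ε ⊗ id)`, as an algebra map. -/
def counitLeft : A ⊗[R] A →ₐ[R] A :=
  (Algebra.TensorProduct.lid R A).toAlgHom.comp
    (Algebra.TensorProduct.map (Bialgebra.counitAlgHom R A) (.id R A))

variable (R A) in
/-- `(id ⊗ ε)`, as an algebra map. -/
def counitRight : A ⊗[R] A →ₐ[R] A :=
  (Algebra.TensorProduct.rid R R A).toAlgHom.comp
    (Algebra.TensorProduct.map (.id R A) (Bialgebra.counitAlgHom R A))

theorem counitLeft_tmul (a b : A) :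
    counitLeft R A (a ⊗ₜ b) = Coalgebra.counit (R := R) a • b := rfl

theorem counitRight_tmul (a b : A) :
    counitRight R A (a ⊗ₜ b) = Coalgebra.counit (R := R) b • a := rfl

variable (R A) in
/-- `a ⊗ b ⊗ c ↦ S(a) b S(c)`. -/
def antipodeOuter : A ⊗[R] (A ⊗[R] A) →ₗ[R] A :=
  LinearMap.mul' R A ∘ₗ TensorProduct.map (antipode R) (mulAntipodeRight R A)

variable (R A) in
/-- `a ⊗ b ⊗ c ↦ a S(b) c`. -/
def antipodeInner : A ⊗[R] (A ⊗[R] A) →ₗ[R] A :=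
  LinearMap.mul' R A ∘ₗ TensorProduct.map .id (mulAntipodeLeft R A)

theorem antipodeOuter_tmul (a : A) (z : A ⊗[R] A) :
    antipodeOuter R A (a ⊗ₜ z) = antipode R a * mulAntipodeRight R A z := rfl

theorem antipodeInner_tmul (a : A) (z : A ⊗[R] A) :
    antipodeInner R A (a ⊗ₜ z) = a * mulAntipodeLeft R A z := rfl

theorem antipodeOuter_inclLeft_mul_inclRight (x y : A ⊗[R] A) :
    antipodeOuter R A (inclLeft R A x * inclRight R A y) =
      mulAntipodeLeft R A x * mulAntipodeRight R A y := by
  induction x with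
  | zero => simp
  | add x x' hx hx' => rw [map_add, add_mul, map_add, hx, hx', map_add, add_mul]
  | tmul a b =>
    rw [inclLeft_tmul, inclRight_apply, tmul_mul_tmul, mul_one, antipodeOuter_tmul,
      mulAntipodeRight_tmul_mul, antipode_one, mul_one, ← mul_assoc, mulAntipodeLeft_tmul]

theorem antipodeInner_inclRight_mul_inclLeft (x y : A ⊗[R] A) :
    antipodeInner R A (inclRight R A x * inclLeft R A y) =
      mulAntipodeRight R A y * mulAntipodeLeft R A x := by
  induction y with
  | zero => simp
  | add y y' hy hy' => rw [map_add, mul_add, map_add, hy, hy', map_add, add_mul]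
  | tmul a b =>
    rw [inclLeft_tmul, inclRight_apply, tmul_mul_tmul, one_mul, antipodeInner_tmul,
      mulAntipodeLeft_mul_tmul, mul_one, ← mul_assoc, mulAntipodeRight_tmul]

/-- On pure tensors `x = a ⊗ b`, `y = c ⊗ d` this is `S(a₁ c) a₂ d₁ S(b d₂) = S(c) (S(a₁) a₂) (d₁
S(d₂)) S(b) = ε(a) ε(d) S(b c)`. -/
theorem antipodeOuter_comulLeft_mul_comulRight (x y : A ⊗[R] A) :
    antipodeOuter R A (comulLeft R A x * comulRight R A y) =
      antipode R (counitLeft R A x * counitRight R A y) := by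
  induction x with
  | zero => simp
  | add x x' hx hx' => rw [map_add, add_mul, map_add, hx, hx', map_add, add_mul, map_add]
  | tmul a b =>
    induction y with
    | zero => simp
    | add y y' hy hy' => rw [map_add, mul_add, map_add, hy, hy', map_add, mul_add, map_add]
    | tmul c d =>
      rw [comulLeft_tmul, comulRight_tmul, inclRight_apply, mul_assoc, tmul_mul_tmul, one_mul,
        counitLeft_tmul, counitRight_tmul, smul_mul_smul_comm, map_smul, antipode_mul_antidistrib]
      have key (z : A ⊗[R] A) : antipodeOuter R A (inclLeft R A z *
          c ⊗ₜ[R] (((1 : A) ⊗ₜ[R] b) * Bialgebra.comulAlgHom R A d)) =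
          antipode R c * mulAntipodeLeft R A z * (Coalgebra.counit (R := R) d • antipode R b) := by
        induction z with
        | zero => simp
        | add x x' hx hx' => simp only [map_add, add_mul, mul_add, hx, hx']
        | tmul x y =>
          rw [inclLeft_tmul, tmul_mul_tmul, ← mul_assoc, tmul_mul_tmul, one_mul, mul_one,
            antipodeOuter_tmul, mulAntipodeRight_mul_comul, mulAntipodeRight_tmul,
            antipode_mul_antidistrib, mulAntipodeLeft_tmul]
          simp only [mul_smul_comm, mul_assoc]
      rw [key, mulAntipodeLeft_comul, ← Algebra.commutes, mul_assoc, ← Algebra.smul_def,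
        mul_smul_comm, smul_smul]

/-- On pure tensors `x = a ⊗ b`, `y = c ⊗ d` this is `a c₁ S(b₁ c₂) b₂ d = a (c₁ S(c₂)) (S(b₁) b₂) d
= ε(b) ε(c) a d`. -/
theorem antipodeInner_comulRight_mul_comulLeft (x y : A ⊗[R] A) :
    antipodeInner R A (comulRight R A x * comulLeft R A y) =
      counitRight R A x * counitLeft R A y := by
  induction x with
  | zero => simp
  | add x x' hx hx' => rw [map_add, add_mul, map_add, hx, hx', map_add, add_mul]
  | tmul a b =>
    induction y with
    | zero => simp
    | add y y' hy hy' => rw [map_add, mul_add, map_add, hy, hy', map_add, mul_add]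
    | tmul c d =>
      rw [comulLeft_tmul, comulRight_tmul, counitLeft_tmul, counitRight_tmul, inclRight_apply]
      have key (z : A ⊗[R] A) : antipodeInner R A (a ⊗ₜ[R] Bialgebra.comulAlgHom R A b *
          (inclLeft R A z * (1 : A) ⊗ₜ[R] ((1 : A) ⊗ₜ[R] d))) =
          Coalgebra.counit (R := R) b • (a * (mulAntipodeRight R A z * d)) := by
        induction z with
        | zero => simp
        | add x x' hx hx' => simp only [map_add, add_mul, mul_add, hx, hx', smul_add]
        | tmul x y =>
          rw [inclLeft_tmul, tmul_mul_tmul, tmul_mul_tmul, tmul_mul_tmul, one_mul, mul_one,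
            mul_one, antipodeInner_tmul, mulAntipodeLeft_comul_mul, mulAntipodeLeft_tmul,
            mulAntipodeRight_tmul]
          simp only [mul_smul_comm, mul_assoc]
      rw [key, mulAntipodeRight_comul, ← Algebra.smul_def, smul_mul_smul_comm, mul_smul_comm,
        smul_smul]

variable {F G : A ⊗[R] A}

theorem IsDrinfeldTwist.counitLeft_eq (hF : IsDrinfeldTwist R F) : counitLeft R A F = 1 :=
  hF.counit_left

theorem IsDrinfeldTwist.counitRight_eq (hF : IsDrinfeldTwist R F) : counitRight R A F = 1 :=
  hF.counit_right

theorem algHom_eq_one_of_mul_eq_one {B C : Type*} [Ring B] [Algebra R B] [Ring C] [Algebra R C]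
    (f : B →ₐ[R] C) {x y : B} (hx : f x = 1) (hxy : x * y = 1) : f y = 1 := by
  have := congrArg f hxy
  rwa [map_mul, hx, one_mul, map_one] at this

/-- Half of the invertibility of `w`. The cocycle identity rearranges to `(G ⊗ 1)(1 ⊗ F) = (Δ ⊗
id)(F) (id ⊗ Δ)(G)`; applying `a ⊗ b ⊗ c ↦ S(a) b S(c)` gives the product on the left and, by
normalization, `1` on the right. -/
theorem IsDrinfeldTwist.mulAntipodeLeft_mul_mulAntipodeRight (hF : IsDrinfeldTwist R F)
    (hFG : F * G = 1) (hGF : G * F = 1) :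
    mulAntipodeLeft R A G * mulAntipodeRight R A F = 1 := by
  rw [← antipodeOuter_inclLeft_mul_inclRight]
  have h := (cocycle_iff F).1 hF.cocycle
  have h' : inclLeft R A G * inclRight R A F = comulLeft R A F * comulRight R A G := by
    calc _ = inclLeft R A G * (inclRight R A F * comulRight R A F) * comulRight R A G := by
          rw [mul_assoc, mul_assoc, ← map_mul (comulRight R A), hFG, map_one, mul_one]
      _ = _ := by
          rw [← h, ← mul_assoc, ← map_mul (inclLeft R A), hGF, map_one, one_mul]
  rw [h', antipodeOuter_comulLeft_mul_comulRight, hF.counitLeft_eq,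
    algHom_eq_one_of_mul_eq_one _ hF.counitRight_eq hFG, mul_one, antipode_one]

/-- The other half: `(1 ⊗ G)(F ⊗ 1) = (id ⊗ Δ)(F) (Δ ⊗ id)(G)` is contracted with `a ⊗ b ⊗ c ↦ a
S(b) c`. -/
theorem IsDrinfeldTwist.mulAntipodeRight_mul_mulAntipodeLeft (hF : IsDrinfeldTwist R F)
    (hFG : F * G = 1) (hGF : G * F = 1) :
    mulAntipodeRight R A F * mulAntipodeLeft R A G = 1 := by
  rw [← antipodeInner_inclRight_mul_inclLeft]
  have h := (cocycle_iff F).1 hF.cocycle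
  have h' : inclRight R A G * inclLeft R A F = comulRight R A F * comulLeft R A G := by
    calc _ = inclRight R A G * (inclLeft R A F * comulLeft R A F) * comulLeft R A G := by
          rw [mul_assoc, mul_assoc, ← map_mul (comulLeft R A), hFG, map_one, mul_one]
      _ = _ := by
          rw [h, ← mul_assoc, ← map_mul (inclRight R A), hGF, map_one, one_mul]
  rw [h', antipodeInner_comulRight_mul_comulLeft, hF.counitRight_eq,
    algHom_eq_one_of_mul_eq_one _ hF.counitLeft_eq hFG, mul_one]

/-- The algebra map `a ↦ x f(a) y` for inverse elements `x` and `y`. -/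
def conjAlgHom {B C : Type*} [Ring B] [Algebra R B] [Ring C] [Algebra R C] (f : B →ₐ[R] C)
    (x y : C) (hxy : x * y = 1) (hyx : y * x = 1) : B →ₐ[R] C :=
  AlgHom.ofLinearMap (LinearMap.mulRight R y ∘ₗ LinearMap.mulLeft R x ∘ₗ f.toLinearMap)
    (by simp [hxy])
    (fun a b => by
      simp only [LinearMap.comp_apply, AlgHom.toLinearMap_apply, LinearMap.mulLeft_apply,
        LinearMap.mulRight_apply, map_mul]
      calc x * (f a * f b) * y = x * f a * 1 * (f b * y) := by noncomm_ring
        _ = _ := by rw [← hyx]; noncomm_ring)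

theorem conjAlgHom_apply {B C : Type*} [Ring B] [Algebra R B] [Ring C] [Algebra R C]
    (f : B →ₐ[R] C) (x y : C) (hxy : x * y = 1) (hyx : y * x = 1) (b : B) :
    conjAlgHom f x y hxy hyx b = x * f b * y := rfl

/-- The right factor `S(G₁) G₂` of the twisted antipode sits between `S(y₁)` and `y₂`, and `S(y₁)
S(G₁) G₂ y₂` is the contraction of `G y`; hence `F` cancels. -/
theorem conj_mulAntipodeLeft_twist (hGF : G * F = 1)
    (z : A ⊗[R] A) :
    LinearMap.mul' R A ((LinearMap.mulRight R (mulAntipodeLeft R A G) ∘ₗ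
      LinearMap.mulLeft R (mulAntipodeRight R A F) ∘ₗ antipode R).rTensor A (F * z)) =
      mulAntipodeRight R A F * mulAntipodeLeft R A z := by
  have key (y : A ⊗[R] A) : LinearMap.mul' R A ((LinearMap.mulRight R (mulAntipodeLeft R A G) ∘ₗ
      LinearMap.mulLeft R (mulAntipodeRight R A F) ∘ₗ antipode R).rTensor A y) =
      mulAntipodeRight R A F * mulAntipodeLeft R A (G * y) := by
    induction y with
    | zero => simp
    | add x y hx hy => simp only [map_add, mul_add, hx, hy]
    | tmul a b =>
      rw [mulAntipodeLeft_mul_tmul]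
      simp [mul_assoc]
  rw [key, ← mul_assoc, hGF, one_mul]

theorem conj_mulAntipodeRight_twist (hGF : G * F = 1)
    (z : A ⊗[R] A) :
    LinearMap.mul' R A ((LinearMap.mulRight R (mulAntipodeLeft R A G) ∘ₗ
      LinearMap.mulLeft R (mulAntipodeRight R A F) ∘ₗ antipode R).lTensor A (z * G)) =
      mulAntipodeRight R A z * mulAntipodeLeft R A G := by
  have key (y : A ⊗[R] A) : LinearMap.mul' R A ((LinearMap.mulRight R (mulAntipodeLeft R A G) ∘ₗ
      LinearMap.mulLeft R (mulAntipodeRight R A F) ∘ₗ antipode R).lTensor A y) =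
      mulAntipodeRight R A (y * F) * mulAntipodeLeft R A G := by
    induction y with
    | zero => simp
    | add x y hx hy => simp only [map_add, add_mul, hx, hy]
    | tmul a b =>
      rw [mulAntipodeRight_tmul_mul]
      simp [mul_assoc]
  rw [key, mul_assoc z, hGF, mul_one]

/-- The twisting of a Hopf algebra by a Drinfel'd twist `F` with inverse `G`. -/
def twistHopf (hF : IsDrinfeldTwist R F) (hFG : F * G = 1) (hGF : G * F = 1) :
    HopfStructure R A where
  comul := conjAlgHom (Bialgebra.comulAlgHom R A) F G hFG hGF
  counit := Bialgebra.counitAlgHom R A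
  antipode := LinearMap.mulRight R (mulAntipodeLeft R A G) ∘ₗ
    LinearMap.mulLeft R (mulAntipodeRight R A F) ∘ₗ antipode R
  coassoc := by
    have hl (z : A ⊗[R] A) : (Algebra.TensorProduct.assoc R R R A A A)
        (Algebra.TensorProduct.map (conjAlgHom (Bialgebra.comulAlgHom R A) F G hFG hGF)
          (.id R A) z) = inclLeft R A F * comulLeft R A z * inclLeft R A G := by
      induction z with
      | zero => simp
      | add x y hx hy => simp only [map_add, mul_add, add_mul, hx, hy]
      | tmul a b =>
        rw [map_tmul, conjAlgHom_apply, ← assoc_tmul_one, ← assoc_tmul_one]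
        change _ = _ * Algebra.TensorProduct.assoc R R R A A A
          (Bialgebra.comulAlgHom R A a ⊗ₜ[R] b) * _
        rw [← map_mul, ← map_mul, tmul_mul_tmul, tmul_mul_tmul, one_mul, mul_one]
        rfl
    have hr (z : A ⊗[R] A) : Algebra.TensorProduct.map (.id R A)
        (conjAlgHom (Bialgebra.comulAlgHom R A) F G hFG hGF) z =
          inclRight R A F * comulRight R A z * inclRight R A G := by
      induction z with
      | zero => simp
      | add x y hx hy => simp only [map_add, mul_add, add_mul, hx, hy]
      | tmul a b =>
        rw [map_tmul, conjAlgHom_apply, inclRight_apply, inclRight_apply, comulRight_tmul,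
          tmul_mul_tmul, tmul_mul_tmul, one_mul, mul_one]
        rfl
    refine AlgHom.ext fun a => (hl _).trans ((hr _).trans ?_).symm
    change inclRight R A F * comulRight R A (F * Bialgebra.comulAlgHom R A a * G) * inclRight R A G =
      inclLeft R A F * comulLeft R A (F * Bialgebra.comulAlgHom R A a * G) * inclLeft R A G
    simp only [map_mul]
    have h := (cocycle_iff F).1 hF.cocycle
    -- The inverse of the cocycle identity: the two sides are a right and a left inverse of the same
    -- element.
    have h' : comulLeft R A G * inclLeft R A G = comulRight R A G * inclRight R A G := by
      have h1 : inclLeft R A F * comulLeft R A F * (comulLeft R A G * inclLeft R A G) = 1 := by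
        rw [mul_assoc, ← mul_assoc (comulLeft R A F), ← map_mul (comulLeft R A), hFG, map_one,
          one_mul, ← map_mul, hFG, map_one]
      have h2 : comulRight R A G * inclRight R A G * (inclLeft R A F * comulLeft R A F) = 1 := by
        rw [h, mul_assoc, ← mul_assoc (inclRight R A G), ← map_mul (inclRight R A), hGF, map_one,
          one_mul, ← map_mul, hGF, map_one]
      exact (left_inv_eq_right_inv h2 h1).symm
    rw [← comulLeft_comul]
    calc _ = (inclRight R A F * comulRight R A F) * comulLeft R A (Bialgebra.comulAlgHom R A a) *
          (comulRight R A G * inclRight R A G) := by noncomm_ring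
      _ = _ := by rw [← h, ← h']; noncomm_ring
  rTensor_counit := by
    refine AlgHom.ext fun a => (Algebra.TensorProduct.lid R A).injective ?_
    change counitLeft R A (F * Bialgebra.comulAlgHom R A a * G) = Algebra.TensorProduct.lid R A
      ((Algebra.TensorProduct.lid R A).symm a)
    rw [map_mul, map_mul, hF.counitLeft_eq,
      algHom_eq_one_of_mul_eq_one _ hF.counitLeft_eq hFG, mul_one, one_mul,
      AlgEquiv.apply_symm_apply]
    change Algebra.TensorProduct.lid R A ((Coalgebra.counit (R := R)).rTensor A
      (Coalgebra.comul (R := R) a)) = a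
    rw [Coalgebra.rTensor_counit_comul]
    simp
  lTensor_counit := by
    refine AlgHom.ext fun a => (Algebra.TensorProduct.rid R R A).injective ?_
    change counitRight R A (F * Bialgebra.comulAlgHom R A a * G) = Algebra.TensorProduct.rid R R A
      ((Algebra.TensorProduct.rid R R A).symm a)
    rw [map_mul, map_mul, hF.counitRight_eq,
      algHom_eq_one_of_mul_eq_one _ hF.counitRight_eq hFG, mul_one, one_mul,
      AlgEquiv.apply_symm_apply]
    change Algebra.TensorProduct.rid R R A ((Coalgebra.counit (R := R)).lTensor A
      (Coalgebra.comul (R := R) a)) = a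
    rw [Coalgebra.lTensor_counit_comul]
    simp
  mul_antipode_rTensor := by
    refine LinearMap.ext fun a => ?_
    change LinearMap.mul' R A (LinearMap.rTensor A _ (F * Bialgebra.comulAlgHom R A a * G)) = _
    rw [mul_assoc, conj_mulAntipodeLeft_twist hGF, mulAntipodeLeft_comul_mul,
      mul_smul_comm, hF.mulAntipodeRight_mul_mulAntipodeLeft hFG hGF]
    exact (Algebra.algebraMap_eq_smul_one _).symm
  mul_antipode_lTensor := by
    refine LinearMap.ext fun a => ?_
    change LinearMap.mul' R A (LinearMap.lTensor A _ (F * Bialgebra.comulAlgHom R A a * G)) = _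
    rw [conj_mulAntipodeRight_twist hGF, mulAntipodeRight_mul_comul,
      smul_mul_assoc, hF.mulAntipodeRight_mul_mulAntipodeLeft hFG hGF]
    exact (Algebra.algebraMap_eq_smul_one _).symm

theorem isTwisting_twistHopf (hF : IsDrinfeldTwist R F) (hFG : F * G = 1) (hGF : G * F = 1) :
    IsTwisting (twistHopf hF hFG hGF) F := by
  have hG : Ring.inverse F = G := Ring.inverse_unit (⟨F, G, hFG, hGF⟩ : (A ⊗[R] A)ˣ)
  have h1 := hF.mulAntipodeRight_mul_mulAntipodeLeft hFG hGF
  have h2 := hF.mulAntipodeLeft_mul_mulAntipodeRight hFG hGF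
  have hw : twistElement R F = mulAntipodeRight R A F := rfl
  have hv : Ring.inverse (twistElement R F) = mulAntipodeLeft R A G :=
    Ring.inverse_unit (⟨mulAntipodeRight R A F, mulAntipodeLeft R A G, h1, h2⟩ : Aˣ)
  refine ⟨hF, fun a => ?_, fun a => rfl, ?_, fun a => ?_⟩
  · rw [hG]; rfl
  · exact (⟨mulAntipodeRight R A F, mulAntipodeLeft R A G, h1, h2⟩ : Aˣ).isUnit
  · rw [hv]; rfl

/-- The product of two Drinfel'd twists that commute suitably is a Drinfel'd twist. -/
theorem IsDrinfeldTwist.mul {F₁ F₂ : A ⊗[R] A} (h₁ : IsDrinfeldTwist R F₁)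
    (h₂ : IsDrinfeldTwist R F₂) (hl : Commute (comulLeft R A F₁) (inclLeft R A F₂))
    (hr : Commute (comulRight R A F₁) (inclRight R A F₂)) : IsDrinfeldTwist R (F₁ * F₂) := by
  refine ⟨h₁.isUnit.mul h₂.isUnit, (cocycle_iff _).2 ?_, ?_, ?_⟩
  · have c₁ := (cocycle_iff F₁).1 h₁.cocycle
    have c₂ := (cocycle_iff F₂).1 h₂.cocycle
    simp only [map_mul]
    -- The commutation hypotheses regroup each side into the cocycle expressions of `F₁` and `F₂`
    -- separately.
    rw [hl.symm.mul_mul_mul_comm, c₁, c₂, hr.mul_mul_mul_comm]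
  · exact (map_mul (counitLeft R A) _ _).trans
      (by rw [h₁.counitLeft_eq, h₂.counitLeft_eq, mul_one])
  · exact (map_mul (counitRight R A) _ _).trans
      (by rw [h₁.counitRight_eq, h₂.counitRight_eq, mul_one])

end Twisting

end JacobsonWitt
end

noncomputable section

namespace JacobsonWitt

/-! ### Eigenprojections of a toral element. -/

section Eigen

variable {A : Type*} [Ring A] (p : ℕ)

/-- The projection `1 - (h - i)^(p-1)` onto the `i`-eigenspace of an element with `h^p = h`. -/
def eigenProj (h : A) (i : ℤ) : A := 1 - (h - i) ^ (p - 1)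

variable {p}

theorem eigenProj_congr [CharP A p] (h : A) {i j : ℤ} (hij : (i : ZMod p) = j) :
    eigenProj p h i = eigenProj p h j := by
  have : (i : A) = j := by
    rw [CharP.intCast_eq_intCast A p]
    exact (ZMod.intCast_eq_intCast_iff _ _ _).1 hij
  rw [eigenProj, eigenProj, this]

theorem eigenProj_sub (h : A) (i j : ℤ) : eigenProj p (h - j) i = eigenProj p h (i + j) := by
  rw [eigenProj, eigenProj]
  congr 2
  push_cast
  abel

theorem eigenProj_neg (hp : Even (p - 1)) (h : A) (i : ℤ) :
    eigenProj p (-h) i = eigenProj p h (-i) := by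
  rw [eigenProj, eigenProj, ← hp.neg_pow]
  congr 2
  push_cast
  abel

/-- An element of weight `c` intertwines `h - (i - c)` with `h - i`, so it shifts eigenvalues by
`c`. -/
theorem eigenProj_mul {h x : A} {c : ℤ} (hx : h * x = x * (h + c)) (i : ℤ) :
    eigenProj p h i * x = x * eigenProj p h (i - c) := by
  have : SemiconjBy x (h - ((i - c : ℤ) : A)) (h - i) := by
    rw [SemiconjBy, sub_mul, hx, Int.cast_sub, mul_sub, mul_sub, mul_add,
      ← (Int.cast_commute i x).eq]
    abel
  rw [eigenProj, eigenProj, sub_mul, mul_sub, one_mul, mul_one, (this.pow_right (p - 1)).eq]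

theorem eigenProj_commute {h x : A} (hx : Commute h x) (i : ℤ) : Commute (eigenProj p h i) x := by
  have := eigenProj_mul (p := p) (h := h) (x := x) (c := 0) (by simpa using hx.eq) i
  rwa [sub_zero] at this

theorem map_eigenProj {B S : Type*} [Ring B] [CommRing S] [Algebra S A] [Algebra S B]
    (f : A →ₐ[S] B) (h : A) (i : ℤ) : f (eigenProj p h i) = eigenProj p (f h) i := by
  simp [eigenProj]

variable [Fact p.Prime] [CharP A p]

/-- A polynomial identity over `ZMod p`, valid for every `h`: the difference of the two sides has
degree at most `p - 1` and, by Fermat, vanishes at all `p` points. -/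
theorem sum_eigenProj (h : A) : ∑ i ∈ Finset.range p, eigenProj p h i = 1 := by
  let P : Polynomial (ZMod p) :=
    ∑ j ∈ Finset.range p, (1 - (Polynomial.X - Polynomial.C (j : ZMod p)) ^ (p - 1)) - 1
  have hp := (Fact.out : p.Prime).two_le
  have hP : P = 0 := by
    refine Polynomial.eq_zero_of_natDegree_lt_card_of_eval_eq_zero P Function.injective_id
      (fun a => ?_) ?_
    · simp only [P, id, Polynomial.eval_sub, Polynomial.eval_finsetSum, Polynomial.eval_one,
        Polynomial.eval_pow, Polynomial.eval_X, Polynomial.eval_C]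
      rw [Finset.sum_eq_single a.val]
      · rw [ZMod.natCast_zmod_val, sub_self, zero_pow (by omega), sub_zero, sub_self]
      · intro b hb hne
        rw [ZMod.pow_card_sub_one_eq_one, sub_self]
        intro h0
        rw [sub_eq_zero] at h0
        rw [h0, ZMod.val_cast_of_lt (Finset.mem_range.1 hb)] at hne
        exact hne rfl
      · intro h
        exact absurd (Finset.mem_range.2 a.val_lt) h
    · have h1 : P.natDegree ≤ p - 1 := by
        refine (Polynomial.natDegree_sub_le_of_le (Polynomial.natDegree_sum_le_of_forall_le _ _
          fun j _ => ?_) (n := p - 1) (by simp)).trans (max_self _).le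
        refine Polynomial.natDegree_sub_le_of_le (n := p - 1) (by simp)
          (Polynomial.natDegree_pow_le.trans ?_) |>.trans (max_self _).le
        rw [Polynomial.natDegree_X_sub_C, mul_one]
      rw [ZMod.card]
      omega
  let _ := ZMod.algebra A p
  have h2 := congrArg (Polynomial.aeval h) hP
  simp only [P, map_sub, map_sum, map_one, map_pow, Polynomial.aeval_X, map_natCast, map_zero]
    at h2
  rw [sub_eq_zero] at h2
  simpa [eigenProj] using h2

theorem sum_eigenProj_add (h : A) (c : ℤ) :
    ∑ i ∈ Finset.range p, eigenProj p h (i + c) = 1 := by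
  rw [← sum_eigenProj (h - (c : A))]
  simp only [eigenProj_sub]

/-- In characteristic `p`, `(h - i)^p = h^p - i^p = h - i`, so `h - i` annihilates `1 - (h -
i)^(p-1)`. -/
theorem mul_eigenProj {h : A} (hh : h ^ p = h) (i : ℤ) :
    h * eigenProj p h i = i * eigenProj p h i := by
  have hp := (Fact.out : p.Prime).one_lt
  rw [← sub_eq_zero, ← sub_mul, eigenProj, mul_sub, mul_one, ← pow_succ',
    Nat.sub_add_cancel hp.le, sub_pow_char_of_commute p (Int.commute_cast h i), hh]
  have : (i : A) ^ p = i := by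
    rw [← Int.cast_pow, CharP.intCast_eq_intCast A p, ← ZMod.intCast_eq_intCast_iff]
    push_cast
    exact ZMod.pow_card _
  rw [this, sub_self]

omit [CharP A p] in
theorem intCast_congr (hA : (p : A) = 0) {i j : ℤ} (hij : (i : ZMod p) = j) : (i : A) = j := by
  obtain ⟨c, hc⟩ := (ZMod.intCast_eq_intCast_iff_dvd_sub _ _ _).1 hij
  rw [eq_comm, ← sub_eq_zero, ← Int.cast_sub, hc, Int.cast_mul, Int.cast_natCast, hA, zero_mul]

-- On an eigenvector of eigenvalue `a` the projection is the scalar `1 - (a - i)^(p-1)`, which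
-- Fermat decides. Asking only for `(p : A) = 0` makes this usable in `A ⊗ A` and in the base ring
-- as well.
omit [CharP A p] in
theorem eigenProj_mul_of_mul_eq (hA : (p : A) = 0) {h z : A} {a : ℤ} (hz : h * z = a * z) (i : ℤ) :
    eigenProj p h i * z = if (i : ZMod p) = a then z else 0 := by
  have key (m : ℕ) : (h - i) ^ m * z = ((a - i : ℤ) ^ m : ℤ) * z := by
    induction m with
    | zero => simp
    | succ m ih =>
      rw [pow_succ', mul_assoc, ih, ← mul_assoc, ← (Int.cast_commute _ _).eq, mul_assoc, sub_mul,
        hz, ← sub_mul, ← mul_assoc]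
      push_cast
      rw [pow_succ]
  have hp := (Fact.out : p.Prime).two_le
  have h1 : (((a - i : ℤ) ^ (p - 1) : ℤ) : A) = if (i : ZMod p) = a then 0 else 1 := by
    split_ifs with hij
    · rw [← Int.cast_zero]
      refine intCast_congr (p := p) hA ?_
      push_cast
      rw [hij, sub_self, zero_pow (by omega)]
    · rw [← Int.cast_one]
      refine intCast_congr (p := p) hA ?_
      push_cast
      exact ZMod.pow_card_sub_one_eq_one (sub_ne_zero.2 (Ne.symm hij))
  rw [eigenProj, sub_mul, key, h1]
  split_ifs <;> simp

theorem eigenProj_mul_eigenProj {h : A} (hh : h ^ p = h) (i j : ℤ) :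
    eigenProj p h i * eigenProj p h j = if (i : ZMod p) = j then eigenProj p h j else 0 :=
  eigenProj_mul_of_mul_eq (CharP.cast_eq_zero A p) (mul_eigenProj hh j) i

/-- Sums over the residues `0, …, p - 1` can be evaluated at any integer, so eigenvalues such as `a
+ b` or `-j` need no reduction. -/
theorem sum_range_ite_intCast {M : Type*} [AddCommMonoid M] (f : ℤ → M)
    (hf : ∀ i j : ℤ, (i : ZMod p) = j → f i = f j) (a : ℤ) :
    ∑ i ∈ Finset.range p, (if ((i : ℤ) : ZMod p) = a then f i else 0) = f a := by
  rw [Finset.sum_eq_single (a : ZMod p).val]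
  · rw [if_pos (by simp)]
    exact hf _ _ (by simp)
  · intro b hb hne
    rw [if_neg]
    intro h0
    rw [← h0, Int.cast_natCast, ZMod.val_cast_of_lt (Finset.mem_range.1 hb)] at hne
    exact hne rfl
  · intro h
    exact absurd (Finset.mem_range.2 (ZMod.val_lt _)) h

end Eigen

/-! ### Rising and falling factorials on eigenspaces. -/

section Factorials

variable {A : Type*} [Ring A] {p : ℕ}

theorem rising_succ (x a : A) (r : ℕ) : rising x a (r + 1) = rising x a r * (x + a + (r : A)) := by
  simp [rising, List.range_succ]

theorem falling_succ (x a : A) (r : ℕ) :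
    falling x a (r + 1) = falling x a r * (x + a - (r : A)) := by
  simp [falling, List.range_succ]

theorem commute_rising {x y : A} (h : Commute y x) (a : ℤ) (r : ℕ) :
    Commute y (rising x a r) := by
  induction r with
  | zero => simp [rising]
  | succ r ih =>
    rw [rising_succ]
    exact ih.mul_right ((h.add_right (Int.commute_cast _ _)).add_right (Nat.commute_cast _ _))

theorem cast_prod_sub_eq_descFactorial (j r : ℕ) :
    ∏ s ∈ Finset.range r, ((j : ℤ) - s) = j.descFactorial r := by
  induction r with
  | zero => simp
  | succ r ih =>
    rw [Finset.prod_range_succ, ih, Nat.descFactorial_succ]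
    rcases le_or_gt r j with h | h
    · push_cast [Nat.cast_sub h]
      ring
    · rw [Nat.descFactorial_eq_zero_iff_lt.2 h]
      simp

variable [Fact p.Prime] [CharP A p]

theorem rising_mul_eigenProj {h : A} (hh : h ^ p = h) (a i : ℤ) (r : ℕ) :
    rising h a r * eigenProj p h i =
      ((∏ s ∈ Finset.range r, (i + a + s) : ℤ) : A) * eigenProj p h i := by
  induction r with
  | zero => simp [rising]
  | succ r ih =>
    rw [rising_succ, mul_assoc, add_mul, add_mul, mul_eigenProj hh, ← add_mul, ← add_mul,
      Finset.prod_range_succ]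
    have : ((i : A) + a + r) = ((i + a + r : ℤ) : A) := by push_cast; rfl
    rw [this, ← mul_assoc, ← (Int.cast_commute _ _).eq, mul_assoc, ih, ← mul_assoc, Int.cast_mul,
      (Int.cast_commute _ _).eq]

theorem falling_mul_eigenProj {h : A} (hh : h ^ p = h) (j r : ℕ) :
    falling h 0 r * eigenProj p h j = (j.descFactorial r : A) * eigenProj p h j := by
  rw [← Int.cast_natCast (j.descFactorial r), ← cast_prod_sub_eq_descFactorial]
  induction r with
  | zero => simp [falling]
  | succ r ih =>
    rw [falling_succ, add_zero, mul_assoc, sub_mul, mul_eigenProj hh, ← sub_mul,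
      Finset.prod_range_succ]
    have : (((j : ℤ) : A) - r) = ((j - r : ℤ) : A) := by push_cast; rfl
    rw [this, ← mul_assoc, ← (Int.cast_commute _ _).eq, mul_assoc, ih, ← mul_assoc, Int.cast_mul,
      (Int.cast_commute _ _).eq]

/-- `(-j)(-j+1)⋯(-j+r-1) = (-1)^r j(j-1)⋯(j-r+1)`. This is the source of the signs in the coproduct
formula. -/
theorem rising_zero_mul_eigenProj_neg {h : A} (hh : h ^ p = h) (j r : ℕ) :
    rising h 0 r * eigenProj p h (-j) = ((-1) ^ r * j.descFactorial r : ℤ) * eigenProj p h (-j) := by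
  have := rising_mul_eigenProj hh 0 (-j) r
  rw [Int.cast_zero] at this
  rw [this, ← cast_prod_sub_eq_descFactorial]
  congr 2
  rw [← Finset.card_range r, ← Finset.prod_const, Finset.card_range, ← Finset.prod_mul_distrib]
  exact Finset.prod_congr rfl fun s _ => by ring

/-- At `h = j - r` the factors `h + 1, …, h + r` are those of `j(j-1)⋯(j-r+1)` in reverse order.
This produces the shift by `1` in the antipode formula. -/
theorem rising_one_mul_eigenProj_sub {h : A} (hh : h ^ p = h) (j r : ℕ) :
    rising h 1 r * eigenProj p h (j - r) = (j.descFactorial r : A) * eigenProj p h (j - r) := by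
  have := rising_mul_eigenProj hh 1 (j - r) r
  rw [Int.cast_one] at this
  rw [this, ← Int.cast_natCast (j.descFactorial r), ← cast_prod_sub_eq_descFactorial,
    ← Finset.prod_range_reflect]
  congr 2
  refine Finset.prod_congr rfl fun s hs => ?_
  rw [Finset.mem_range] at hs
  omega

end Factorials

/-! ### Binomial expansions with commutators. -/

section Binomial

variable {A : Type*} [Ring A]

/-- The commutator `x ↦ e x - x e`. -/
def commutator (e : A) : Module.End ℤ A := LinearMap.mulLeft ℤ e - LinearMap.mulRight ℤ e

theorem commutator_apply (e x : A) : commutator e x = e * x - x * e := rfl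

theorem commute_mulLeft_commutator {e g : A} (h : Commute g e) :
    Commute (LinearMap.mulLeft ℤ g) (commutator e) := by
  refine LinearMap.ext fun x => ?_
  simp [commutator_apply, mul_sub, ← mul_assoc, h.eq]

theorem commute_mulRight_commutator {e g : A} (h : Commute g e) :
    Commute (LinearMap.mulRight ℤ g) (commutator e) := by
  refine LinearMap.ext fun x => ?_
  simp [commutator_apply, sub_mul, mul_assoc, h.eq]

theorem commute_commutator {e f : A} (h : Commute e f) :
    Commute (commutator e) (commutator f) := by
  refine LinearMap.ext fun x => ?_
  have h1 : e * (f * x) = f * (e * x) := by rw [← mul_assoc, h.eq, mul_assoc]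
  have h2 : x * e * f = x * f * e := by rw [mul_assoc, h.eq, mul_assoc]
  simp only [Module.End.mul_apply, commutator_apply, mul_sub, sub_mul, h1, h2, mul_assoc]
  abel

/-- Right multiplication by `1 - e` is left multiplication by `1 - e` plus `ad e`; these operators
commute, so the binomial theorem applies. The sum runs to a fixed bound `q`, independent of `j`,
since the extra binomials vanish. -/
theorem mul_one_sub_pow (e x : A) {j q : ℕ} (hj : j < q) :
    x * (1 - e) ^ j = ∑ l ∈ Finset.range q,
      (j.choose l : A) * ((1 - e) ^ (j - l) * (commutator e ^ l) x) := by
  have hc : Commute (1 - e) e := (Commute.one_left e).sub_left rfl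
  have h1 : LinearMap.mulRight ℤ (1 - e) = commutator e + LinearMap.mulLeft ℤ (1 - e) := by
    refine LinearMap.ext fun x => ?_
    simp [commutator_apply, mul_sub, sub_mul]
  have h2 : x * (1 - e) ^ j = (LinearMap.mulRight ℤ (1 - e) ^ j) x := by
    rw [LinearMap.pow_mulRight, LinearMap.mulRight_apply]
  rw [h2, h1, (commute_mulLeft_commutator hc).symm.add_pow, LinearMap.sum_apply]
  refine (Finset.sum_subset (Finset.range_subset_range.2 hj) fun l _ hl => ?_).trans
    (Finset.sum_congr rfl fun l _ => ?_)
  · rw [Nat.choose_eq_zero_of_lt (by simpa using hl)]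
    simp
  · rw [(((commute_mulLeft_commutator hc).symm.pow_pow l (j - l))).eq, LinearMap.pow_mulLeft,
      ← Nat.cast_comm, Module.End.mul_apply, Module.End.mul_apply, LinearMap.mulLeft_apply]
    simp

/-- The mirror image: left multiplication by `1 + e` is right multiplication by `1 + e` plus `ad e`.
-/
theorem one_add_pow_mul (e x : A) {j q : ℕ} (hj : j < q) :
    (1 + e) ^ j * x = ∑ l ∈ Finset.range q,
      (j.choose l : A) * ((commutator e ^ l) x * (1 + e) ^ (j - l)) := by
  have hc : Commute (1 + e) e := (Commute.one_left e).add_left rfl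
  have h1 : LinearMap.mulLeft ℤ (1 + e) = commutator e + LinearMap.mulRight ℤ (1 + e) := by
    refine LinearMap.ext fun x => ?_
    simp [commutator_apply, mul_add, add_mul]
    abel
  have h2 : (1 + e) ^ j * x = (LinearMap.mulLeft ℤ (1 + e) ^ j) x := by
    rw [LinearMap.pow_mulLeft, LinearMap.mulLeft_apply]
  rw [h2, h1, (commute_mulRight_commutator hc).symm.add_pow, LinearMap.sum_apply]
  refine (Finset.sum_subset (Finset.range_subset_range.2 hj) fun l _ hl => ?_).trans
    (Finset.sum_congr rfl fun l _ => ?_)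
  · rw [Nat.choose_eq_zero_of_lt (by simpa using hl)]
    simp
  · rw [(((commute_mulRight_commutator hc).symm.pow_pow l (j - l))).eq, LinearMap.pow_mulRight,
      ← Nat.cast_comm, Module.End.mul_apply, Module.End.mul_apply, LinearMap.mulRight_apply]
    simp

/-- The commutator raises the weight of eigenvectors by that of the operator. -/
theorem weight_commutator_pow {h e x : A} {c : ℤ} (he : h * e = e * (h + 1))
    (hx : h * x = x * (h + c)) (l : ℕ) :
    h * (commutator e ^ l) x = (commutator e ^ l) x * (h + (c + l : ℤ)) := by
  induction l with
  | zero => simpa using hx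
  | succ l ih =>
    rw [pow_succ', Module.End.mul_apply, commutator_apply]
    generalize (commutator e ^ l) x = y at ih
    have h1 : h * (e * y) = e * y * (h + (c + l + 1 : ℤ)) := by
      rw [← mul_assoc, he, mul_assoc, add_mul, ih, one_mul]
      push_cast
      noncomm_ring
    have h2 : h * (y * e) = y * e * (h + (c + l + 1 : ℤ)) := by
      rw [← mul_assoc, ih, mul_assoc, add_mul, he, (Int.cast_commute _ _).eq]
      push_cast
      noncomm_ring
    rw [mul_sub, h1, h2, sub_mul]
    push_cast
    simp only [add_assoc]

end Binomial

end JacobsonWitt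
end

/-! ### Twist pairs and divided powers of the adjoint action. -/

noncomputable section

namespace JacobsonWitt

/-- A pair `h, e` with `[h, e] = e`, `h` toral and `e` nilpotent, together with the units
`g = 1 - e` and `g' = 1 + e`. -/
structure IsTwistPair {A : Type*} [Ring A] (p : ℕ) (h e : A) (g g' : Aˣ) : Prop where
  pow_h : h ^ p = h
  pow_e : e ^ p = 0
  mul_eq : h * e = e * (h + 1)
  val : (g : A) = 1 - e
  val' : (g' : A) = 1 + e

section DividedPower

variable (K : Type*) [Field K] {A : Type*} [Ring A] [Algebra K A]

/-- The divided power `(ad e)^l / l!` of the commutator with `e`. -/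
def divAd (e : A) (l : ℕ) (x : A) : A := ((l ! : K)⁻¹) • (commutator e ^ l) x

variable {K}

theorem weight_divAd {h e x : A} {c : ℤ} (he : h * e = e * (h + 1))
    (hx : h * x = x * (h + c)) (l : ℕ) :
    h * divAd K e l x = divAd K e l x * (h + (c + l : ℤ)) := by
  rw [divAd, mul_smul_comm, weight_commutator_pow he hx, smul_mul_assoc]

theorem commutator_smul (e x : A) (r : K) : commutator e (r • x) = r • commutator e x := by
  simp [commutator_apply, smul_sub]

theorem commutator_pow_smul (e x : A) (r : K) (l : ℕ) :
    (commutator e ^ l) (r • x) = r • (commutator e ^ l) x := by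
  induction l with
  | zero => simp
  | succ l ih => rw [pow_succ', Module.End.mul_apply, ih, commutator_smul, Module.End.mul_apply]

theorem divAd_comm {e f : A} (h : Commute e f) (l s : ℕ) (x : A) :
    divAd K e l (divAd K f s x) = divAd K f s (divAd K e l x) := by
  rw [divAd, divAd, divAd, divAd, commutator_pow_smul, commutator_pow_smul, smul_comm]
  congr 2
  exact LinearMap.congr_fun ((commute_commutator h).pow_pow l s).eq x

theorem weight_divAd_of_commute {h e x : A} {c : ℤ} (he : Commute h e)
    (hx : h * x = x * (h + c)) (l : ℕ) :
    h * divAd K e l x = divAd K e l x * (h + c) := by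
  rw [divAd, mul_smul_comm, smul_mul_assoc]
  congr 1
  induction l with
  | zero => simpa using hx
  | succ l ih =>
    rw [pow_succ', Module.End.mul_apply, commutator_apply]
    generalize (commutator e ^ l) x = y at ih
    have h1 : (h + c) * e = e * (h + c) :=
      (he.add_left (Int.cast_commute c e)).eq
    rw [mul_sub, sub_mul, ← mul_assoc, he.eq, mul_assoc, ih, ← mul_assoc h y, ih, mul_assoc, h1]
    simp only [mul_assoc]

variable {p : ℕ} [Fact p.Prime] [CharP K p]

theorem factorial_ne_zero_of_lt {l : ℕ} (hl : l < p) : (l ! : K) ≠ 0 := fun h => by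
  rw [CharP.cast_eq_zero_iff K p, (Fact.out : p.Prime).dvd_factorial] at h
  omega

theorem choose_mul_commutator_pow (e x : A) (j : ℕ) {l : ℕ} (hl : l < p) :
    (j.choose l : A) * (commutator e ^ l) x = (j.descFactorial l : A) * divAd K e l x := by
  rw [divAd, Nat.descFactorial_eq_factorial_mul_choose, mul_smul_comm, Nat.mul_comm, Nat.cast_mul,
    mul_assoc, ← mul_smul_comm, ← nsmul_eq_mul (l !), ← Nat.cast_smul_eq_nsmul K, smul_smul,
    inv_mul_cancel₀ (factorial_ne_zero_of_lt hl), one_smul]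

end DividedPower

/-! ### The units of a twist pair and the sum computing the antipode. -/

section Pair

variable {A : Type*} [Ring A] {p : ℕ} [Fact p.Prime] [CharP A p] {h e : A} {g g' : Aˣ}

theorem zpow_congr_of_pow_eq_one {M : Type*} [Group M] {g : M} (hg : g ^ p = 1) {i j : ℤ}
    (hij : (i : ZMod p) = j) : g ^ i = g ^ j := by
  obtain ⟨c, hc⟩ := (ZMod.intCast_eq_intCast_iff_dvd_sub _ _ _).1 hij
  have : j = i + p * c := by omega
  rw [this, zpow_add, zpow_mul, zpow_natCast, hg, one_zpow, mul_one]

theorem IsTwistPair.pow_g (H : IsTwistPair p h e g g') : g ^ p = 1 := by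
  apply Units.ext
  rw [Units.val_pow_eq_pow_val, H.val, sub_pow_char_of_commute p (Commute.one_left e), H.pow_e]
  simp

theorem IsTwistPair.pow_g' (H : IsTwistPair p h e g g') : g' ^ p = 1 := by
  apply Units.ext
  rw [Units.val_pow_eq_pow_val, H.val', add_pow_char_of_commute p (Commute.one_left e), H.pow_e]
  simp

-- The expansion of `x g^j`, multiplied by `g^(-j)` on both sides. It is the component at eigenvalue
-- `-j` of the conjugation formula for `1 ⊗ x`.
omit [CharP A p] in
theorem IsTwistPair.sum_zpow_mul_divAd {K : Type*} [Field K] [CharP K p] [Algebra K A]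
    (H : IsTwistPair p h e g g') (x : A) {j : ℕ} (hj : j < p) :
    ∑ l ∈ Finset.range p, (j.descFactorial l : A) *
      (((g ^ (-(l : ℤ)) : Aˣ) : A) * divAd K e l x * ((g ^ (-(j : ℤ)) : Aˣ) : A)) =
      ((g ^ (-(j : ℤ)) : Aˣ) : A) * x := by
  have key : x * ((g ^ (j : ℤ) : Aˣ) : A) = ∑ l ∈ Finset.range p,
      (j.descFactorial l : A) * (((g ^ ((j : ℤ) - l) : Aˣ) : A) * divAd K e l x) := by
    rw [zpow_natCast, Units.val_pow_eq_pow_val, H.val, mul_one_sub_pow e x hj]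
    refine Finset.sum_congr rfl fun l hl => ?_
    rw [← mul_assoc, (Nat.cast_commute _ _).eq, mul_assoc,
      choose_mul_commutator_pow (K := K) e x j (Finset.mem_range.1 hl)]
    -- For `l > j` the natural exponent `j - l` is truncated and differs from the integer one, but
    -- the coefficient vanishes.
    rcases le_or_gt l j with hlj | hlj
    · rw [← H.val, ← Units.val_pow_eq_pow_val, ← zpow_natCast, Nat.cast_sub hlj, ← mul_assoc,
        ← (Nat.cast_commute _ _).eq, mul_assoc]
    · rw [Nat.descFactorial_eq_zero_iff_lt.2 hlj]
      simp
  have h1 : ((g ^ (-(j : ℤ)) : Aˣ) : A) * x = ((g ^ (-(j : ℤ)) : Aˣ) : A) *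
      (x * ((g ^ (j : ℤ) : Aˣ) : A)) * ((g ^ (-(j : ℤ)) : Aˣ) : A) := by
    rw [zpow_neg, mul_assoc, Units.mul_inv_cancel_right]
  rw [h1, key, Finset.mul_sum, Finset.sum_mul]
  refine Finset.sum_congr rfl fun l _ => ?_
  have h2 : -(l : ℤ) = -j + (j - l) := by ring
  rw [h2, zpow_add, Units.val_mul, ← mul_assoc ((g ^ (-(j : ℤ)) : Aˣ) : A) (j.descFactorial l : A),
    ← (Nat.cast_commute _ _).eq]
  simp only [mul_assoc]

omit [CharP A p] in
theorem IsTwistPair.zpow_mul_eq_sum {K : Type*} [Field K] [CharP K p] [Algebra K A]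
    (H : IsTwistPair p h e g g') (x : A) {j : ℕ} (hj : j < p) :
    ((g' ^ (j : ℤ) : Aˣ) : A) * x = ∑ l ∈ Finset.range p,
      (j.descFactorial l : A) * (divAd K e l x * ((g' ^ ((j : ℤ) - l) : Aˣ) : A)) := by
  rw [zpow_natCast, Units.val_pow_eq_pow_val, H.val', one_add_pow_mul e x hj]
  refine Finset.sum_congr rfl fun l hl => ?_
  rw [← mul_assoc, ← mul_assoc, choose_mul_commutator_pow (K := K) e x j (Finset.mem_range.1 hl)]
  rcases le_or_gt l j with hlj | hlj
  · rw [← H.val', ← Units.val_pow_eq_pow_val, ← zpow_natCast, Nat.cast_sub hlj]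
  · rw [Nat.descFactorial_eq_zero_iff_lt.2 hlj]
    simp

variable (p) in
/-- `∑ i, π_i gⁱ`, the antipodal companion of `twistSum`. -/
def antipodeSum (h : A) (g : Aˣ) : A :=
  ∑ i ∈ Finset.range p, eigenProj p h i * ((g ^ (i : ℤ) : Aˣ) : A)

theorem eigenProj_mul_antipodeSum (hh : h ^ p = h) (hg : g ^ p = 1) (a : ℤ) :
    eigenProj p h a * antipodeSum p h g = eigenProj p h a * ((g ^ a : Aˣ) : A) := by
  rw [antipodeSum, Finset.mul_sum,
    ← sum_range_ite_intCast (p := p) (fun i => eigenProj p h i * ((g ^ i : Aˣ) : A))]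
  · refine Finset.sum_congr rfl fun i _ => ?_
    rw [← mul_assoc, eigenProj_mul_eigenProj hh]
    by_cases hia : ((i : ℤ) : ZMod p) = a
    · rw [if_pos hia.symm, if_pos hia]
    · rw [if_neg (Ne.symm hia), if_neg hia, zero_mul]
  · intro i j hij
    rw [eigenProj_congr h hij, zpow_congr_of_pow_eq_one hg hij]

theorem ext_eigenProj_add (h : A) {x y : A} (c : ℤ)
    (hxy : ∀ j < p, eigenProj p h (j + c) * x = eigenProj p h (j + c) * y) : x = y := by
  rw [← one_mul x, ← one_mul y, ← sum_eigenProj_add (p := p) h c, Finset.sum_mul, Finset.sum_mul]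
  exact Finset.sum_congr rfl fun i hi => hxy i (Finset.mem_range.1 hi)

/-- With `w` the sum, `π_i e = e π_{i-1}` gives `π_i (1 - e) w g' = π_i (g'^(i+1) - e g'^i) = π_i
g'^i`, because `g' - e = 1`. -/
theorem IsTwistPair.mul_antipodeSum_mul (H : IsTwistPair p h e g g') :
    (g : A) * antipodeSum p h g' * (g' : A) = antipodeSum p h g' := by
  refine ext_eigenProj_add (p := p) h 0 fun j _ => ?_
  have he (i : ℤ) := eigenProj_mul (p := p) (c := 1) (by simpa using H.mul_eq) i
  have hw (i : ℤ) := eigenProj_mul_antipodeSum H.pow_h H.pow_g' i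
  generalize ((j : ℤ) + 0) = i
  rw [H.val, sub_mul, one_mul, sub_mul, mul_sub, ← mul_assoc, hw, ← mul_assoc, ← mul_assoc, he,
    mul_assoc e, hw, ← mul_assoc, ← he]
  simp only [mul_assoc]
  rw [← mul_sub]
  congr 1
  have : g' ^ i = g' ^ (i - 1) * g' := by rw [zpow_sub_one, inv_mul_cancel_right]
  rw [this, ← Units.val_mul, ← Units.val_mul, ← this, (Commute.zpow_self g' i).eq, Units.val_mul,
    H.val']
  noncomm_ring

theorem IsTwistPair.zpow_mul_antipodeSum (H : IsTwistPair p h e g g') (c : ℤ) :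
    ((g ^ c : Aˣ) : A) * antipodeSum p h g' =
      antipodeSum p h g' * ((g' ^ (-c) : Aˣ) : A) := by
  have h1 : SemiconjBy (antipodeSum p h g') ((g'⁻¹ : Aˣ) : A) (g : A) := by
    rw [SemiconjBy]
    conv_lhs => rw [← H.mul_antipodeSum_mul]
    rw [Units.mul_inv_cancel_right]
  have := (h1.units_zpow_right c).eq
  rw [← this, zpow_neg, inv_zpow]

/-- Conjugation by `∑ i, π_i g'ⁱ`. -/
theorem IsTwistPair.antipodeSum_mul {K : Type*} [Field K] [CharP K p] [Algebra K A]
    (H : IsTwistPair p h e g g') {x : A} {c : ℤ} (hx : h * x = x * (h + c)) :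
    antipodeSum p h g' * x = ((g ^ (-c) : Aˣ) : A) *
      (∑ l ∈ Finset.range p, divAd K e l x * rising h 1 l) * antipodeSum p h g' := by
  -- After multiplication by `g^c`, the left side becomes `w g'^(-c) x`, where `w` is the antipodal
  -- sum.
  rw [← Units.mul_right_inj (g ^ c), mul_assoc, ← mul_assoc (g ^ c : Aˣ).val,
    ← mul_assoc (g ^ c : Aˣ).val, ← Units.val_mul, ← zpow_add, add_neg_cancel, zpow_zero,
    Units.val_one, one_mul, H.zpow_mul_antipodeSum]
  -- At eigenvalue `j + c` the power left in front of `x` is `g'^j` with `0 ≤ j < p`, so the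
  -- binomial expansion applies.
  refine ext_eigenProj_add (p := p) h c fun j hj => ?_
  rw [← mul_assoc, ← mul_assoc, eigenProj_mul_antipodeSum H.pow_h H.pow_g', mul_assoc _ _ x,
    mul_assoc, ← mul_assoc _ _ x, ← Units.val_mul, ← zpow_add, add_neg_cancel_right,
    H.zpow_mul_eq_sum (K := K) x hj, Finset.sum_mul, Finset.mul_sum, Finset.mul_sum]
  refine Finset.sum_congr rfl fun l _ => ?_
  -- The `l`-th divided power has weight `c + l`, so `π_{j+c}` passes through it as `π_{j-l}`, where
  -- `rising h 1 l` is the required falling factorial of `j`.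
  have h1 := eigenProj_mul (p := p) (weight_divAd (K := K) H.mul_eq hx l) (j + c)
  have h2 : (j : ℤ) + c - (c + l) = j - l := by ring
  rw [h2] at h1
  have h3 : Commute (eigenProj p h (j - l)) (rising h 1 l) := by
    refine eigenProj_commute ?_ _
    simpa using commute_rising (Commute.refl h) 1 l
  rw [← mul_assoc, ← mul_assoc _ _ (antipodeSum p h g'), ← mul_assoc _ _ (rising h 1 l), h1,
    mul_assoc (divAd K e l x), h3.eq, rising_one_mul_eigenProj_sub H.pow_h, mul_assoc, mul_assoc,
    mul_assoc _ _ (antipodeSum p h g'), eigenProj_mul_antipodeSum H.pow_h H.pow_g',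
    ← mul_assoc (eigenProj p h _), ← (Nat.cast_commute _ _).eq, mul_assoc,
    ← mul_assoc _ (divAd K e l x), h1, ← mul_assoc (divAd K e l x) (j.descFactorial l : A),
    ← (Nat.cast_commute _ _).eq]
  simp only [mul_assoc]

end Pair

end JacobsonWitt
end

noncomputable section

namespace JacobsonWitt

open Algebra.TensorProduct HopfAlgebra

/-! ### The spectral form of the basic twist and conjugation by it. -/

section TwistSum

variable {R A : Type*} [CommRing R] [Ring A] [Algebra R A] {p : ℕ} [Fact p.Prime] [CharP A p]
  {h e : A} {g g' : Aˣ}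

variable (R p) in
/-- `∑ i, π_i ⊗ gⁱ`, the spectral form of the basic twist. -/
def twistSum (h : A) (g : Aˣ) : A ⊗[R] A :=
  ∑ i ∈ Finset.range p, eigenProj p h i ⊗ₜ[R] ((g ^ (i : ℤ) : Aˣ) : A)

theorem sum_tmul_mul_eigenProj {M : Type*} [Ring M] [Algebra R M] (hh : h ^ p = h) (f : ℤ → M)
    (hf : ∀ i j : ℤ, (i : ZMod p) = j → f i = f j) (a : ℤ) :
    (∑ i ∈ Finset.range p, eigenProj p h i ⊗ₜ[R] f i) * (eigenProj p h a ⊗ₜ[R] 1) =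
      eigenProj p h a ⊗ₜ[R] f a := by
  rw [Finset.sum_mul, ← sum_range_ite_intCast (p := p) (fun i => eigenProj p h i ⊗ₜ[R] f i)]
  · refine Finset.sum_congr rfl fun i _ => ?_
    rw [tmul_mul_tmul, mul_one, eigenProj_mul_eigenProj hh]
    by_cases hia : ((i : ℤ) : ZMod p) = a
    · rw [if_pos hia, if_pos hia, eigenProj_congr h hia]
    · rw [if_neg hia, if_neg hia, TensorProduct.zero_tmul]
  · intro i j hij
    rw [eigenProj_congr h hij, hf i j hij]

theorem twistSum_mul_eigenProj (hh : h ^ p = h) (hg : g ^ p = 1) (a : ℤ) :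
    twistSum R p h g * (eigenProj p h a ⊗ₜ[R] (1 : A)) =
      eigenProj p h a ⊗ₜ[R] ((g ^ a : Aˣ) : A) :=
  sum_tmul_mul_eigenProj hh (fun i => ((g ^ i : Aˣ) : A))
    (fun _ _ hij => by rw [zpow_congr_of_pow_eq_one hg hij]) a

theorem ext_tmul_eigenProj {M : Type*} [Ring M] [Algebra R M] (h : A) {x y : A ⊗[R] M}
    (hxy : ∀ j < p, x * (eigenProj p h j ⊗ₜ[R] (1 : M)) = y * (eigenProj p h j ⊗ₜ[R] (1 : M))) :
    x = y := by
  have h1 : ∑ j ∈ Finset.range p, eigenProj p h j ⊗ₜ[R] (1 : M) = 1 := by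
    rw [← TensorProduct.sum_tmul, sum_eigenProj, Algebra.TensorProduct.one_def]
  rw [← mul_one x, ← mul_one y, ← h1, Finset.mul_sum, Finset.mul_sum]
  exact Finset.sum_congr rfl fun i hi => hxy i (Finset.mem_range.1 hi)

/-- Lists the eigenvalues as `0, -1, …, -(p-1)`, so that the powers `g^(-j)` to be moved past `x`
have `0 ≤ j < p`. -/
theorem ext_tmul_eigenProj_neg (hp : p ≠ 2) (h : A) {x y : A ⊗[R] A}
    (hxy : ∀ j < p, x * (eigenProj p h (-j) ⊗ₜ[R] (1 : A)) =
      y * (eigenProj p h (-j) ⊗ₜ[R] (1 : A))) : x = y := by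
  refine ext_tmul_eigenProj (p := p) (-h) fun j hj => ?_
  rw [eigenProj_neg ((Fact.out : p.Prime).even_sub_one hp)]
  exact hxy j hj

theorem twistSum_mul_twistSum_inv (hh : h ^ p = h) (hg : g ^ p = 1) :
    twistSum R p h g * twistSum R p h g⁻¹ = 1 := by
  refine ext_tmul_eigenProj (p := p) h fun j _ => ?_
  have h1 : eigenProj p h j ⊗ₜ[R] (((g⁻¹) ^ (j : ℤ) : Aˣ) : A) =
      (eigenProj p h j ⊗ₜ[R] (1 : A)) * ((1 : A) ⊗ₜ[R] (((g⁻¹) ^ (j : ℤ) : Aˣ) : A)) := by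
    rw [tmul_mul_tmul, mul_one, one_mul]
  rw [mul_assoc, twistSum_mul_eigenProj hh (by rw [inv_pow, hg, inv_one]), h1, ← mul_assoc,
    twistSum_mul_eigenProj hh hg, tmul_mul_tmul, mul_one, inv_zpow, Units.mul_inv, one_mul]

theorem twistSum_inv_mul_twistSum (hh : h ^ p = h) (hg : g ^ p = 1) :
    twistSum R p h g⁻¹ * twistSum R p h g = 1 := by
  have := twistSum_mul_twistSum_inv (R := R) (g := g⁻¹) hh (by rw [inv_pow, hg, inv_one])
  rwa [inv_inv] at this

omit [Fact p.Prime] [CharP A p] in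
theorem commute_twistSum_tmul {u v : A} (hu : Commute h u) (hv : Commute (g : A) v) :
    Commute (twistSum R p h g) (u ⊗ₜ[R] v) := by
  refine Commute.sum_left _ _ _ fun i _ => ?_
  have h1 := (eigenProj_commute (p := p) hu i).eq
  have h2 := (hv.units_zpow_left i).eq
  rw [Commute, SemiconjBy, tmul_mul_tmul, tmul_mul_tmul, h1, h2]

/-- The element `x` carries `π_j` to `π_{j+c}`, and `g^(j+c) = g^c g^j`. -/
theorem twistSum_mul_tmul_one (hh : h ^ p = h) (hg : g ^ p = 1) {x : A} {c : ℤ}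
    (hx : h * x = x * (h + c)) :
    twistSum R p h g * (x ⊗ₜ[R] (1 : A)) = (x ⊗ₜ[R] ((g ^ c : Aˣ) : A)) * twistSum R p h g := by
  refine ext_tmul_eigenProj (p := p) h fun j _ => ?_
  have h1 := eigenProj_mul (p := p) hx (j + c)
  rw [add_sub_cancel_right] at h1
  have h2 : eigenProj p h (j + c) ⊗ₜ[R] ((g ^ (j + c : ℤ) : Aˣ) : A) * x ⊗ₜ[R] (1 : A) =
      (x ⊗ₜ[R] ((g ^ c : Aˣ) : A)) * (eigenProj p h j ⊗ₜ[R] ((g ^ (j : ℤ) : Aˣ) : A)) := by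
    rw [tmul_mul_tmul, h1, tmul_mul_tmul, mul_one, ← Units.val_mul, ← zpow_add, add_comm]
  rw [mul_assoc, mul_assoc, twistSum_mul_eigenProj hh hg, ← h2, ← twistSum_mul_eigenProj hh hg,
    mul_assoc, tmul_mul_tmul, tmul_mul_tmul, h1, mul_one]

variable {K : Type*} [Field K] [CharP K p] [Algebra K A]

variable (R p K) in
/-- The conjugate of `1 ⊗ x` by the basic twist. -/
def twistedRight (h e : A) (g : Aˣ) (x : A) : A ⊗[R] A :=
  ∑ l ∈ Finset.range p, (-1) ^ l *
    (rising h 0 l ⊗ₜ[R] (((g ^ (-(l : ℤ)) : Aˣ) : A) * divAd K e l x))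

/-- At eigenvalue `-j` the left side is `g^(-j) x`, expanded by `IsTwistPair.sum_zpow_mul_divAd`;
its coefficients are `(-1)^l` times the eigenvalues of `rising h 0 l`. -/
theorem IsTwistPair.twistSum_mul_one_tmul (hp : p ≠ 2) (H : IsTwistPair p h e g g') (x : A) :
    twistSum R p h g * ((1 : A) ⊗ₜ[R] x) = twistedRight R p K h e g x * twistSum R p h g := by
  refine ext_tmul_eigenProj_neg hp h fun j hj => ?_
  have h1 : ((1 : A) ⊗ₜ[R] x) * (eigenProj p h (-j) ⊗ₜ[R] (1 : A)) =
      (eigenProj p h (-j) ⊗ₜ[R] (1 : A)) * ((1 : A) ⊗ₜ[R] x) := by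
    simp [tmul_mul_tmul]
  rw [mul_assoc, mul_assoc, h1, ← mul_assoc, twistSum_mul_eigenProj H.pow_h H.pow_g,
    tmul_mul_tmul, mul_one, ← H.sum_zpow_mul_divAd (K := K) x hj, TensorProduct.tmul_sum,
    twistedRight, Finset.sum_mul]
  refine Finset.sum_congr rfl fun l _ => ?_
  have h2 (z : A ⊗[R] A) : (-1) ^ l * z = ((-1) ^ l : ℤ) • z := by
    rw [zsmul_eq_mul]
    push_cast
    rfl
  have h3 : ((-1) ^ l * ((-1) ^ l * j.descFactorial l) : ℤ) = j.descFactorial l := by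
    rcases neg_one_pow_eq_or ℤ l with h | h <;> simp [h]
  have h4 : (((-1) ^ l * j.descFactorial l : ℤ) : A) * eigenProj p h (-j) =
      ((-1) ^ l * j.descFactorial l : ℤ) • eigenProj p h (-j) := (zsmul_eq_mul _ _).symm
  have h5 := rising_zero_mul_eigenProj_neg H.pow_h j l
  push_cast at h4 h5
  rw [mul_assoc ((-1) ^ l : A ⊗[R] A), tmul_mul_tmul, h5, h4, ← Int.cast_natCast (j.descFactorial l), ← zsmul_eq_mul,
    TensorProduct.tmul_smul, ← TensorProduct.smul_tmul', h2, smul_smul, h3]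

/-- At eigenvalue `j` with `0 ≤ j < p`, the falling factorial divided by `r!` is `binom(j, r)`, and
the sum is the binomial expansion of `(1 - e)^j = g^j`. -/
theorem sum_falling_tmul_pow (hh : h ^ p = h) (hg : g ^ p = 1) (hge : (g : A) = 1 - e) :
    ∑ r ∈ Finset.range p, (((-1) ^ r * (r ! : K)⁻¹) • falling h 0 r) ⊗ₜ[R] (e ^ r) =
      twistSum R p h g := by
  refine ext_tmul_eigenProj (p := p) h fun j hj => ?_
  rw [twistSum_mul_eigenProj hh hg, zpow_natCast, Units.val_pow_eq_pow_val, hge, sub_eq_neg_add,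
    ((Commute.one_right (-e))).add_pow, TensorProduct.tmul_sum, Finset.sum_mul]
  symm
  refine (Finset.sum_subset (Finset.range_subset_range.2 hj) fun l _ hl => ?_).trans
    (Finset.sum_congr rfl fun l hl => ?_)
  · rw [Nat.choose_eq_zero_of_lt (by simpa using hl)]
    simp
  · rw [tmul_mul_tmul, mul_one, one_pow, mul_one, smul_mul_assoc, falling_mul_eigenProj hh,
      ← nsmul_eq_mul, ← Nat.cast_smul_eq_nsmul K, smul_smul,
      Nat.descFactorial_eq_factorial_mul_choose, Nat.cast_mul, mul_assoc, ← mul_assoc _ (l ! : K),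
      inv_mul_cancel₀ (factorial_ne_zero_of_lt (Finset.mem_range.1 hl)), one_mul, mul_smul,
      Nat.cast_smul_eq_nsmul, ← (Nat.cast_commute _ _).eq, ← nsmul_eq_mul, neg_pow,
      TensorProduct.tmul_smul]
    rcases Nat.even_or_odd l with h1 | h1
    · rw [h1.neg_one_pow, h1.neg_one_pow, one_smul, one_mul, TensorProduct.smul_tmul']
    · rw [h1.neg_one_pow, h1.neg_one_pow, neg_one_smul, neg_one_mul, TensorProduct.neg_tmul,
        TensorProduct.tmul_neg, smul_neg, TensorProduct.smul_tmul']

end TwistSum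

/-! ### The basic twist satisfies the Drinfel'd axioms. -/

section Hopf

variable {R A : Type*} [CommRing R] [Ring A] [HopfAlgebra R A] {p : ℕ} [Fact p.Prime] [CharP A p]
  {h e : A} {g g' : Aˣ}

variable (R) in
/-- `x` is primitive. -/
structure IsPrimitive (x : A) : Prop where
  comul : Bialgebra.comulAlgHom R A x = x ⊗ₜ[R] (1 : A) + (1 : A) ⊗ₜ[R] x
  counit : Bialgebra.counitAlgHom R A x = 0
  antipode : antipode R x = -x

omit [Fact p.Prime] [CharP A p] in
theorem IsTwistPair.counit_zpow (H : IsTwistPair p h e g g') (he : IsPrimitive R e) (j : ℕ) :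
    Bialgebra.counitAlgHom R A ((g ^ (j : ℤ) : Aˣ) : A) = 1 := by
  rw [zpow_natCast, Units.val_pow_eq_pow_val, map_pow, H.val, map_sub, he.counit]
  simp

/-- Twisting makes `g` group-like. Moving past the twist turns `e ⊗ 1` into `e ⊗ g`, as `e` has
weight `1`, and fixes `1 ⊗ e`; thus `1 - e ⊗ 1 - 1 ⊗ e` becomes `1 - e ⊗ g - 1 ⊗ e = g ⊗ g`. -/
theorem IsTwistPair.twistSum_mul_comul (H : IsTwistPair p h e g g')
    (he : IsPrimitive R e) :
    twistSum R p h g * Bialgebra.comulAlgHom R A g = ((g : A) ⊗ₜ[R] (g : A)) * twistSum R p h g := by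
  have h1 := twistSum_mul_tmul_one (R := R) (c := 1) H.pow_h H.pow_g (by simpa using H.mul_eq)
  have hge : Commute (g : A) e := by
    rw [H.val]
    exact (Commute.one_left e).sub_left rfl
  have h2 : twistSum R p h g * ((1 : A) ⊗ₜ[R] e) = ((1 : A) ⊗ₜ[R] e) * twistSum R p h g :=
    (commute_twistSum_tmul (Commute.one_right h) hge).eq
  rw [zpow_one] at h1
  have h3 : Bialgebra.comulAlgHom R A (g : A) = 1 - e ⊗ₜ[R] (1 : A) - (1 : A) ⊗ₜ[R] e := by
    rw [H.val, map_sub, map_one, he.comul]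
    abel
  rw [h3, mul_sub, mul_sub, h1, h2, mul_one]
  have h4 : (g : A) ⊗ₜ[R] (g : A) = 1 - e ⊗ₜ[R] (g : A) - (1 : A) ⊗ₜ[R] e := by
    have : (g : A) ⊗ₜ[R] (g : A) = (1 - e) ⊗ₜ[R] (g : A) := by rw [← H.val]
    rw [this, TensorProduct.sub_tmul, one_def]
    conv_lhs => enter [1]; rw [H.val, TensorProduct.tmul_sub]
    abel
  rw [h4, sub_mul, sub_mul, one_mul]

theorem inclLeft_mul_tmul (z : A ⊗[R] A) (a b c : A) :
    inclLeft R A z * (a ⊗ₜ[R] (b ⊗ₜ[R] c)) =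
      inclLeft R A (z * (a ⊗ₜ[R] b)) * inclRight R A ((1 : A) ⊗ₜ[R] c) := by
  have : a ⊗ₜ[R] (b ⊗ₜ[R] c) = inclLeft R A (a ⊗ₜ[R] b) * inclRight R A ((1 : A) ⊗ₜ[R] c) := by
    rw [inclLeft_tmul, inclRight_apply]
    simp
  rw [this, ← mul_assoc, ← map_mul]

theorem commute_inclLeft_inclRight (z : A ⊗[R] A) (c : A) :
    Commute (inclLeft R A z) (inclRight R A ((1 : A) ⊗ₜ[R] c)) := by
  induction z with
  | zero => simp
  | add x y hx hy =>
    rw [map_add]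
    exact hx.add_left hy
  | tmul x y =>
    rw [inclLeft_tmul, inclRight_apply, Commute, SemiconjBy]
    simp

/-- `Δ(h) = h ⊗ 1 + 1 ⊗ h` acts on `π_a ⊗ π_b` by `a + b`, so only the term with `i = a + b` modulo
`p` survives. -/
theorem comulLeft_twistSum_mul (H : IsTwistPair p h e g g') (hh : IsPrimitive R h) (a b : ℤ) :
    comulLeft R A (twistSum R p h g) *
        (eigenProj p h a ⊗ₜ[R] (eigenProj p h b ⊗ₜ[R] (1 : A))) =
      eigenProj p h a ⊗ₜ[R] (eigenProj p h b ⊗ₜ[R] ((g ^ (a + b) : Aˣ) : A)) := by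
  have hpA : (p : A ⊗[R] A) = 0 := by
    have := map_natCast (includeLeft (R := R) (S := R) (A := A) (B := A)) p
    rw [← this, CharP.cast_eq_zero A p, map_zero]
  have hz : (h ⊗ₜ[R] (1 : A) + (1 : A) ⊗ₜ[R] h) * (eigenProj p h a ⊗ₜ[R] eigenProj p h b) =
      (a + b : ℤ) * (eigenProj p h a ⊗ₜ[R] eigenProj p h b) := by
    rw [add_mul, tmul_mul_tmul, tmul_mul_tmul, mul_eigenProj H.pow_h, mul_eigenProj H.pow_h,
      one_mul, one_mul, ← zsmul_eq_mul, ← zsmul_eq_mul, ← zsmul_eq_mul, TensorProduct.tmul_smul,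
      ← TensorProduct.smul_tmul', add_smul]
  have hΔ (i : ℤ) := eigenProj_mul_of_mul_eq (p := p) hpA hz i
  have hsum : comulLeft R A (twistSum R p h g) = ∑ i ∈ Finset.range p,
      inclLeft R A (eigenProj p (h ⊗ₜ[R] (1 : A) + (1 : A) ⊗ₜ[R] h) i) *
        inclRight R A ((1 : A) ⊗ₜ[R] ((g ^ (i : ℤ) : Aˣ) : A)) := by
    rw [twistSum, map_sum]
    refine Finset.sum_congr rfl fun i _ => ?_
    rw [comulLeft_tmul, map_eigenProj, hh.comul]
  have hel (x y z : A) : x ⊗ₜ[R] (y ⊗ₜ[R] z) =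
      inclLeft R A (x ⊗ₜ[R] y) * inclRight R A ((1 : A) ⊗ₜ[R] z) := by
    rw [inclLeft_tmul, inclRight_apply]
    simp
  have h1 (i : ℕ) : inclLeft R A (eigenProj p (h ⊗ₜ[R] (1 : A) + (1 : A) ⊗ₜ[R] h) i) *
        inclRight R A ((1 : A) ⊗ₜ[R] ((g ^ (i : ℤ) : Aˣ) : A)) *
        (eigenProj p h a ⊗ₜ[R] (eigenProj p h b ⊗ₜ[R] (1 : A))) =
      if ((i : ℤ) : ZMod p) = (a + b : ℤ) then eigenProj p h a ⊗ₜ[R] (eigenProj p h b ⊗ₜ[R]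
        ((g ^ (i : ℤ) : Aˣ) : A)) else 0 := by
    rw [← inclLeft_tmul, mul_assoc, ← (commute_inclLeft_inclRight _ _).eq, ← mul_assoc, ← map_mul,
      hΔ]
    by_cases hi : ((i : ℤ) : ZMod p) = (a + b : ℤ)
    · rw [if_pos hi, if_pos hi, hel]
    · rw [if_neg hi, if_neg hi, map_zero, zero_mul]
  rw [hsum, Finset.sum_mul, Finset.sum_congr rfl fun i _ => h1 i,
    sum_range_ite_intCast (fun i => eigenProj p h a ⊗ₜ[R] (eigenProj p h b ⊗ₜ[R]
        ((g ^ i : Aˣ) : A)))]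
  intro i j hij
  rw [zpow_congr_of_pow_eq_one H.pow_g hij]

theorem comulRight_twistSum_mul (H : IsTwistPair p h e g g') (a : ℕ) :
    comulRight R A (twistSum R p h g) * (eigenProj p h a ⊗ₜ[R] (1 : A ⊗[R] A)) =
      eigenProj p h a ⊗ₜ[R] ((Bialgebra.comulAlgHom R A g) ^ a) := by
  have := sum_tmul_mul_eigenProj (R := R) H.pow_h
    (fun i => Bialgebra.comulAlgHom R A ((g ^ i : Aˣ) : A))
    (fun _ _ hij => by rw [zpow_congr_of_pow_eq_one H.pow_g hij]) a
  rw [zpow_natCast, Units.val_pow_eq_pow_val, map_pow] at this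
  rw [← this, twistSum, map_sum]
  rfl

/-- The basic twist is a Drinfel'd twist. -/
theorem IsTwistPair.isDrinfeldTwist (H : IsTwistPair p h e g g')
    (hh : IsPrimitive R h) (he : IsPrimitive R e) : IsDrinfeldTwist R (twistSum R p h g) := by
  refine ⟨?_, (cocycle_iff _).2 ?_, ?_, ?_⟩
  · exact (⟨_, _, twistSum_mul_twistSum_inv H.pow_h H.pow_g,
      twistSum_inv_mul_twistSum H.pow_h H.pow_g⟩ : (A ⊗[R] A)ˣ).isUnit
  -- On `π_a ⊗ π_b ⊗ 1` both sides equal `π_a ⊗ g^a π_b ⊗ g^(a+b)`; on the right this uses `F Δ(g)^a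
  -- = (g ⊗ g)^a F`.
  · refine ext_tmul_eigenProj (p := p) h fun a _ => ?_
    have h1 : (1 : A ⊗[R] A) = ∑ b ∈ Finset.range p, eigenProj p h b ⊗ₜ[R] (1 : A) := by
      rw [← TensorProduct.sum_tmul, sum_eigenProj, one_def]
    have hc : ((g : A) ⊗ₜ[R] (g : A)) ^ a * (twistSum R p h g) =
        twistSum R p h g * (Bialgebra.comulAlgHom R A g) ^ a :=
      (SemiconjBy.pow_right (H.twistSum_mul_comul he) a).eq.symm
    conv_rhs => rw [mul_assoc, comulRight_twistSum_mul H, inclRight_apply, tmul_mul_tmul, one_mul,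
      ← hc, tmul_pow, ← mul_one (_ * twistSum R p h g)]
    rw [h1, TensorProduct.tmul_sum, Finset.mul_sum, Finset.mul_sum, TensorProduct.tmul_sum]
    refine Finset.sum_congr rfl fun b _ => ?_
    rw [mul_assoc, comulLeft_twistSum_mul H hh, inclLeft_mul_tmul, mul_assoc _ (twistSum R p h g),
      twistSum_mul_eigenProj H.pow_h H.pow_g]
    have h2 : eigenProj p h a ⊗ₜ[R] eigenProj p h b =
        (eigenProj p h a ⊗ₜ[R] (1 : A)) * ((1 : A) ⊗ₜ[R] eigenProj p h b) := by simp
    rw [h2, ← mul_assoc, twistSum_mul_eigenProj H.pow_h H.pow_g, tmul_mul_tmul, tmul_mul_tmul,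
      inclLeft_tmul, inclRight_apply, tmul_mul_tmul, tmul_mul_tmul, zpow_add, Units.val_mul,
      zpow_natCast, Units.val_pow_eq_pow_val]
    simp
  -- As `ε(h) = 0`, the scalar `ε(π_i)` is `1` for `i = 0` and `0` for the other residues. The base
  -- ring inherits `p = 0` from `A` through the counit.
  · change counitLeft R A (twistSum R p h g) = 1
    have hpR : (p : R) = 0 := by
      rw [← map_natCast (Bialgebra.counitAlgHom R A), CharP.cast_eq_zero A p, map_zero]
    have h1 (i : ℕ) : eigenProj p (0 : R) i = if ((i : ℤ) : ZMod p) = (0 : ℤ) then 1 else 0 := by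
      rw [← eigenProj_mul_of_mul_eq (h := (0 : R)) (z := 1) (a := 0) hpR (by simp) i, mul_one]
    have h2 (i : ℕ) : counitLeft R A (eigenProj p h i ⊗ₜ[R] ((g ^ (i : ℤ) : Aˣ) : A)) =
        if ((i : ℤ) : ZMod p) = (0 : ℤ) then ((g ^ (i : ℤ) : Aˣ) : A) else 0 := by
      rw [counitLeft_tmul]
      change Bialgebra.counitAlgHom R A _ • _ = _
      rw [map_eigenProj, hh.counit, h1]
      split_ifs <;> simp
    rw [twistSum, map_sum, Finset.sum_congr rfl fun i _ => h2 i,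
      sum_range_ite_intCast (fun i => ((g ^ i : Aˣ) : A)), zpow_zero, Units.val_one]
    intro i j hij
    rw [zpow_congr_of_pow_eq_one H.pow_g hij]
  -- As `ε(g) = 1`, what remains is the sum of all projections.
  · change counitRight R A (twistSum R p h g) = 1
    rw [twistSum, map_sum, ← sum_eigenProj (p := p) h]
    refine Finset.sum_congr rfl fun i _ => ?_
    rw [counitRight_tmul]
    change Bialgebra.counitAlgHom R A _ • _ = _
    rw [H.counit_zpow he, one_smul]

theorem antipode_pow (a : A) (j : ℕ) : antipode R (a ^ j) = antipode R a ^ j := by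
  induction j with
  | zero => simp
  | succ j ih => rw [pow_succ, antipode_mul_antidistrib, ih, pow_succ']

omit [Fact p.Prime] [CharP A p] in
theorem IsTwistPair.antipode_zpow (H : IsTwistPair p h e g g') (he : IsPrimitive R e) (j : ℕ) :
    antipode R ((g ^ (j : ℤ) : Aˣ) : A) = ((g' ^ (j : ℤ) : Aˣ) : A) := by
  rw [zpow_natCast, zpow_natCast, Units.val_pow_eq_pow_val, Units.val_pow_eq_pow_val, antipode_pow,
    H.val, H.val', map_sub, he.antipode, antipode_one, sub_neg_eq_add]

-- The antipode places `S(g^i) = g'^i` to the right of the contraction of `z`; the commutation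
-- hypothesis brings it back next to `π_i`.
omit [Fact p.Prime] [CharP A p] in
theorem IsTwistPair.mulAntipodeRight_twistSum_mul (H : IsTwistPair p h e g g')
    (he : IsPrimitive R e) (z : A ⊗[R] A) (hz : Commute (mulAntipodeRight R A z) (g' : A)) :
    mulAntipodeRight R A (twistSum R p h g * z) =
      antipodeSum p h g' * mulAntipodeRight R A z := by
  rw [twistSum, Finset.sum_mul, map_sum, antipodeSum, Finset.sum_mul]
  refine Finset.sum_congr rfl fun i _ => ?_
  rw [mulAntipodeRight_tmul_mul, H.antipode_zpow he, mul_assoc, mul_assoc,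
    (hz.symm.units_zpow_left i).eq]

omit [Fact p.Prime] [CharP A p] in
theorem IsTwistPair.mulAntipodeRight_twistSum (H : IsTwistPair p h e g g')
    (he : IsPrimitive R e) :
    mulAntipodeRight R A (twistSum R p h g) = antipodeSum p h g' := by
  have h1 : mulAntipodeRight R A 1 = 1 := by
    rw [one_def, mulAntipodeRight_tmul, antipode_one, mul_one]
  have := H.mulAntipodeRight_twistSum_mul he 1 (by rw [h1]; exact Commute.one_left _)
  rwa [mul_one, h1, mul_one] at this

end Hopf

end JacobsonWitt
end

/-! ### The product of two commuting basic twists. -/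

noncomputable section

namespace JacobsonWitt

open Algebra.TensorProduct HopfAlgebra

/-- The two pairs `h, e` and `h₂, e₂` commute with each other. -/
structure PairsCommute {A : Type*} [Ring A] (h e h₂ e₂ : A) : Prop where
  hh : Commute h h₂
  he : Commute h e₂
  eh : Commute e h₂
  ee : Commute e e₂

section Units

variable {A : Type*} [Ring A] {p : ℕ} {h e : A} {g g' : Aˣ}

theorem IsTwistPair.commute_g (H : IsTwistPair p h e g g') {x : A} (hx : Commute e x) :
    Commute (g : A) x := by
  rw [H.val]
  exact (Commute.one_left x).sub_left hx

theorem IsTwistPair.commute_g' (H : IsTwistPair p h e g g') {x : A} (hx : Commute e x) :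
    Commute (g' : A) x := by
  rw [H.val']
  exact (Commute.one_left x).add_left hx

theorem commute_antipodeSum {x : A} (hx : Commute h x) (hg : Commute (g' : A) x) :
    Commute (antipodeSum p h g') x :=
  Commute.sum_left _ _ _ fun i _ => (eigenProj_commute hx i).mul_left (hg.units_zpow_left i)

end Units

variable {R A : Type*} [CommRing R] [Ring A] [HopfAlgebra R A] {p : ℕ} [Fact p.Prime] [CharP A p]
  {h e h₂ e₂ : A} {g g' g₂ g₂' : Aˣ}

omit [Fact p.Prime] [CharP A p] in
theorem commute_twistSum_add {x : A} (hx : Commute h x) (hg : Commute (g : A) x) :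
    Commute (twistSum R p h g) (x ⊗ₜ[R] (1 : A) + (1 : A) ⊗ₜ[R] x) :=
  (commute_twistSum_tmul hx (Commute.one_right _)).add_right
    (commute_twistSum_tmul (Commute.one_right _) hg)

/-- The twist of the first pair commutes with `Δ(h₂)` and `Δ(e₂)`, by primitivity of `h₂` and `e₂`,
hence with `Δ` of the projections of `h₂` and of the powers of `g₂`. This is what
`IsDrinfeldTwist.mul` asks for. -/
theorem isDrinfeldTwist_mul (H : IsTwistPair p h e g g') (H₂ : IsTwistPair p h₂ e₂ g₂ g₂')
    (C : PairsCommute h e h₂ e₂) (hh : IsPrimitive R h) (he : IsPrimitive R e)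
    (hh₂ : IsPrimitive R h₂) (he₂ : IsPrimitive R e₂) :
    IsDrinfeldTwist R (twistSum R p h₂ g₂ * twistSum R p h g) := by
  refine (H₂.isDrinfeldTwist hh₂ he₂).mul (H.isDrinfeldTwist hh he) ?_ ?_
  · rw [twistSum, map_sum]
    refine Commute.sum_left _ _ _ fun i _ => ?_
    rw [comulLeft_tmul, map_eigenProj, hh₂.comul]
    refine Commute.mul_left ?_ (commute_inclLeft_inclRight _ _).symm
    refine Commute.map (f := inclLeft R A) (eigenProj_commute ?_ i)
    exact (commute_twistSum_add C.hh (H.commute_g C.eh)).symm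
  · rw [twistSum, map_sum]
    refine Commute.sum_left _ _ _ fun i _ => ?_
    rw [comulRight_tmul, inclRight_apply, zpow_natCast, Units.val_pow_eq_pow_val, map_pow]
    have h1 : Commute (twistSum R p h g) (Bialgebra.comulAlgHom R A (g₂ : A)) := by
      rw [H₂.val, map_sub, map_one, he₂.comul]
      exact (Commute.one_right _).sub_right (commute_twistSum_add C.he (H.commute_g C.ee))
    have h2 := (h1.pow_right i).eq
    rw [Commute, SemiconjBy, tmul_mul_tmul, tmul_mul_tmul, h2, one_mul, mul_one]

variable {K : Type*} [Field K] [CharP K p] [Algebra K A]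

/-- The two conjugation rules are applied in turn: the outer twist commutes with the factors in `h`
and `g` created by the inner one and acts only on `x` and its divided commutators. -/
theorem twistSum_mul_twistSum_mul (hp : p ≠ 2) (H : IsTwistPair p h e g g')
    (H₂ : IsTwistPair p h₂ e₂ g₂ g₂') (C : PairsCommute h e h₂ e₂) {x : A} {c c₂ : ℤ}
    (hx : h * x = x * (h + c)) (hx₂ : h₂ * x = x * (h₂ + c₂)) :
    twistSum R p h₂ g₂ * twistSum R p h g * (x ⊗ₜ[R] (1 : A) + (1 : A) ⊗ₜ[R] x) =
      (x ⊗ₜ[R] ((g ^ c * g₂ ^ c₂ : Aˣ) : A) +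
        ∑ l ∈ Finset.range p, ∑ s ∈ Finset.range p, (-1) ^ (l + s) *
          ((rising h 0 l * rising h₂ 0 s) ⊗ₜ[R] (((g ^ (-(l : ℤ)) * g₂ ^ (-(s : ℤ)) : Aˣ) : A) *
            divAd K e l (divAd K e₂ s x)))) * (twistSum R p h₂ g₂ * twistSum R p h g) := by
  have hgg (i : ℤ) : Commute (g₂ : A) ((g ^ i : Aˣ) : A) :=
    (H₂.commute_g (H.commute_g C.ee).symm).units_zpow_right i
  have h1 : twistSum R p h₂ g₂ * (twistSum R p h g * (x ⊗ₜ[R] (1 : A))) =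
      x ⊗ₜ[R] ((g ^ c * g₂ ^ c₂ : Aˣ) : A) * (twistSum R p h₂ g₂ * twistSum R p h g) := by
    have h2 : x ⊗ₜ[R] ((g ^ c : Aˣ) : A) = ((1 : A) ⊗ₜ[R] ((g ^ c : Aˣ) : A)) * x ⊗ₜ[R] (1 : A) := by
      simp
    rw [twistSum_mul_tmul_one H.pow_h H.pow_g hx, h2, ← mul_assoc, ← mul_assoc,
      (commute_twistSum_tmul (Commute.one_right h₂) (hgg c)).eq, mul_assoc _ (twistSum R p h₂ g₂),
      twistSum_mul_tmul_one H₂.pow_h H₂.pow_g hx₂, ← mul_assoc, tmul_mul_tmul, one_mul,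
      Units.val_mul, mul_assoc]
  have h3 : twistSum R p h₂ g₂ * (twistSum R p h g * ((1 : A) ⊗ₜ[R] x)) =
      (∑ l ∈ Finset.range p, ∑ s ∈ Finset.range p, (-1) ^ (l + s) *
          ((rising h 0 l * rising h₂ 0 s) ⊗ₜ[R] (((g ^ (-(l : ℤ)) * g₂ ^ (-(s : ℤ)) : Aˣ) : A) *
            divAd K e l (divAd K e₂ s x)))) * (twistSum R p h₂ g₂ * twistSum R p h g) := by
    rw [H.twistSum_mul_one_tmul hp (K := K) x, ← mul_assoc, ← mul_assoc]
    congr 1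
    rw [twistedRight, Finset.mul_sum, Finset.sum_mul]
    refine Finset.sum_congr rfl fun l _ => ?_
    have h4 : rising h 0 l ⊗ₜ[R] (((g ^ (-(l : ℤ)) : Aˣ) : A) * divAd K e l x) =
        (rising h 0 l ⊗ₜ[R] ((g ^ (-(l : ℤ)) : Aˣ) : A)) * ((1 : A) ⊗ₜ[R] divAd K e l x) := by
      simp
    have h5 : Commute (twistSum R p h₂ g₂) ((-1) ^ l * rising h 0 l ⊗ₜ[R]
        ((g ^ (-(l : ℤ)) : Aˣ) : A)) := by
      refine Commute.mul_right ((Commute.one_right _).neg_right.pow_right l)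
        (commute_twistSum_tmul ?_ (hgg _))
      simpa using commute_rising C.hh.symm 0 l
    rw [h4, ← mul_assoc ((-1) ^ l), ← mul_assoc (twistSum R p h₂ g₂), h5.eq, mul_assoc, H₂.twistSum_mul_one_tmul hp (K := K),
      ← mul_assoc]
    congr 1
    rw [twistedRight, Finset.mul_sum]
    refine Finset.sum_congr rfl fun s _ => ?_
    have h6 : Commute (rising h 0 l ⊗ₜ[R] ((g ^ (-(l : ℤ)) : Aˣ) : A)) ((-1) ^ s) :=
      (Commute.one_right _).neg_right.pow_right s
    rw [mul_assoc, ← mul_assoc (rising h 0 l ⊗ₜ[R] _), h6.eq, mul_assoc, tmul_mul_tmul,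
      ← mul_assoc, ← pow_add, Units.val_mul, mul_assoc, divAd_comm C.ee]
  rw [mul_add, mul_assoc, mul_assoc, h1, h3, add_mul]

/-- The second rule applies to each `divAd K e l x` because `e` commutes with `h₂`, so the weight
under `h₂` is still `c₂`. -/
theorem antipodeSum_mul_antipodeSum_mul (H : IsTwistPair p h e g g')
    (H₂ : IsTwistPair p h₂ e₂ g₂ g₂') (C : PairsCommute h e h₂ e₂) {x : A} {c c₂ : ℤ}
    (hx : h * x = x * (h + c)) (hx₂ : h₂ * x = x * (h₂ + c₂)) :
    antipodeSum p h₂ g₂' * antipodeSum p h g' * x =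
      ((g ^ (-c) * g₂ ^ (-c₂) : Aˣ) : A) * (∑ l ∈ Finset.range p, ∑ s ∈ Finset.range p,
        divAd K e l (divAd K e₂ s x) * rising h 1 l * rising h₂ 1 s) *
        (antipodeSum p h₂ g₂' * antipodeSum p h g') := by
  have hw (i : ℤ) : Commute (antipodeSum p h₂ g₂') ((g ^ i : Aˣ) : A) :=
    (commute_antipodeSum (H.commute_g C.eh).symm
      (H₂.commute_g' (H.commute_g C.ee).symm)).units_zpow_right i
  have hwr (l : ℕ) : Commute (antipodeSum p h₂ g₂') (rising h 1 l) := by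
    simpa using commute_rising (commute_antipodeSum C.hh.symm (H₂.commute_g' C.he.symm)) 1 l
  have hrr (l s : ℕ) : Commute (rising h₂ 1 s) (rising h 1 l) := by
    have h1 := commute_rising C.hh.symm 1 l
    have h2 := commute_rising h1.symm 1 s
    simpa using h2.symm
  rw [mul_assoc, H.antipodeSum_mul (K := K) hx, ← mul_assoc, ← mul_assoc, ← mul_assoc]
  congr 1
  rw [(hw _).eq, mul_assoc, Units.val_mul, mul_assoc, mul_assoc]
  congr 1
  rw [Finset.mul_sum, Finset.sum_mul, Finset.mul_sum]
  refine Finset.sum_congr rfl fun l _ => ?_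
  rw [← mul_assoc, H₂.antipodeSum_mul (K := K) (weight_divAd_of_commute C.eh.symm hx₂ l),
    mul_assoc, (hwr l).eq, mul_assoc]
  congr 1
  rw [← mul_assoc]
  congr 1
  rw [Finset.sum_mul]
  refine Finset.sum_congr rfl fun s _ => ?_
  rw [mul_assoc, (hrr l s).eq, divAd_comm C.ee.symm, mul_assoc]

end JacobsonWitt
end

noncomputable section

namespace JacobsonWitt

/-! ### Bases of the truncated polynomial algebra and of its derivations. -/

section TruncatedPolynomials

variable (K : Type*) [Field K] (p n : ℕ)

/-- The monomial `x^β` of `O(n; 1)`. -/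
def xm (β : Fin n → ℕ) : O K p n := Ideal.Quotient.mk _ (∏ j, MvPolynomial.X j ^ β j)

theorem dp_eq_smul_xm (α : Fin n → ℕ) : dp K p n α = (∏ j, ((α j)! : K))⁻¹ • xm K p n α := rfl

theorem xm_add (α β : Fin n → ℕ) : xm K p n (α + β) = xm K p n α * xm K p n β := by
  rw [xm, xm, xm, ← map_mul, ← Finset.prod_mul_distrib]
  simp only [Pi.add_apply, pow_add]

theorem prod_X_pow_eq_monomial (β : Fin n → ℕ) :
    (∏ j, (MvPolynomial.X j : MvPolynomial (Fin n) K) ^ β j) =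
      MvPolynomial.monomial (Finsupp.equivFunOnFinite.symm β) 1 := by
  rw [MvPolynomial.monomial_eq, map_one, one_mul, Finsupp.prod_fintype]
  · rfl
  · simp

theorem xm_eq_mk_monomial (β : Fin n → ℕ) :
    xm K p n β = Ideal.Quotient.mk _
      (MvPolynomial.monomial (Finsupp.equivFunOnFinite.symm β) (1 : K)) := by
  rw [xm, prod_X_pow_eq_monomial]

theorem xm_eq_zero {β : Fin n → ℕ} {j : Fin n} (hj : p ≤ β j) : xm K p n β = 0 := by
  rw [xm, Ideal.Quotient.eq_zero_iff_mem]
  refine Ideal.mem_of_dvd _ (Finset.dvd_prod_of_mem _ (Finset.mem_univ j)) ?_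
  exact Ideal.mem_of_dvd _ (pow_dvd_pow _ hj) (Ideal.subset_span ⟨j, rfl⟩)

/-- The ideal is monomial: each monomial occurring in `f` is divisible by some `X_i ^ p`. -/
theorem coeff_eq_zero_of_mem {α : Fin n → ℕ} (hα : ∀ j, α j < p) {f : MvPolynomial (Fin n) K}
    (hf : f ∈ Ideal.span (Set.range fun i : Fin n =>
      (MvPolynomial.X i : MvPolynomial (Fin n) K) ^ p)) :
    f.coeff (Finsupp.equivFunOnFinite.symm α) = 0 := by
  have h1 : (Set.range fun i : Fin n => (MvPolynomial.X i : MvPolynomial (Fin n) K) ^ p) =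
      (fun s => MvPolynomial.monomial s (1 : K)) '' Set.range fun i : Fin n => Finsupp.single i p := by
    rw [← Set.range_comp]
    exact congrArg Set.range (funext fun i => MvPolynomial.X_pow_eq_monomial)
  rw [h1, MvPolynomial.mem_ideal_span_monomial_image] at hf
  by_contra h0
  obtain ⟨_, ⟨i, rfl⟩, hi⟩ := hf _ (MvPolynomial.mem_support_iff.2 h0)
  have h2 : p ≤ (Finsupp.equivFunOnFinite.symm α : Fin n →₀ ℕ) i := by simpa using hi i
  exact absurd (hα i) (not_lt.2 h2)

/-- The coefficient of `x^α`, `α < p`, on `O(n; 1)`. -/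
def xcoeff (α : Fin n → ℕ) (hα : ∀ j, α j < p) : O K p n →ₗ[K] K :=
  Submodule.liftQ ((Ideal.span (Set.range fun i : Fin n =>
      (MvPolynomial.X i : MvPolynomial (Fin n) K) ^ p)).restrictScalars K)
    (MvPolynomial.lcoeff K (Finsupp.equivFunOnFinite.symm α))
    (fun _ hf => coeff_eq_zero_of_mem K p n hα hf) ∘ₗ
  (Submodule.Quotient.restrictScalarsEquiv K (Ideal.span (Set.range fun i : Fin n =>
      (MvPolynomial.X i : MvPolynomial (Fin n) K) ^ p))).symm.toLinearMap

theorem xcoeff_xm {α : Fin n → ℕ} (hα : ∀ j, α j < p) (β : Fin n → ℕ) :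
    xcoeff K p n α hα (xm K p n β) = if β = α then 1 else 0 := by
  rw [xm_eq_mk_monomial]
  change MvPolynomial.coeff (Finsupp.equivFunOnFinite.symm α)
    (MvPolynomial.monomial (Finsupp.equivFunOnFinite.symm β) (1 : K)) = _
  rw [MvPolynomial.coeff_monomial]
  simp

theorem span_xm : Submodule.span K (Set.range (xm K p n)) = ⊤ := by
  rw [eq_top_iff]
  rintro x -
  obtain ⟨f, rfl⟩ := Ideal.Quotient.mk_surjective x
  induction f using MvPolynomial.induction_on' with
  | monomial s a =>
    have : Ideal.Quotient.mk (Ideal.span (Set.range fun i : Fin n =>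
        (MvPolynomial.X i : MvPolynomial (Fin n) K) ^ p)) (MvPolynomial.monomial s a) =
        a • xm K p n s := by
      rw [xm_eq_mk_monomial, ← Ideal.Quotient.mkₐ_eq_mk K, ← map_smul, MvPolynomial.smul_monomial,
        smul_eq_mul, mul_one]
      congr 2
      ext
      simp
    rw [this]
    exact Submodule.smul_mem _ _ (Submodule.subset_span ⟨s, rfl⟩)
  | add f g hf hg =>
    rw [map_add]
    exact Submodule.add_mem _ hf hg

variable {K p n} in
theorem linearMap_ext_xm {M : Type*} [AddCommGroup M] [Module K M] {f g : O K p n →ₗ[K] M}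
    (h : ∀ β, f (xm K p n β) = g (xm K p n β)) : f = g :=
  LinearMap.ext_on_range (span_xm K p n) h

variable [CharP K p]

/-- When `β j = 0` the exponent on the right is truncated, harmlessly, since the coefficient is
zero. -/
theorem D_xm (j : Fin n) (β : Fin n → ℕ) :
    D K p n j (xm K p n β) = (β j : K) • xm K p n (β - Pi.single j 1) := by
  rw [xm_eq_mk_monomial, D_mk, MvPolynomial.pderiv_monomial, xm_eq_mk_monomial,
    ← Ideal.Quotient.mkₐ_eq_mk K, ← map_smul, MvPolynomial.smul_monomial, smul_eq_mul, mul_one,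
    one_mul]
  congr 3
  refine Finsupp.ext fun i => ?_
  rcases eq_or_ne i j with rfl | h
  · simp
  · simp [h]

/-- The generator `x_j`. -/
def xg (j : Fin n) : O K p n := Ideal.Quotient.mk _ (MvPolynomial.X j)

omit [CharP K p] in
theorem xg_eq_xm (j : Fin n) : xg K p n j = xm K p n (Pi.single j 1) := by
  rw [xg, xm, Finset.prod_eq_single j]
  · simp
  · intro b _ hb
    simp [hb]
  · simp

theorem D_xg (i j : Fin n) : D K p n i (xg K p n j) = if i = j then 1 else 0 := by
  rw [xg, D_mk, MvPolynomial.pderiv_X]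
  split_ifs with h
  · subst h; simp
  · rw [Pi.single_eq_of_ne (Ne.symm h), map_zero]

omit [CharP K p] in
variable {K p n} in
theorem derivation_ext {d d' : W K p n} (h : ∀ j, d (xg K p n j) = d' (xg K p n j)) : d = d' := by
  refine Derivation.ext_of_adjoin_eq_top (Set.range (xg K p n)) ?_ ?_
  · have h1 : Set.range (xg K p n) = Ideal.Quotient.mkₐ K (Ideal.span (Set.range fun i : Fin n =>
        (MvPolynomial.X i : MvPolynomial (Fin n) K) ^ p)) '' Set.range MvPolynomial.X := by
      rw [← Set.range_comp]
      rfl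
    rw [h1, Algebra.adjoin_image, MvPolynomial.adjoin_range_X, Algebra.map_top,
      AlgHom.range_eq_top]
    exact Ideal.Quotient.mkₐ_surjective K _
  · rintro _ ⟨j, rfl⟩
    exact h j

omit [CharP K p] in
theorem derivation_sum_apply {ι : Type*} (s : Finset ι) (f : ι → W K p n) (x : O K p n) :
    (∑ i ∈ s, f i) x = ∑ i ∈ s, f i x := by
  rw [← Derivation.coeFnAddMonoidHom_apply, map_sum, Finset.sum_apply]
  rfl

/-- A derivation of `O(n; 1)` is the tuple of its values on the generators. -/
def derivationEquiv : W K p n ≃ₗ[K] (Fin n → O K p n) where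
  toFun d j := d (xg K p n j)
  map_add' _ _ := rfl
  map_smul' _ _ := rfl
  invFun f := ∑ i, f i • D K p n i
  left_inv d := derivation_ext fun j => by
    simp [derivation_sum_apply, D_xg]
  right_inv f := by
    funext j
    simp [derivation_sum_apply, D_xg]

variable [Fact p.Prime]

theorem factorial_prod_ne_zero {α : Fin n → ℕ} (hα : ∀ j, α j < p) :
    (∏ j, ((α j)! : K)) ≠ 0 :=
  Finset.prod_ne_zero_iff.2 fun j _ => factorial_ne_zero_of_lt (hα j)

omit [CharP K p] [Fact p.Prime] in
theorem xcoeff_dp {α β : Fin n → ℕ} (hα : ∀ j, α j < p) :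
    xcoeff K p n α hα (dp K p n β) = if β = α then (∏ j, ((α j)! : K))⁻¹ else 0 := by
  rw [dp_eq_smul_xm, map_smul, xcoeff_xm]
  split_ifs with h
  · simp [h]
  · simp

/-- The divided powers `x^(α)`, `0 ≤ α ≤ τ`, form a basis of `O(n; 1)`. -/
def dpBasis : Module.Basis (Fin n → Fin p) K (O K p n) :=
  Module.Basis.mk (v := fun α : Fin n → Fin p => dp K p n fun j => α j)
    (by
      rw [Fintype.linearIndependent_iff]
      intro c hc α
      have h1 := congrArg (xcoeff K p n (fun j => α j) fun j => (α j).2) hc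
      rw [map_sum, map_zero, Finset.sum_eq_single α] at h1
      · rw [map_smul, xcoeff_dp, if_pos rfl, smul_eq_mul] at h1
        exact (mul_eq_zero.1 h1).resolve_right
          (inv_ne_zero (factorial_prod_ne_zero K p n fun j => (α j).2))
      · intro β _ hβ
        rw [map_smul, xcoeff_dp, if_neg, smul_zero]
        intro h
        exact hβ (funext fun j => Fin.ext (congrFun h j))
      · simp)
    (by
      rw [← span_xm, Submodule.span_le]
      rintro _ ⟨β, rfl⟩
      by_cases h : ∀ j, β j < p
      · have h1 : xm K p n β = (∏ j, ((β j)! : K)) • dp K p n β := by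
          rw [dp_eq_smul_xm, smul_smul, mul_inv_cancel₀ (factorial_prod_ne_zero K p n h), one_smul]
        rw [h1]
        exact Submodule.smul_mem _ _ (Submodule.subset_span ⟨fun j => ⟨β j, h j⟩, rfl⟩)
      · push Not at h
        obtain ⟨j, hj⟩ := h
        rw [xm_eq_zero K p n hj]
        exact Submodule.zero_mem _)

theorem dpBasis_apply (α : Fin n → Fin p) : dpBasis K p n α = dp K p n fun j => α j :=
  Module.Basis.mk_apply _ _ _

/-- The elements `x^(α) D_i`, `0 ≤ α ≤ τ`, form a basis of `W(n; 1)`. -/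
def xDBasis : Module.Basis (Σ _ : Fin n, Fin n → Fin p) K (W K p n) :=
  (Pi.basis fun _ : Fin n => dpBasis K p n).map (derivationEquiv K p n).symm

theorem xDBasis_apply (b : Σ _ : Fin n, Fin n → Fin p) :
    xDBasis K p n b = xD K p n (fun j => b.2 j) b.1 := by
  rw [xDBasis, Module.Basis.map_apply, LinearEquiv.symm_apply_eq]
  obtain ⟨i, α⟩ := b
  rw [Pi.basis_apply, dpBasis_apply]
  funext j
  change _ = xD K p n (fun j => α j) i (xg K p n j)
  rw [xD, Derivation.smul_apply, D_xg]
  rcases eq_or_ne i j with rfl | h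
  · simp
  · simp [h, h.symm]

end TruncatedPolynomials

end JacobsonWitt
end

noncomputable section

namespace JacobsonWitt

/-! ### Brackets of the elements `x^(α) D_i`. -/

section Brackets

variable (K : Type*) [Field K] (p n : ℕ) [CharP K p]

theorem lie_smul_D (f g : O K p n) (i j : Fin n) :
    ⁅f • D K p n i, g • D K p n j⁆ =
      (f * D K p n i g) • D K p n j - (g * D K p n j f) • D K p n i := by
  refine derivation_ext fun l => ?_
  rw [Derivation.commutator_apply]
  simp only [Derivation.smul_apply, Derivation.sub_apply, D_xg, smul_eq_mul, Derivation.leibniz]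
  split_ifs <;> simp

theorem xm_single_mul_D (k : Fin n) (β : Fin n → ℕ) :
    xm K p n (Pi.single k 1) * D K p n k (xm K p n β) = (β k : K) • xm K p n β := by
  rw [D_xm, mul_smul_comm, ← xm_add]
  by_cases h : β k = 0
  · simp [h]
  · congr 2
    funext j
    rcases eq_or_ne j k with rfl | hj
    · simp; omega
    · simp [hj]

omit [CharP K p] in
theorem dp_single_one (k : Fin n) : dp K p n (Pi.single k 1) = xm K p n (Pi.single k 1) := by
  rw [dp_eq_smul_xm, Finset.prod_eq_one, inv_one, one_smul]
  intro j _
  rcases eq_or_ne j k with rfl | hj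
  · simp
  · simp [hj]

theorem hW_eq (k : Fin n) : hW K p n k = xm K p n (Pi.single k 1) • D K p n k := by
  rw [hW, xD, dp_single_one]

/-- The factor `2` cancels the `2!` of the divided power, as `2` is invertible: `e(k)` is `x_k²
D_k`. -/
theorem eW_eq (hp : p ≠ 2) [Fact p.Prime] (k : Fin n) :
    eW K p n k = xm K p n (Pi.single k 2) • D K p n k := by
  have h2 : (2 : K) ≠ 0 := by
    have := factorial_ne_zero_of_lt (K := K) (p := p) (l := 2)
      (lt_of_le_of_ne (Fact.out : p.Prime).two_le (Ne.symm hp))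
    simpa using this
  have h1 : (∏ j, (((Pi.single k 2 : Fin n → ℕ) j)! : K)) = 2 := by
    rw [Finset.prod_eq_single k]
    · simp
    · intro j _ hj
      simp [hj]
    · simp
  rw [eW, xD, dp_eq_smul_xm, h1, smul_assoc, smul_smul, mul_inv_cancel₀ h2, one_smul]

theorem D_xm_single_of_ne {i k : Fin n} (h : i ≠ k) (a : ℕ) :
    D K p n i (xm K p n (Pi.single k a)) = 0 := by
  rw [D_xm]
  simp [h]

/-- The weight found here is the exponent of `1 - e(k) t` in the coproduct. -/
theorem lie_hW_xD (k i : Fin n) (α : Fin n → ℕ) :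
    ⁅hW K p n k, xD K p n α i⁆ = (((α k : ℤ) - if i = k then 1 else 0 : ℤ) : K) • xD K p n α i := by
  rw [hW_eq, xD, lie_smul_D, dp_eq_smul_xm, Derivation.map_smul, mul_smul_comm, xm_single_mul_D]
  refine Derivation.ext fun f => ?_
  simp only [Derivation.sub_apply, Derivation.smul_apply, smul_eq_mul, smul_mul_assoc]
  rcases eq_or_ne i k with rfl | h
  · rw [← xg_eq_xm, D_xg, if_pos rfl, if_pos rfl, mul_one, smul_comm (_ : K)⁻¹,
      Int.cast_sub, Int.cast_one, Int.cast_natCast, sub_smul, one_smul]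
  · rw [D_xm_single_of_ne K p n h, if_neg h, mul_zero, zero_mul, smul_zero, sub_zero, smul_comm]
    simp

omit [CharP K p] in
theorem lie_smul_W (r : K) (d d' : W K p n) : ⁅d, r • d'⁆ = r • ⁅d, d'⁆ :=
  lie_smul r d d'

theorem lie_hW_eW [Fact p.Prime] (k : Fin n) : ⁅hW K p n k, eW K p n k⁆ = eW K p n k := by
  rw [eW, lie_smul_W, lie_hW_xD, if_pos rfl, Pi.single_eq_same]
  norm_num

theorem lie_single_of_ne {k m : Fin n} (h : k ≠ m) (a b : ℕ) :
    ⁅xm K p n (Pi.single k a) • D K p n k, xm K p n (Pi.single m b) • D K p n m⁆ = 0 := by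
  rw [lie_smul_D, D_xm_single_of_ne K p n h, D_xm_single_of_ne K p n h.symm]
  refine Derivation.ext fun f => ?_
  simp only [Derivation.sub_apply, Derivation.smul_apply, smul_eq_mul, mul_zero, zero_mul, sub_zero,
    Derivation.zero_apply]

end Brackets

/-! ### The natural representation of `u(W(n; 1))`. -/

section Representation

variable (K : Type*) [Field K] (p n : ℕ) [CharP K p]

/-- The action of `x^(α) D_i` iterated on monomials. -/
theorem smul_D_pow_xm (α β : Fin n → ℕ) (i : Fin n) (r : ℕ) :
    (((xm K p n α • D K p n i : W K p n) : Module.End K (O K p n)) ^ r) (xm K p n β) =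
      ((∏ s ∈ Finset.range r, ((β i : ℤ) + s * (α i - 1) : ℤ) : ℤ) : K) •
        xm K p n (β + r • α - Pi.single i r) := by
  induction r with
  | zero => simp
  | succ r ih =>
    rw [pow_succ', Module.End.mul_apply, ih, map_smul]
    change _ • (xm K p n α * D K p n i (xm K p n _)) = _
    rw [D_xm, mul_smul_comm, ← xm_add, smul_smul, Finset.prod_range_succ]
    have h1 : (β + r • α - Pi.single i r : Fin n → ℕ) i = β i + r * α i - r := by simp
    rw [h1]
    -- The exponent of `x_i` is a truncated difference. In the first case no truncation occurs; in
    -- the second the new factor is zero; the third forces `α i = 0`, and the factor at `s = β i` is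
    -- already zero.
    rcases lt_trichotomy r (β i + r * α i) with hr | hr | hr
    · congr 1
      · push_cast [Nat.cast_sub hr.le]
        ring
      · congr 1
        funext j
        rcases eq_or_ne j i with rfl | hj
        · simp only [Pi.add_apply, Pi.sub_apply, Pi.smul_apply, smul_eq_mul, Pi.single_eq_same,
            add_mul, one_mul]
          omega
        · simp only [Pi.add_apply, Pi.sub_apply, Pi.smul_apply, smul_eq_mul,
            Pi.single_eq_of_ne hj, add_mul, one_mul]
          omega
    · have h2 : ((β i : ℤ) + r * (α i - 1) : ℤ) = 0 := by
        have : (r : ℤ) = β i + r * α i := by exact_mod_cast hr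
        linarith
      rw [h2, ← hr]
      simp
    · have h0 : α i = 0 := by
        by_contra h0
        have := Nat.le_mul_of_pos_right r (Nat.pos_of_ne_zero h0)
        omega
      have h2 : ∏ s ∈ Finset.range r, ((β i : ℤ) + s * (α i - 1) : ℤ) = 0 := by
        refine Finset.prod_eq_zero (i := β i) (Finset.mem_range.2 (by simpa [h0] using hr)) ?_
        rw [h0]
        push_cast
        ring
      rw [h2]
      simp

variable [Fact p.Prime]

/-- If `α i = 1`, another variable `x_j` divides `x^α`, and `p` applications produce `x_j ^ p = 0`.
Otherwise `β i + s (α i - 1)` takes every residue modulo `p` as `s` runs below `p`, so one factor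
vanishes. -/
theorem smul_D_pow_char_eq_zero {α : Fin n → ℕ} {i : Fin n} (hα : ∀ j, α j ≤ p - 1)
    (hne : α ≠ Pi.single i 1) :
    ((xm K p n α • D K p n i : W K p n) : Module.End K (O K p n)) ^ p = 0 := by
  have hp := (Fact.out : p.Prime).two_le
  refine linearMap_ext_xm fun β => ?_
  rw [smul_D_pow_xm, LinearMap.zero_apply]
  by_cases hi : α i = 1
  · obtain ⟨j, hj⟩ : ∃ j, α j ≠ (Pi.single i 1 : Fin n → ℕ) j := Function.ne_iff.1 hne
    have hji : j ≠ i := by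
      rintro rfl
      exact hj (by simpa using hi)
    rw [Pi.single_eq_of_ne hji] at hj
    rw [xm_eq_zero K p n (j := j), smul_zero]
    have := Nat.le_mul_of_pos_right p (Nat.pos_of_ne_zero hj)
    simp only [Pi.add_apply, Pi.sub_apply, Pi.smul_apply, smul_eq_mul, Pi.single_eq_of_ne hji]
    omega
  · have h1 : (α i : ZMod p) - 1 ≠ 0 := by
      rw [sub_ne_zero]
      intro h
      have h2 : (α i : ZMod p) = (1 : ℕ) := by simpa using h
      rw [ZMod.natCast_eq_natCast_iff', Nat.mod_eq_of_lt, Nat.mod_eq_of_lt] at h2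
      · exact hi h2
      · omega
      · have := hα i
        omega
    have h2 : ((∏ s ∈ Finset.range p, ((β i : ℤ) + s * (α i - 1) : ℤ) : ℤ) : K) = (0 : ℤ) := by
      refine intCast_congr (p := p) (CharP.cast_eq_zero K p) ?_
      push_cast
      refine Finset.prod_eq_zero (i := (-(β i : ZMod p) / (α i - 1)).val)
        (Finset.mem_range.2 (ZMod.val_lt _)) ?_
      rw [ZMod.natCast_zmod_val, div_mul_cancel₀ _ h1, add_neg_cancel]
    rw [h2, Int.cast_zero, zero_smul]

theorem single_smul_D_pow_char (i : Fin n) :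
    ((xm K p n (Pi.single i 1) • D K p n i : W K p n) : Module.End K (O K p n)) ^ p =
      (xm K p n (Pi.single i 1) • D K p n i : W K p n) := by
  refine linearMap_ext_xm fun β => ?_
  rw [smul_D_pow_xm]
  change _ = xm K p n (Pi.single i 1) * D K p n i (xm K p n β)
  rw [xm_single_mul_D]
  congr 1
  · refine Eq.trans ?_ (Int.cast_natCast (β i))
    refine intCast_congr (p := p) (CharP.cast_eq_zero K p) ?_
    simp [ZMod.pow_card]
  · congr 1
    funext j
    rcases eq_or_ne j i with rfl | hj
    · simp
    · simp [hj]

/-- The natural representation of `u(W(n; 1))` on `O(n; 1)`. -/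
def natRep : u K p n →ₐ[K] Module.End K (O K p n) :=
  lift
    { toFun := fun d => (d : O K p n →ₗ[K] O K p n)
      map_add' := fun _ _ => rfl
      map_smul' := fun _ _ => rfl }
    (fun x y => Derivation.commutator_coe_linear_map)
    (fun i => by
      have h := single_smul_D_pow_char K p n i
      rwa [← dp_single_one] at h)
    (fun α i hα hne => by
      change ((xD K p n α i : W K p n) : Module.End K (O K p n)) ^ p = 0
      rw [xD, dp_eq_smul_xm, smul_assoc, Derivation.coe_smul_linearMap, smul_pow, smul_D_pow_char_eq_zero K p n hα hne, smul_zero])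

theorem natRep_ι (d : W K p n) (f : O K p n) : natRep K p n (ι K p n d) f = d f :=
  LinearMap.congr_fun (lift_ι _ _ _ _ d) f

/-- On `W(n; 1)` the natural representation is the tautological action of derivations, which is
faithful. -/
theorem ι_injective : Function.Injective (ι K p n) := fun d d' h =>
  Derivation.ext fun f => by rw [← natRep_ι, h, natRep_ι]

end Representation

end JacobsonWitt
end

noncomputable section

namespace JacobsonWitt

/-! ### Ordered monomials. -/

section OrderedMonomials

variable {A : Type*} [Ring A]

/-- The ordered monomial `y₀^{a₀} y₁^{a₁} ⋯`. -/
def orderedMonomial {N : ℕ} (y : Fin N → A) (a : Fin N → ℕ) : A :=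
  (List.ofFn fun i => y i ^ a i).prod

theorem orderedMonomial_zero {N : ℕ} (y : Fin N → A) : orderedMonomial y 0 = 1 := by
  simp [orderedMonomial]

theorem orderedMonomial_succ {N : ℕ} (y : Fin (N + 1) → A) (a : Fin (N + 1) → ℕ) :
    orderedMonomial y a =
      y 0 ^ a 0 * orderedMonomial (fun i => y i.succ) (fun i => a i.succ) := by
  rw [orderedMonomial, List.ofFn_succ, List.prod_cons]
  rfl

theorem orderedMonomial_single {N : ℕ} (y : Fin N → A) (j : Fin N) :
    orderedMonomial y (Pi.single j 1) = y j := by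
  induction N with
  | zero => exact j.elim0
  | succ N ih =>
    rw [orderedMonomial_succ]
    induction j using Fin.cases with
    | zero =>
      have : (fun i : Fin N => (Pi.single 0 1 : Fin (N + 1) → ℕ) i.succ) = 0 := by
        funext i
        simp
      rw [this, orderedMonomial_zero]
      simp
    | succ j =>
      have : (fun i : Fin N => (Pi.single j.succ 1 : Fin (N + 1) → ℕ) i.succ) =
          Pi.single j 1 := by
        funext i
        simp [Pi.single_apply]
      rw [this, ih]
      simp

theorem exists_single_of_sum_eq_one {N : ℕ} {b : Fin N → ℕ} (hb : ∑ i, b i = 1) :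
    ∃ j, b = Pi.single j 1 := by
  obtain ⟨j, -, hj⟩ := Finset.exists_ne_zero_of_sum_ne_zero (hb.trans_ne one_ne_zero)
  rw [← Finset.add_sum_erase _ _ (Finset.mem_univ j)] at hb
  have h1 : ∑ i ∈ Finset.univ.erase j, b i = 0 := by omega
  refine ⟨j, funext fun i => ?_⟩
  rcases eq_or_ne i j with rfl | h
  · rw [Pi.single_eq_same]; omega
  · rw [Pi.single_eq_of_ne h]
    exact Finset.sum_eq_zero_iff.1 h1 i (Finset.mem_erase.2 ⟨h, Finset.mem_univ i⟩)

end OrderedMonomials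

/-! ### Linear independence of ordered monomials in primitive elements. -/

section Independence

variable {K A : Type*} [Field K] [Ring A] [Bialgebra K A] {p : ℕ}

theorem comul_pow_of_primitive {y : A}
    (hy : Bialgebra.comulAlgHom K A y = y ⊗ₜ[K] (1 : A) + (1 : A) ⊗ₜ[K] y) {a : ℕ} (ha : a < p) :
    Bialgebra.comulAlgHom K A (y ^ a) =
      ∑ j : Fin p, (a.choose j : K) • ((y ^ (a - j)) ⊗ₜ[K] (y ^ (j : ℕ))) := by
  have hc : Commute ((1 : A) ⊗ₜ[K] y) (y ⊗ₜ[K] (1 : A)) := by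
    rw [Commute, SemiconjBy]
    simp
  rw [map_pow, hy, add_comm, hc.add_pow,
    Fin.sum_univ_eq_sum_range (fun j => (a.choose j : K) • ((y ^ (a - j)) ⊗ₜ[K] (y ^ j)))]
  refine (Finset.sum_subset (Finset.range_subset_range.2 ha) fun l _ hl => ?_).trans
    (Finset.sum_congr rfl fun l _ => ?_)
  · rw [Nat.choose_eq_zero_of_lt (by simpa using hl)]
    simp
  · rw [← (Nat.cast_commute _ _).eq, ← nsmul_eq_mul, Nat.cast_smul_eq_nsmul]
    simp [Algebra.TensorProduct.tmul_pow]

/-- The binomial theorem in each `y i`. Indices `c` not below `a` contribute nothing, because a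
binomial coefficient vanishes, so truncated differences do no harm. -/
theorem comul_orderedMonomial {N : ℕ} {y : Fin N → A}
    (hy : ∀ i, Bialgebra.comulAlgHom K A (y i) = y i ⊗ₜ[K] (1 : A) + (1 : A) ⊗ₜ[K] y i)
    {a : Fin N → ℕ} (ha : ∀ i, a i < p) :
    Bialgebra.comulAlgHom K A (orderedMonomial y a) =
      ∑ c : Fin N → Fin p, ((∏ i, (a i).choose (c i) : ℕ) : K) •
        (orderedMonomial y (fun i => a i - c i) ⊗ₜ[K] orderedMonomial y (fun i => c i)) := by
  induction N with
  | zero => simp [orderedMonomial, Algebra.TensorProduct.one_def]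
  | succ N ih =>
    rw [orderedMonomial_succ, map_mul, comul_pow_of_primitive (hy 0) (ha 0),
      ih (fun i => hy i.succ) (fun i => ha i.succ), Finset.sum_mul_sum,
      ← Fintype.sum_prod_type', ← Equiv.sum_comp (Fin.consEquiv fun _ => Fin p)]
    refine Finset.sum_congr rfl fun c _ => ?_
    rw [orderedMonomial_succ, orderedMonomial_succ, Fin.prod_univ_succ, smul_mul_smul_comm,
      Algebra.TensorProduct.tmul_mul_tmul]
    simp [Fin.consEquiv]

/-- A dual functional on the span of the `y j` is extended to `A`, then corrected by a multiple of
the counit so as to vanish at `1`; the values at the `y j` do not change. -/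
theorem exists_dual_functional {N : ℕ} {y : Fin N → A}
    (h0 : ∀ i, Bialgebra.counitAlgHom K A (y i) = 0) (hli : LinearIndependent K y) (i : Fin N) :
    ∃ f : A →ₗ[K] K, f 1 = 0 ∧ ∀ j, f (y j) = if j = i then 1 else 0 := by
  obtain ⟨g, hg⟩ := LinearMap.exists_extend ((Module.Basis.span hli).coord i)
  refine ⟨g - g 1 • (Bialgebra.counitAlgHom K A).toLinearMap, by simp, fun j => ?_⟩
  have h1 := LinearMap.congr_fun hg (Module.Basis.span hli j)
  rw [Module.Basis.coord_apply, Module.Basis.repr_self, LinearMap.comp_apply,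
    Submodule.subtype_apply, Module.Basis.span_apply] at h1
  simp only [LinearMap.sub_apply, LinearMap.smul_apply, AlgHom.toLinearMap_apply, h0, smul_zero,
    sub_zero, h1, Finsupp.single_apply]

variable [Fact p.Prime] [CharP K p]

omit [Fact p.Prime] in
/-- Ordered monomials with exponents below `p` in linearly independent primitive elements are
linearly independent. -/
theorem linearIndependent_orderedMonomial {N : ℕ} {y : Fin N → A}
    (hy : ∀ i, Bialgebra.comulAlgHom K A (y i) = y i ⊗ₜ[K] (1 : A) + (1 : A) ⊗ₜ[K] y i)
    (h0 : ∀ i, Bialgebra.counitAlgHom K A (y i) = 0) (hli : LinearIndependent K y) :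
    LinearIndependent K fun a : Fin N → Fin p => orderedMonomial y fun i => (a i : ℕ) := by
  -- Induction on a bound `d` for the total degrees occurring in the relation.
  have key : ∀ d : ℕ, ∀ c : (Fin N → Fin p) → K, (∀ a, d < ∑ i, (a i : ℕ) → c a = 0) →
      ∑ a, c a • orderedMonomial y (fun i => (a i : ℕ)) = 0 → ∀ a, c a = 0 := by
    intro d
    induction d with
    | zero =>
      intro c hc hsum a
      by_cases ha : 0 < ∑ i, (a i : ℕ)
      · exact hc a ha
      have haz (b : Fin N → Fin p) (hb : ¬ 0 < ∑ i, (b i : ℕ)) (i : Fin N) : (b i : ℕ) = 0 :=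
        Finset.sum_eq_zero_iff.1 (by omega : ∑ i, (b i : ℕ) = 0) i (Finset.mem_univ i)
      rw [Finset.sum_eq_single a] at hsum
      · have h1 : (fun i => (a i : ℕ)) = 0 := funext fun i => haz a ha i
        have h2 := congrArg (Bialgebra.counitAlgHom K A) hsum
        rw [h1, orderedMonomial_zero, map_smul, map_one, map_zero, smul_eq_mul, mul_one] at h2
        exact h2
      · intro b _ hb
        rw [hc b, zero_smul]
        by_contra hb0
        exact hb (funext fun i => Fin.ext ((haz b hb0 i).trans (haz a ha i).symm))
      · simp
    | succ d ih =>
      intro c hc hsum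
      refine ih c (fun a₀ ha₀ => ?_) hsum
      rcases lt_or_eq_of_le (Nat.succ_le_of_lt ha₀) with h | h
      · exact hc a₀ h
      obtain ⟨i, -, hi⟩ := Finset.exists_ne_zero_of_sum_ne_zero
        (show ∑ i, (a₀ i : ℕ) ≠ 0 by omega)
      obtain ⟨f, hf1, hf⟩ := exists_dual_functional h0 hli i
      -- The exponent `a₀` with one factor `y i` removed: its coefficient in the derived relation
      -- isolates `c a₀`.
      let e : Fin N → Fin p := Function.update a₀ i ⟨a₀ i - 1, by omega⟩
      have he (j : Fin N) : (e j : ℕ) = a₀ j - (Pi.single i 1 : Fin N → ℕ) j := by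
        rcases eq_or_ne j i with rfl | hj
        · simp [e]
        · simp [e, hj]
      have hea : (fun j => (a₀ j : ℕ) - (e j : ℕ)) = Pi.single i 1 := by
        funext j
        rw [he]
        rcases eq_or_ne j i with rfl | hj
        · rw [Pi.single_eq_same]; omega
        · rw [Pi.single_eq_of_ne hj]; omega
      -- The coefficients of the relation obtained by applying `(f ⊗ id) Δ`. As `f 1 = 0`, this
      -- lowers the degree by at least one, so the induction hypothesis applies to `c'`.
      let c' : (Fin N → Fin p) → K := fun e => ∑ a, c a *
        (((∏ i, (a i : ℕ).choose (e i) : ℕ) : K) * f (orderedMonomial y fun i => a i - e i))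
      have hsub {a e : Fin N → Fin p} (h : ∀ j, e j ≤ a j) :
          ∑ j, ((a j : ℕ) - (e j : ℕ)) + ∑ j, (e j : ℕ) = ∑ j, (a j : ℕ) := by
        rw [← Finset.sum_add_distrib]
        exact Finset.sum_congr rfl fun j _ => Nat.sub_add_cancel (h j)
      have hle {a e : Fin N → Fin p} (h : ¬ ∀ j, e j ≤ a j) :
          (∏ i, (a i : ℕ).choose (e i) : ℕ) = 0 := by
        push Not at h
        obtain ⟨j, hj⟩ := h
        exact Finset.prod_eq_zero (Finset.mem_univ j) (Nat.choose_eq_zero_of_lt hj)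
      have hzero {a e : Fin N → Fin p} (h : ∑ j, ((a j : ℕ) - (e j : ℕ)) = 0) :
          f (orderedMonomial y fun i => a i - e i) = 0 := by
        have : (fun i => (a i : ℕ) - (e i : ℕ)) = 0 :=
          funext fun j => Finset.sum_eq_zero_iff.1 h j (Finset.mem_univ j)
        rw [this, orderedMonomial_zero, hf1]
      have h1 : ∑ e, c' e • orderedMonomial y (fun i => (e i : ℕ)) = 0 := by
        have h2 := congrArg (fun z => TensorProduct.lid K A
          (f.rTensor A (Bialgebra.comulAlgHom K A z))) hsum
        simp only [map_sum, map_smul, map_zero] at h2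
        rw [← h2]
        simp only [c', Finset.sum_smul]
        rw [Finset.sum_comm]
        refine Finset.sum_congr rfl fun a _ => ?_
        rw [comul_orderedMonomial hy fun i => (a i).2]
        simp only [map_sum, map_smul, LinearMap.rTensor_tmul, TensorProduct.lid_tmul,
          Finset.smul_sum, smul_smul]
      have h2 : c' e = 0 := by
        refine ih c' (fun e he => Finset.sum_eq_zero fun a _ => ?_) h1 e
        by_cases hle' : ∀ j, e j ≤ a j
        · by_cases hd : d + 1 < ∑ i, (a i : ℕ)
          · rw [hc a hd, zero_mul]
          · rw [hzero, mul_zero, mul_zero]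
            have := hsub hle'
            omega
        · rw [hle hle']
          simp
      -- Since `e` has degree `d`, only exponents of degree `d + 1` contribute. They differ from `e`
      -- by a single factor `y j`, and `f` selects `j = i`; values of `f` on longer monomials never
      -- matter.
      have h3 : c' e = c a₀ * (a₀ i : ℕ) := by
        have hes : ∑ j, (e j : ℕ) = d := by
          have h4 : ∀ j, e j ≤ a₀ j := fun j => by
            rw [Fin.le_def, he]
            omega
          have h5 := hsub h4
          have h6 : ∑ j, ((a₀ j : ℕ) - (e j : ℕ)) = 1 := by
            have := congrArg (fun b : Fin N → ℕ => ∑ j, b j) hea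
            simpa using this
          omega
        simp only [c']
        rw [Finset.sum_eq_single a₀]
        · rw [hea, orderedMonomial_single, hf, if_pos rfl, mul_one, Finset.prod_eq_single i]
          · rw [he, Pi.single_eq_same]
            have h4 : ((a₀ i : ℕ)).choose ((a₀ i : ℕ) - 1) = a₀ i := by
              rw [Nat.choose_symm (by omega), Nat.choose_one_right]
            rw [h4]
          · intro j _ hj
            rw [he, Pi.single_eq_of_ne hj]
            simp
          · simp
        · intro a _ hne
          by_cases hle' : ∀ j, e j ≤ a j
          · by_cases hd : d + 1 < ∑ i, (a i : ℕ)
            · rw [hc a hd, zero_mul]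
            · have h4 := hsub hle'
              by_cases h5 : ∑ j, ((a j : ℕ) - (e j : ℕ)) = 0
              · rw [hzero h5, mul_zero, mul_zero]
              · obtain ⟨j, hj⟩ := exists_single_of_sum_eq_one
                  (by omega : ∑ j, ((a j : ℕ) - (e j : ℕ)) = 1)
                rw [hj, orderedMonomial_single, hf, if_neg, mul_zero, mul_zero]
                rintro rfl
                refine hne (funext fun l => Fin.ext ?_)
                have h6 := congrFun (hj.trans hea.symm) l
                have h7 := hle' l
                have h8 : (e l : ℕ) ≤ a₀ l := by rw [he]; omega
                rw [Fin.le_def] at h7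
                omega
          · rw [hle hle']
            simp
        · simp
      rw [h3] at h2
      refine (mul_eq_zero.1 h2).resolve_right fun h4 => ?_
      -- `0 < a₀ i < p`, so this integer is nonzero in `K`.
      rw [CharP.cast_eq_zero_iff K p] at h4
      exact absurd (Nat.le_of_dvd (Nat.pos_of_ne_zero hi) h4) (by omega)
  rw [Fintype.linearIndependent_iff]
  intro c hc
  exact key (∑ _i : Fin N, p) c (fun a ha => absurd ha (not_lt.2
    (Finset.sum_le_sum fun i _ => (a i).2.le))) hc

end Independence

/-! ### Spanning by ordered monomials. -/

section Spanning

variable (K : Type*) {A : Type*} [Field K] [Ring A] [Algebra K A] {N : ℕ} (y : Fin N → A)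

/-- The span of the products of at most `d` elements of the family `y`. -/
def wordSpan (d : ℕ) : Submodule K A :=
  Submodule.span K {x | ∃ l : List (Fin N), l.length ≤ d ∧ (l.map y).prod = x}

variable {K y}

theorem prod_mem_wordSpan {l : List (Fin N)} {d : ℕ} (hl : l.length ≤ d) :
    (l.map y).prod ∈ wordSpan K y d :=
  Submodule.subset_span ⟨l, hl, rfl⟩

theorem mul_mem_wordSpan {x z : A} (hx : x ∈ Submodule.span K (Set.range y)) {d : ℕ}
    (hz : z ∈ wordSpan K y d) : x * z ∈ wordSpan K y (d + 1) := by
  have h := Submodule.mul_mem_mul hx hz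
  rw [wordSpan, Submodule.span_mul_span] at h
  refine Submodule.span_mono ?_ h
  rintro _ ⟨_, ⟨i, rfl⟩, _, ⟨l, hl, rfl⟩, rfl⟩
  exact ⟨i :: l, by simpa using hl, by simp⟩

/-- Exchanging adjacent letters costs a commutator, which is a combination of single letters, so the
error consists of words one letter shorter. -/
theorem prod_sub_prod_mem_wordSpan
    (hlie : ∀ i j, y i * y j - y j * y i ∈ Submodule.span K (Set.range y)) {l l' : List (Fin N)}
    (h : l.Perm l') : ∀ d, l.length ≤ d + 1 →
      (l.map y).prod - (l'.map y).prod ∈ wordSpan K y d := by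
  induction h with
  | nil => intro d _; simp
  | @cons x l l' h ih =>
    intro d hd
    rw [List.map_cons, List.map_cons, List.prod_cons, List.prod_cons, ← mul_sub]
    rcases d with _ | d
    · have h1 : l = [] := by simpa using hd
      subst h1
      rw [List.nil_perm.1 h]
      simp
    · exact mul_mem_wordSpan (Submodule.subset_span ⟨x, rfl⟩) (ih d (by simpa using hd))
  | swap a b l =>
    intro d hd
    have h1 : ((b :: a :: l).map y).prod - ((a :: b :: l).map y).prod =
        (y b * y a - y a * y b) * (l.map y).prod := by
      simp only [List.map_cons, List.prod_cons]
      noncomm_ring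
    rw [h1]
    rcases d with _ | d
    · simp at hd
    · exact mul_mem_wordSpan (hlie b a) (prod_mem_wordSpan (by simpa using hd))
  | trans h₁ h₂ ih₁ ih₂ =>
    intro d hd
    rw [← sub_add_sub_cancel]
    exact Submodule.add_mem _ (ih₁ d hd) (ih₂ d (h₁.length_eq ▸ hd))

theorem orderedMonomial_eq_prod (a : Fin N → ℕ) :
    orderedMonomial y a =
      (((List.finRange N).flatMap fun i => List.replicate (a i) i).map y).prod := by
  rw [orderedMonomial, List.ofFn_eq_map, List.map_flatMap, List.flatMap, List.prod_flatten,
    List.map_map]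
  congr 1
  exact List.map_congr_left fun i _ => by simp

theorem perm_flatMap_replicate_count (l : List (Fin N)) :
    l.Perm ((List.finRange N).flatMap fun i => List.replicate (l.count i) i) := by
  rw [List.perm_iff_count]
  intro b
  rw [List.count_flatMap]
  rw [← Fin.sum_univ_def, Finset.sum_eq_single b]
  · simp
  · intro i _ hi
    simp [List.count_replicate, hi]
  · simp

/-- If the commutators and the `p`-th powers of the `y i` are linear combinations of the `y i`, then
the ordered monomials with exponents below `p` span the algebra generated by the `y i`. -/
theorem wordSpan_le_span_orderedMonomial {p : ℕ} (hp : 2 ≤ p)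
    (hlie : ∀ i j, y i * y j - y j * y i ∈ Submodule.span K (Set.range y))
    (hpow : ∀ i, y i ^ p ∈ Submodule.span K (Set.range y)) (d : ℕ) :
    wordSpan K y d ≤ Submodule.span K (Set.range fun a : Fin N → Fin p =>
      orderedMonomial y fun i => (a i : ℕ)) := by
  induction d with
  | zero =>
    rw [wordSpan, Submodule.span_le]
    rintro _ ⟨l, hl, rfl⟩
    have h1 : l = [] := by simpa using hl
    subst h1
    exact Submodule.subset_span ⟨fun _ => ⟨0, by omega⟩, orderedMonomial_zero y⟩
  | succ d ih =>
    rw [wordSpan, Submodule.span_le]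
    rintro _ ⟨l, hl, rfl⟩
    by_cases h : ∀ i, l.count i < p
    · have h1 := ih (prod_sub_prod_mem_wordSpan hlie (perm_flatMap_replicate_count l) d hl)
      rw [← orderedMonomial_eq_prod] at h1
      rw [← sub_add_cancel (l.map y).prod (orderedMonomial y fun i => l.count i)]
      exact Submodule.add_mem _ h1 (Submodule.subset_span ⟨fun i => ⟨l.count i, h i⟩, rfl⟩)
    -- A letter occurs at least `p` times: gather `p` copies in front and replace `y i ^ p` by a
    -- combination of letters. The word gets shorter because `p ≥ 2`.
    · push Not at h
      obtain ⟨i, hi⟩ := h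
      obtain ⟨r, hr⟩ := (List.replicate_sublist_iff.2 hi).exists_perm_append
      have h1 := prod_sub_prod_mem_wordSpan hlie hr d hl
      have h2 : ((List.replicate p i ++ r).map y).prod ∈ wordSpan K y d := by
        rw [List.map_append, List.prod_append, List.map_replicate, List.prod_replicate]
        have h3 := hr.length_eq
        rw [List.length_append, List.length_replicate] at h3
        obtain ⟨d, rfl⟩ : ∃ d', d = d' + 1 := ⟨d - 1, by omega⟩
        exact mul_mem_wordSpan (hpow i) (prod_mem_wordSpan (by omega))
      have h3 := Submodule.add_mem _ h1 h2
      rw [sub_add_cancel] at h3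
      exact ih h3

theorem span_orderedMonomial_eq_top {p : ℕ} (hp : 2 ≤ p)
    (hlie : ∀ i j, y i * y j - y j * y i ∈ Submodule.span K (Set.range y))
    (hpow : ∀ i, y i ^ p ∈ Submodule.span K (Set.range y))
    (hgen : Algebra.adjoin K (Set.range y) = ⊤) :
    Submodule.span K (Set.range fun a : Fin N → Fin p =>
      orderedMonomial y fun i => (a i : ℕ)) = ⊤ := by
  rw [eq_top_iff, ← Algebra.top_toSubmodule, ← hgen, Algebra.adjoin_eq_span, Submodule.span_le]
  intro x hx
  obtain ⟨l, hl, rfl⟩ := Submonoid.exists_list_of_mem_closure hx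
  obtain ⟨l, rfl⟩ : ∃ l' : List (Fin N), l = l'.map y := by
    clear hx
    induction l with
    | nil => exact ⟨[], rfl⟩
    | cons a l ih =>
      obtain ⟨i, hi⟩ := hl a (by simp)
      obtain ⟨l', rfl⟩ := ih fun b hb => hl b (by simp [hb])
      exact ⟨i :: l', by simp [hi]⟩
  exact wordSpan_le_span_orderedMonomial hp hlie hpow l.length (prod_mem_wordSpan le_rfl)

end Spanning

end JacobsonWitt
end

noncomputable section

namespace JacobsonWitt

/-! ### Dimension of `u_{t,q}(W(n; 1))`. -/

section Dimension

variable (K : Type*) [Field K] (p n : ℕ) [CharP K p] [Fact p.Prime]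

theorem isPrimitive_ι (x : W K p n) : IsPrimitive K (ι K p n x) :=
  ⟨comul₀_ι K p n x, counit₀_ι K p n x, antipode₀_ι K p n x⟩

theorem ι_xDBasis_pow_mem (b : Σ _ : Fin n, Fin n → Fin p) :
    ι K p n (xDBasis K p n b) ^ p ∈ Submodule.span K {ι K p n (xDBasis K p n b)} := by
  rw [xDBasis_apply]
  by_cases h : (fun j => (b.2 j : ℕ)) = Pi.single b.1 1
  · rw [h, ι_toral]
    exact Submodule.mem_span_singleton_self _
  · rw [ι_nilp K p n _ _ (fun j => Nat.le_sub_one_of_lt (b.2 j).2) h]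
    exact Submodule.zero_mem _

/-- The restricted Poincaré-Birkhoff-Witt basis of `u(W(n; 1))`. -/
theorem nonempty_basis_u {N : ℕ} (e : Fin N ≃ Σ _ : Fin n, Fin n → Fin p) :
    Nonempty (Module.Basis (Fin N → Fin p) K (u K p n)) := by
  let y : Fin N → u K p n := fun i => ι K p n (xDBasis K p n (e i))
  have hspan : Submodule.span K (Set.range y) = LinearMap.range (ι K p n) := by
    have h1 : Set.range y = ι K p n '' Set.range (xDBasis K p n) := by
      rw [← Set.range_comp, ← e.surjective.range_comp]
      rfl
    rw [h1, Submodule.span_image, (xDBasis K p n).span_eq, Submodule.map_top]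
  have hli : LinearIndependent K y := by
    have h1 := (xDBasis K p n).linearIndependent.comp e e.injective
    rw [Fintype.linearIndependent_iffₛ] at h1
    rw [Fintype.linearIndependent_iff]
    refine fun c hc => h1 c 0 (ι_injective K p n ?_)
    simp only [map_sum, map_smul, Pi.zero_apply, zero_smul, Finset.sum_const_zero]
    exact hc.trans (map_zero (ι K p n)).symm
  refine ⟨Module.Basis.mk (linearIndependent_orderedMonomial (p := p) (y := y)
    (fun i => (isPrimitive_ι K p n _).comul) (fun i => (isPrimitive_ι K p n _).counit) hli)
    (span_orderedMonomial_eq_top (Fact.out : p.Prime).two_le ?_ ?_ ?_).ge⟩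
  · intro i j
    rw [hspan, ← ι_lie]
    exact ⟨_, rfl⟩
  · intro i
    refine Submodule.span_mono ?_ (ι_xDBasis_pow_mem K p n (e i))
    rintro _ rfl
    exact ⟨i, rfl⟩
  · refine eq_top_iff.2 fun a _ => mem_of_ι_mem (K := K) (p := p) (n := n) _ (fun x => ?_) a
    refine Algebra.span_le_adjoin K _ ?_
    rw [hspan]
    exact ⟨x, rfl⟩

omit [Fact p.Prime] in
theorem card_xDBasis : Fintype.card (Σ _ : Fin n, Fin n → Fin p) = n * p ^ n := by
  simp

theorem finite_u : Module.Finite K (u K p n) := by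
  obtain ⟨b⟩ := nonempty_basis_u K p n (Fintype.equivFin _).symm
  exact Module.Finite.of_basis b

theorem finrank_u : Module.finrank K (u K p n) = p ^ (n * p ^ n) := by
  obtain ⟨b⟩ := nonempty_basis_u K p n (Fintype.equivFin _).symm
  rw [Module.finrank_eq_card_basis b, Fintype.card_fun, Fintype.card_fin, Fintype.card_fin,
    card_xDBasis]

variable (q : K)

omit [CharP K p] in
theorem degree_C_mul_X_lt : (Polynomial.C q * Polynomial.X : Polynomial K).degree <
    ((Polynomial.X : Polynomial K) ^ p).degree := by
  rw [Polynomial.degree_X_pow]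
  exact (Polynomial.degree_C_mul_X_le q).trans_lt
    (by exact_mod_cast (Fact.out : p.Prime).one_lt)

omit [CharP K p] in
theorem monic_X_pow_sub_C_mul_X :
    ((Polynomial.X : Polynomial K) ^ p - Polynomial.C q * Polynomial.X).Monic :=
  (Polynomial.monic_X_pow p).sub_of_left (degree_C_mul_X_lt K p q)

omit [CharP K p] in
theorem natDegree_X_pow_sub_C_mul_X :
    ((Polynomial.X : Polynomial K) ^ p - Polynomial.C q * Polynomial.X).natDegree = p := by
  rw [Polynomial.natDegree_eq_of_degree_eq (Polynomial.degree_sub_eq_left_of_degree_lt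
    (degree_C_mul_X_lt K p q)), Polynomial.natDegree_X_pow]

omit [CharP K p] in
theorem finite_Kt : Module.Finite K (Kt K p q) :=
  (monic_X_pow_sub_C_mul_X K p q).finite_adjoinRoot

omit [CharP K p] in
theorem finrank_Kt : Module.finrank K (Kt K p q) = p := by
  rw [(AdjoinRoot.powerBasis' (monic_X_pow_sub_C_mul_X K p q)).finrank,
    AdjoinRoot.powerBasis'_dim, natDegree_X_pow_sub_C_mul_X]

theorem finite_utq : Module.Finite K (utq K p n q) := by
  have := finite_u K p n
  have := finite_Kt K p q
  infer_instance

theorem finrank_utq : Module.finrank K (utq K p n q) = p ^ (1 + n * p ^ n) := by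
  rw [Module.finrank_tensorProduct, finrank_u, finrank_Kt, pow_add, pow_one]

omit [CharP K p] in
theorem nontrivial_Kt : Nontrivial (Kt K p q) := by
  refine AdjoinRoot.nontrivial _ ?_
  rw [Polynomial.degree_eq_natDegree (monic_X_pow_sub_C_mul_X K p q).ne_zero,
    natDegree_X_pow_sub_C_mul_X]
  exact_mod_cast (Fact.out : p.Prime).ne_zero

omit [CharP K p] in
theorem root_ne_zero : AdjoinRoot.root
    ((Polynomial.X : Polynomial K) ^ p - Polynomial.C q * Polynomial.X) ≠ 0 := by
  rw [AdjoinRoot.root, Ne, AdjoinRoot.mk_eq_zero]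
  intro h
  have h1 := Polynomial.natDegree_le_of_dvd h Polynomial.X_ne_zero
  rw [natDegree_X_pow_sub_C_mul_X, Polynomial.natDegree_X] at h1
  exact absurd (Fact.out : p.Prime).one_lt (not_lt.2 h1)

theorem charP_utq : CharP (utq K p n q) p := by
  have := nontrivial_Kt K p q
  have : Nontrivial (utq K p n q) := Bialgebra.nontrivial (R := Kt K p q)
  exact charP_of_injective_algebraMap (algebraMap K (utq K p n q)).injective p

end Dimension

/-! ### The twist pairs inside `u_{t,q}(W(n; 1))`. -/

section StandardHopf

variable (K : Type*) [Field K] (p n : ℕ) [CharP K p] [Fact p.Prime] (q : K)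

theorem isPrimitive_ιA (x : W K p n) : IsPrimitive (Kt K p q) (ιA K p n q x) := by
  have h := isPrimitive_ι K p n x
  refine ⟨?_, ?_, ?_⟩
  · change Coalgebra.comul (R := Kt K p q) ((1 : Kt K p q) ⊗ₜ[K] ι K p n x) = _
    have h1 : Coalgebra.comul (R := K) (ι K p n x) = _ := h.comul
    rw [TensorProduct.comul_tmul, h1]
    simp [TensorProduct.tmul_add]
    rfl
  · change Coalgebra.counit (R := Kt K p q) ((1 : Kt K p q) ⊗ₜ[K] ι K p n x) = _
    have h1 : Coalgebra.counit (R := K) (ι K p n x) = _ := h.counit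
    rw [TensorProduct.counit_tmul, h1]
    simp
  · change HopfAlgebra.antipode (Kt K p q) ((1 : Kt K p q) ⊗ₜ[K] ι K p n x) = _
    rw [TensorProduct.antipode_def, TensorProduct.AlgebraTensorModule.map_tmul, h.antipode,
      TensorProduct.tmul_neg]
    simp
    rfl

theorem IsPrimitive.smul {R A : Type*} [CommRing R] [Ring A] [HopfAlgebra R A] {x : A}
    (hx : IsPrimitive R x) (r : R) : IsPrimitive R (r • x) := by
  refine ⟨?_, ?_, ?_⟩
  · rw [map_smul, hx.comul, smul_add, TensorProduct.smul_tmul', TensorProduct.tmul_smul]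
  · rw [map_smul, hx.counit, smul_zero]
  · rw [map_smul, hx.antipode, smul_neg]

omit [Fact p.Prime] in
theorem commute_tA (x : utq K p n q) : Commute x (tA K p n q) :=
  (Algebra.commutes _ _).symm

omit [Fact p.Prime] in
theorem ιA_lie (x y : W K p n) : ιA K p n q ⁅x, y⁆ =
    ιA K p n q x * ιA K p n q y - ιA K p n q y * ιA K p n q x := by
  change (1 : Kt K p q) ⊗ₜ[K] ι K p n ⁅x, y⁆ = (1 ⊗ₜ[K] ι K p n x) * (1 ⊗ₜ[K] ι K p n y) -
    (1 ⊗ₜ[K] ι K p n y) * (1 ⊗ₜ[K] ι K p n x)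
  rw [ι_lie, TensorProduct.tmul_sub]
  simp

omit [Fact p.Prime] in
theorem mul_ιA_of_lie_eq {h x : W K p n} {c : ℤ} (hx : ⁅h, x⁆ = (c : K) • x) :
    ιA K p n q h * ιA K p n q x = ιA K p n q x * (ιA K p n q h + c) := by
  have h1 := ιA_lie K p n q h x
  rw [hx, map_smul, Int.cast_smul_eq_zsmul, zsmul_eq_mul, (Int.cast_commute _ _).eq] at h1
  rw [mul_add, h1]
  abel

omit [Fact p.Prime] in
theorem commute_ιA_of_lie_eq_zero {x y : W K p n} (h : ⁅x, y⁆ = 0) :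
    Commute (ιA K p n q x) (ιA K p n q y) := by
  have h1 := ιA_lie K p n q x y
  rw [h, map_zero] at h1
  exact sub_eq_zero.1 h1.symm

/-- The nilpotent partner of `h(k)` is `e(k) t`, so the central `t` is absorbed into `e` in the
abstract results. -/
theorem exists_isTwistPair (k : Fin n) : ∃ g' : (utq K p n q)ˣ,
    IsTwistPair p (hA K p n q k) (eA K p n q k * tA K p n q) (oneSub K p n q k) g' := by
  have h0 : IsNilpotent (eA K p n q k * tA K p n q) := ⟨p, eA_mul_tA_pow K p n q k⟩
  refine ⟨h0.isUnit_one_add.unit, ?_, eA_mul_tA_pow K p n q k, ?_, oneSub_val K p n q k, rfl⟩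
  · change ((1 : Kt K p q) ⊗ₜ[K] ι K p n (hW K p n k)) ^ p = 1 ⊗ₜ[K] ι K p n (hW K p n k)
    rw [Algebra.TensorProduct.tmul_pow, one_pow, hW, ι_toral]
  · have h1 := mul_ιA_of_lie_eq K p n q (c := 1) (h := hW K p n k) (x := eW K p n k)
      (by rw [lie_hW_eW, Int.cast_one, one_smul])
    rw [Int.cast_one] at h1
    change hA K p n q k * eA K p n q k = eA K p n q k * (hA K p n q k + 1) at h1
    rw [← mul_assoc, h1, mul_assoc, mul_assoc, (commute_tA K p n q _).eq]

theorem isPrimitive_eA_mul_tA (k : Fin n) :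
    IsPrimitive (Kt K p q) (eA K p n q k * tA K p n q) := by
  rw [(commute_tA K p n q _).eq, tA, ← Algebra.smul_def]
  exact (isPrimitive_ιA K p n q _).smul _

theorem pairsCommute (hp : p ≠ 2) {k m : Fin n} (hkm : k ≠ m) :
    PairsCommute (hA K p n q k) (eA K p n q k * tA K p n q) (hA K p n q m)
      (eA K p n q m * tA K p n q) := by
  have hh : Commute (hA K p n q k) (hA K p n q m) := commute_ιA_of_lie_eq_zero K p n q
    (by rw [hW_eq, hW_eq, lie_single_of_ne K p n hkm])
  have he : Commute (hA K p n q k) (eA K p n q m) := commute_ιA_of_lie_eq_zero K p n q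
    (by rw [hW_eq, eW_eq K p n hp, lie_single_of_ne K p n hkm])
  have eh : Commute (eA K p n q k) (hA K p n q m) := commute_ιA_of_lie_eq_zero K p n q
    (by rw [hW_eq, eW_eq K p n hp, lie_single_of_ne K p n hkm])
  have ee : Commute (eA K p n q k) (eA K p n q m) := commute_ιA_of_lie_eq_zero K p n q
    (by rw [eW_eq K p n hp, eW_eq K p n hp, lie_single_of_ne K p n hkm])
  have t (x : utq K p n q) := commute_tA K p n q x
  exact ⟨hh, he.mul_right (t _), eh.mul_left (t _).symm,
    (ee.mul_right (t _)).mul_left ((t _).symm)⟩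

omit [Fact p.Prime] in
-- Each application of `ad (e(k) t)` releases one central factor `t`. The power `t^s` is allowed in
-- the argument so that the rule can be used twice.
theorem divAd_ιA (k : Fin n) (l s : ℕ) (x : W K p n) :
    divAd K (eA K p n q k * tA K p n q) l (ιA K p n q x * tA K p n q ^ s) =
      ιA K p n q (dW K p n k l x) * tA K p n q ^ (l + s) := by
  have key : (commutator (eA K p n q k * tA K p n q) ^ l) (ιA K p n q x * tA K p n q ^ s) =
      ιA K p n q ((LieAlgebra.ad K (W K p n) (eW K p n k) ^ l) x) * tA K p n q ^ (l + s) := by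
    induction l with
    | zero => simp
    | succ l ih =>
      rw [pow_succ', Module.End.mul_apply, ih, pow_succ', Module.End.mul_apply,
        LieAlgebra.ad_apply, ιA_lie, commutator_apply]
      generalize ιA K p n q ((LieAlgebra.ad K (W K p n) (eW K p n k) ^ l) x) = z
      have h1 (a b : utq K p n q) : a * tA K p n q * (b * tA K p n q ^ (l + s)) =
          a * b * tA K p n q ^ (l + 1 + s) := by
        rw [mul_assoc, ← mul_assoc _ b, ← (commute_tA K p n q b).eq, mul_assoc b, ← pow_succ',
          mul_assoc, add_right_comm]
      have h2 (a b : utq K p n q) : a * tA K p n q ^ (l + s) * (b * tA K p n q) =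
          a * b * tA K p n q ^ (l + 1 + s) := by
        rw [mul_assoc, ← mul_assoc _ b, ← ((commute_tA K p n q b).pow_right _).eq, mul_assoc b,
          ← pow_succ, mul_assoc, add_right_comm]
      rw [h1, h2, sub_mul]
      rfl
  rw [divAd, key, dW, LinearMap.smul_apply, map_smul, smul_mul_assoc]

omit [Fact p.Prime] in
theorem divAd_divAd_ιA (k m : Fin n) (l s : ℕ) (x : W K p n) :
    divAd K (eA K p n q k * tA K p n q) l
      (divAd K (eA K p n q m * tA K p n q) s (ιA K p n q x)) =
      ιA K p n q (dW K p n k l (dW K p n m s x)) * tA K p n q ^ (l + s) := by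
  have h := divAd_ιA K p n q m s 0 x
  rw [pow_zero, mul_one, add_zero] at h
  rw [h, divAd_ιA]

theorem basicTwist_eq_twistSum (k : Fin n) : basicTwist K p n q k =
    twistSum (Kt K p q) p (hA K p n q k) (oneSub K p n q k) := by
  obtain ⟨g', H⟩ := exists_isTwistPair K p n q k
  have := charP_utq K p n q
  rw [← sum_falling_tmul_pow (K := K) H.pow_h H.pow_g H.val, basicTwist]
  refine Finset.sum_congr rfl fun r _ => ?_
  rw [(commute_tA K p n q _).mul_pow]

end StandardHopf

end JacobsonWitt
end

noncomputable section

namespace JacobsonWitt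

/-! ### Functionals detecting noncommutativity and noncocommutativity. -/

section CoefficientFunctionals

variable (K : Type*) [Field K] (p n : ℕ) [CharP K p] [Fact p.Prime] (q : K)

/-- The functional `a ↦` coefficient of `x^γ` in `a · x_k` on `u(W(n; 1))`. -/
def coeffFunctional (k : Fin n) (γ : Fin n → ℕ) (hγ : ∀ j, γ j < p) : u K p n →ₗ[K] K :=
  xcoeff K p n γ hγ ∘ₗ LinearMap.applyₗ (xg K p n k) ∘ₗ (natRep K p n).toLinearMap

theorem coeffFunctional_apply (k : Fin n) (γ : Fin n → ℕ) (hγ : ∀ j, γ j < p) (a : u K p n) :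
    coeffFunctional K p n k γ hγ a = xcoeff K p n γ hγ (natRep K p n a (xg K p n k)) := rfl

/-- The extension of `coeffFunctional` to `u_{t,q}(W(n; 1))`. -/
def coeffFunctionalA (k : Fin n) (γ : Fin n → ℕ) (hγ : ∀ j, γ j < p) :
    utq K p n q →ₗ[Kt K p q] Kt K p q :=
  (TensorProduct.AlgebraTensorModule.rid K (Kt K p q) (Kt K p q)).toLinearMap ∘ₗ
    (coeffFunctional K p n k γ hγ).baseChange (Kt K p q)

theorem coeffFunctionalA_tmul (k : Fin n) (γ : Fin n → ℕ) (hγ : ∀ j, γ j < p) (r : Kt K p q)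
    (a : u K p n) :
    coeffFunctionalA K p n q k γ hγ (r ⊗ₜ[K] a) = coeffFunctional K p n k γ hγ a • r := rfl

theorem single_lt {a : ℕ} (ha : a < p) (k j : Fin n) : (Pi.single k a : Fin n → ℕ) j < p := by
  rcases eq_or_ne j k with rfl | h
  · simpa using ha
  · simpa [h] using (Fact.out : p.Prime).pos

/-- `x_k² D_k` sends `x_k^a` to `a x_k^(a+1)`, and no other monomial contributes to `x_k^(a+1)`. -/
theorem xcoeff_eW_apply (hp : p ≠ 2) (k : Fin n) (a : ℕ) (ha : a + 1 < p) (f : O K p n) :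
    xcoeff K p n (Pi.single k (a + 1)) (single_lt p n ha k) (eW K p n k f) =
      (a : K) * xcoeff K p n (Pi.single k a) (single_lt p n (by omega) k) f := by
  have h : xcoeff K p n (Pi.single k (a + 1)) (single_lt p n ha k) ∘ₗ (eW K p n k : W K p n) =
      (a : K) • xcoeff K p n (Pi.single k a) (single_lt p n (by omega) k) := by
    refine linearMap_ext_xm fun β => ?_
    rw [LinearMap.comp_apply, LinearMap.smul_apply, eW_eq K p n hp, xcoeff_xm]
    change xcoeff K p n _ _ (xm K p n (Pi.single k 2) * D K p n k (xm K p n β)) = _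
    rw [D_xm, mul_smul_comm, ← xm_add, map_smul, xcoeff_xm]
    -- For `β k = 0` the truncated exponent would break the equivalence `h1`, but the coefficient is
    -- zero.
    by_cases hβ : β k = 0
    · rw [hβ, Nat.cast_zero, zero_smul]
      split_ifs with h
      · rw [h, Pi.single_eq_same] at hβ
        rw [hβ, Nat.cast_zero, zero_smul]
      · rw [smul_zero]
    · have h1 : Pi.single k 2 + (β - Pi.single k 1) = (Pi.single k (a + 1) : Fin n → ℕ) ↔
          β = Pi.single k a := by
        rw [funext_iff, funext_iff]
        refine forall_congr' fun j => ?_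
        rcases eq_or_ne j k with rfl | hj
        · simp only [Pi.add_apply, Pi.sub_apply, Pi.single_eq_same]
          omega
        · simp [hj]
      simp only [h1]
      split_ifs with h
      · rw [h, Pi.single_eq_same]
      · rw [smul_zero, smul_zero]
  exact LinearMap.congr_fun h f

theorem coeffFunctionalA_eA_mul (hp : p ≠ 2) (k : Fin n) (a : ℕ) (ha : a + 1 < p)
    (z : utq K p n q) :
    coeffFunctionalA K p n q k (Pi.single k (a + 1)) (single_lt p n ha k) (eA K p n q k * z) =
      (a : K) • coeffFunctionalA K p n q k (Pi.single k a) (single_lt p n (by omega) k) z := by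
  induction z using TensorProduct.induction_on with
  | zero => simp
  | add x y hx hy => rw [mul_add, map_add, map_add, hx, hy, smul_add]
  | tmul r b =>
    change coeffFunctionalA K p n q k _ _ ((1 ⊗ₜ[K] ι K p n (eW K p n k)) * (r ⊗ₜ[K] b)) = _
    rw [Algebra.TensorProduct.tmul_mul_tmul, one_mul, coeffFunctionalA_tmul, coeffFunctionalA_tmul,
      coeffFunctional_apply, map_mul, Module.End.mul_apply, natRep_ι,
      xcoeff_eW_apply K p n hp k a ha, mul_smul]
    rfl

theorem coeffFunctionalA_one (k : Fin n) (h : 1 < p) :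
    coeffFunctionalA K p n q k (Pi.single k 1) (single_lt p n h k) 1 = 1 := by
  rw [Algebra.TensorProduct.one_def, coeffFunctionalA_tmul, coeffFunctional_apply, map_one,
    Module.End.one_apply, xg_eq_xm, xcoeff_xm, if_pos rfl, one_smul]

theorem natRep_hW_xg (k : Fin n) : natRep K p n (ι K p n (hW K p n k)) (xg K p n k) =
    xm K p n (Pi.single k 1) := by
  rw [natRep_ι, hW_eq, xg_eq_xm]
  change xm K p n _ * D K p n k _ = _
  rw [xm_single_mul_D, Pi.single_eq_same, Nat.cast_one, one_smul]

theorem coeffFunctionalA_hA (k : Fin n) {a : ℕ} (ha : a < p) :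
    coeffFunctionalA K p n q k (Pi.single k a) (single_lt p n ha k) (hA K p n q k) =
      if a = 1 then 1 else 0 := by
  change coeffFunctionalA K p n q k _ _ (1 ⊗ₜ[K] ι K p n (hW K p n k)) = _
  rw [coeffFunctionalA_tmul, coeffFunctional_apply, natRep_hW_xg, xcoeff_xm]
  rcases eq_or_ne a 1 with rfl | h
  · simp
  · rw [if_neg, if_neg h, zero_smul]
    intro h1
    have := congrFun h1 k
    simp only [Pi.single_eq_same] at this
    exact h this.symm

theorem eA_ne_zero (hp : p ≠ 2) (k : Fin n) : eA K p n q k ≠ 0 := by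
  have h2 : 1 + 1 < p := lt_of_le_of_ne (Fact.out : p.Prime).two_le (Ne.symm hp)
  have := nontrivial_Kt K p q
  intro h
  have h1 := coeffFunctionalA_eA_mul K p n q hp k 1 h2 1
  rw [h, zero_mul, map_zero, coeffFunctionalA_one K p n q k (by omega), Nat.cast_one, one_smul] at h1
  exact zero_ne_one h1

theorem hA_mul_eA (k : Fin n) :
    hA K p n q k * eA K p n q k = eA K p n q k * (hA K p n q k + 1) := by
  have h1 := mul_ιA_of_lie_eq K p n q (c := 1) (h := hW K p n k) (x := eW K p n k)
    (by rw [lie_hW_eW, Int.cast_one, one_smul])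
  rw [Int.cast_one] at h1
  exact h1

theorem hA_mul_eA_ne (hp : p ≠ 2) (k : Fin n) :
    hA K p n q k * eA K p n q k ≠ eA K p n q k * hA K p n q k := by
  rw [hA_mul_eA, mul_add, mul_one]
  intro h
  exact eA_ne_zero K p n q hp k (by simpa using h)

/-- The extra term `h(k) ⊗ (1 - e(k) t)⁻¹ e(k) t` of the twisted coproduct of `h(k)` is not
symmetric. -/
theorem hA_tmul_ne (hp : p ≠ 2) (k : Fin n) :
    hA K p n q k ⊗ₜ[Kt K p q] (eA K p n q k * tA K p n q * ((oneSub K p n q k)⁻¹ : (utq K p n q)ˣ))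
      ≠ (eA K p n q k * tA K p n q * ((oneSub K p n q k)⁻¹ : (utq K p n q)ˣ)) ⊗ₜ[Kt K p q]
        hA K p n q k := by
  have h2 : 1 + 1 < p := lt_of_le_of_ne (Fact.out : p.Prime).two_le (Ne.symm hp)
  have h1 : 0 + 1 < p := by omega
  set f₁ := coeffFunctionalA K p n q k (Pi.single k 1) (single_lt p n h1 k)
  set f₂ := coeffFunctionalA K p n q k (Pi.single k 2) (single_lt p n h2 k)
  intro h
  have hh₁ : f₁ (hA K p n q k) = 1 := (coeffFunctionalA_hA K p n q k h1).trans (if_pos rfl)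
  have hh₂ : f₂ (hA K p n q k) = 0 := (coeffFunctionalA_hA K p n q k h2).trans (if_neg (by omega))
  have he₁ (z : utq K p n q) : f₁ (eA K p n q k * z) = 0 :=
    (coeffFunctionalA_eA_mul K p n q hp k 0 h1 z).trans (by simp)
  have he₂ (z : utq K p n q) : f₂ (eA K p n q k * z) = f₁ z :=
    (coeffFunctionalA_eA_mul K p n q hp k 1 h2 z).trans (by simp [f₁])
  -- Under `f₁ ⊗ f₂` the right side gives `0`, as `f₂` kills `h(k)`. The left side gives `t f₁((1 -
  -- e(k) t)⁻¹) = t`, since `(1 - e(k) t)⁻¹` is `1` plus a left multiple of `e(k)`, which `f₁`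
  -- kills.
  have h3 := congrArg (fun z => LinearMap.mul' (Kt K p q) (Kt K p q) (TensorProduct.map f₁ f₂ z)) h
  simp only [TensorProduct.map_tmul, LinearMap.mul'_apply, hh₁, hh₂, mul_zero, one_mul] at h3
  have hg : (((oneSub K p n q k)⁻¹ : (utq K p n q)ˣ) : utq K p n q) =
      1 + eA K p n q k * (tA K p n q * ((oneSub K p n q k)⁻¹ : (utq K p n q)ˣ)) := by
    have h4 := (oneSub K p n q k).mul_inv
    rw [oneSub_val, sub_mul, one_mul, sub_eq_iff_eq_add, mul_assoc] at h4
    exact h4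
  have h5 : f₁ ((oneSub K p n q k)⁻¹ : (utq K p n q)ˣ) = 1 := by
    rw [hg, map_add, he₁, add_zero]
    exact coeffFunctionalA_one K p n q k h1
  rw [mul_assoc, he₂, tA, ← Algebra.smul_def, map_smul, h5, smul_eq_mul, mul_one] at h3
  exact root_ne_zero K p q h3

end CoefficientFunctionals

/-! ### The twisted coproduct of the toral element. -/

section TwistedToral

variable {R A : Type*} [CommRing R] [Ring A] [HopfAlgebra R A] {p : ℕ} [Fact p.Prime] [CharP A p]
  {h e : A} {g g' : Aˣ} (K : Type*) [Field K] [CharP K p] [Algebra K A]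

include K in
/-- The twisted coproduct of the toral element itself. -/
theorem IsTwistPair.twistSum_mul_one_tmul_toral (hp : p ≠ 2) (H : IsTwistPair p h e g g') :
    twistSum R p h g * ((1 : A) ⊗ₜ[R] h) =
      ((1 : A) ⊗ₜ[R] h + h ⊗ₜ[R] (e * (g⁻¹ : Aˣ))) * twistSum R p h g := by
  rw [H.twistSum_mul_one_tmul hp (K := K) h]
  congr 1
  -- Since `[e, h] = -e` commutes with `e`, only the terms `l = 0` and `l = 1` survive.
  have hc1 : commutator e h = -e := by
    rw [commutator_apply, H.mul_eq]
    noncomm_ring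
  have hc2 (l : ℕ) : (commutator e ^ (l + 2)) h = 0 := by
    rw [pow_add, Module.End.mul_apply, pow_two, Module.End.mul_apply, hc1, map_neg,
      commutator_apply, sub_self, neg_zero, map_zero]
  obtain ⟨r, rfl⟩ : ∃ r, p = r + 2 := ⟨p - 2, by have := (Fact.out : p.Prime).two_le; omega⟩
  rw [twistedRight, Finset.sum_range_succ', Finset.sum_range_succ', Finset.sum_eq_zero, zero_add]
  · have hg : Commute ((g⁻¹ : Aˣ) : A) e :=
      (H.commute_g (Commute.refl e)).units_inv_left
    simp [divAd, hc1, rising, hg.eq, add_comm, TensorProduct.tmul_neg]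
  · intro l _
    rw [add_assoc, divAd, hc2]
    simp

end TwistedToral

end JacobsonWitt
end

noncomputable section

namespace JacobsonWitt

/-! ### Assembling the twisted structure. -/

section TwistedProduct

open HopfAlgebra

variable {R A : Type*} [CommRing R] [Ring A] [HopfAlgebra R A] {p : ℕ} [Fact p.Prime] [CharP A p]
  {h e h₂ e₂ : A} {g g' g₂ g₂' : Aˣ}

omit [Fact p.Prime] [CharP A p] in
theorem mulAntipodeRight_twistSum_mul_twistSum (H : IsTwistPair p h e g g')
    (H₂ : IsTwistPair p h₂ e₂ g₂ g₂') (C : PairsCommute h e h₂ e₂) (he : IsPrimitive R e)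
    (he₂ : IsPrimitive R e₂) :
    mulAntipodeRight R A (twistSum R p h₂ g₂ * twistSum R p h g) =
      antipodeSum p h₂ g₂' * antipodeSum p h g' := by
  rw [H₂.mulAntipodeRight_twistSum_mul he₂, H.mulAntipodeRight_twistSum he]
  rw [H.mulAntipodeRight_twistSum he]
  exact commute_antipodeSum (H₂.commute_g' C.he.symm).symm
    (H.commute_g' (H₂.commute_g' C.ee.symm).symm)

omit [Fact p.Prime] [CharP A p] in
theorem twistHopf_comul_eq {F G : A ⊗[R] A} (hF : IsDrinfeldTwist R F) (hFG : F * G = 1)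
    (hGF : G * F = 1) {x : A} (hx : IsPrimitive R x) {z : A ⊗[R] A}
    (hz : F * (x ⊗ₜ[R] 1 + 1 ⊗ₜ[R] x) = z * F) : (twistHopf hF hFG hGF).comul x = z := by
  change F * Bialgebra.comulAlgHom R A x * G = z
  rw [hx.comul, hz, mul_assoc, hFG, mul_one]

omit [Fact p.Prime] [CharP A p] in
theorem twistHopf_counit_eq {F G : A ⊗[R] A} (hF : IsDrinfeldTwist R F) (hFG : F * G = 1)
    (hGF : G * F = 1) {x : A} (hx : IsPrimitive R x) : (twistHopf hF hFG hGF).counit x = 0 :=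
  hx.counit

omit [Fact p.Prime] [CharP A p] in
theorem twistHopf_antipode_eq {F G : A ⊗[R] A} (hF : IsDrinfeldTwist R F) (hFG : F * G = 1)
    (hGF : G * F = 1) {x w y : A} (hx : IsPrimitive R x) (hw : mulAntipodeRight R A F = w)
    (hy : w * x = y * w) : (twistHopf hF hFG hGF).antipode x = -y := by
  have h1 := hF.mulAntipodeRight_mul_mulAntipodeLeft hFG hGF
  change mulAntipodeRight R A F * antipode R x * mulAntipodeLeft R A G = _
  rw [hw] at h1 ⊢
  rw [hx.antipode, mul_neg, neg_mul, hy, mul_assoc, h1, mul_one]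

variable (K : Type*) [Field K] [CharP K p] [Algebra K A]

-- The twist of the second pair commutes with all three terms produced from `h` by the first, so the
-- asymmetric term persists under the full twist.
include K in
theorem twistSum_mul_twistSum_mul_toral (hp : p ≠ 2) (H : IsTwistPair p h e g g')
    (H₂ : IsTwistPair p h₂ e₂ g₂ g₂') (C : PairsCommute h e h₂ e₂) :
    twistSum R p h₂ g₂ * twistSum R p h g * (h ⊗ₜ[R] (1 : A) + (1 : A) ⊗ₜ[R] h) =
      (h ⊗ₜ[R] (1 : A) + (1 : A) ⊗ₜ[R] h + h ⊗ₜ[R] (e * (g⁻¹ : Aˣ))) *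
        (twistSum R p h₂ g₂ * twistSum R p h g) := by
  have h1 : twistSum R p h g * (h ⊗ₜ[R] (1 : A)) = (h ⊗ₜ[R] (1 : A)) * twistSum R p h g :=
    (commute_twistSum_tmul (Commute.refl h) (Commute.one_right _)).eq
  have hg₂e : Commute (g₂ : A) (e * (g⁻¹ : Aˣ)) :=
    (H₂.commute_g C.ee.symm).mul_right (H.commute_g (H₂.commute_g C.ee.symm).symm).symm.units_inv_right
  have h2 : Commute (twistSum R p h₂ g₂)
      (h ⊗ₜ[R] (1 : A) + (1 : A) ⊗ₜ[R] h + h ⊗ₜ[R] (e * (g⁻¹ : Aˣ))) :=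
    ((commute_twistSum_tmul C.hh.symm (Commute.one_right _)).add_right
      (commute_twistSum_tmul (Commute.one_right _) (H₂.commute_g C.he.symm))).add_right
        (commute_twistSum_tmul C.hh.symm hg₂e)
  rw [mul_assoc, mul_add, h1, H.twistSum_mul_one_tmul_toral K hp, ← add_mul, ← mul_assoc,
    ← add_assoc, h2.eq, mul_assoc]

end TwistedProduct

end JacobsonWitt
end

theorem theorem3p11 (K : Type*) [Field K] (p : ℕ) [Fact p.Prime] [CharP K p] (hp : p ≠ 2)
    (n : ℕ) (k m : Fin n) (hkm : k ≠ m) (q : K) :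
    (⁅hW K p n k, eW K p n k⁆ = eW K p n k ∧ ⁅hW K p n m, eW K p n m⁆ = eW K p n m) ∧
    (∃ H : HopfStructure (Kt K p q) (utq K p n q),
      IsTwisting H (basicTwist K p n q m * basicTwist K p n q k) ∧
      (∀ (α : Fin n → ℕ) (i : Fin n), (∀ r, α r ≤ p - 1) →
        H.comul (ιA K p n q (xD K p n α i)) =
          ιA K p n q (xD K p n α i) ⊗ₜ[Kt K p q]
            ((oneSub K p n q k ^ ((α k : ℤ) - if i = k then 1 else 0) *
              oneSub K p n q m ^ ((α m : ℤ) - if i = m then 1 else 0) :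
                (utq K p n q)ˣ) : utq K p n q) +
          ∑ l ∈ Finset.range p, ∑ s ∈ Finset.range p, (-1) ^ (l + s) *
            ((rising (hA K p n q k) 0 l * rising (hA K p n q m) 0 s) ⊗ₜ[Kt K p q]
              (((oneSub K p n q k ^ (-(l : ℤ)) * oneSub K p n q m ^ (-(s : ℤ)) :
                  (utq K p n q)ˣ) : utq K p n q) *
                ιA K p n q (dW K p n k l (dW K p n m s (xD K p n α i))) *
                tA K p n q ^ (l + s))) ∧
        H.antipode (ιA K p n q (xD K p n α i)) =
          -(((oneSub K p n q k ^ ((if i = k then 1 else 0) - (α k : ℤ)) *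
              oneSub K p n q m ^ ((if i = m then 1 else 0) - (α m : ℤ)) :
                (utq K p n q)ˣ) : utq K p n q) *
            ∑ l ∈ Finset.range p, ∑ s ∈ Finset.range p,
              ιA K p n q (dW K p n k l (dW K p n m s (xD K p n α i))) *
                rising (hA K p n q k) 1 l * rising (hA K p n q m) 1 s *
                tA K p n q ^ (l + s)) ∧
        H.counit (ιA K p n q (xD K p n α i)) = 0) ∧
      (∃ a b : utq K p n q, a * b ≠ b * a) ∧
      (∃ a : utq K p n q,
        TensorProduct.comm (Kt K p q) (utq K p n q) (utq K p n q) (H.comul a) ≠ H.comul a)) ∧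
    Module.Finite K (utq K p n q) ∧
    Module.finrank K (utq K p n q) = p ^ (1 + n * p ^ n) := by
  refine ⟨⟨lie_hW_eW K p n k, lie_hW_eW K p n m⟩, ?_, finite_utq K p n q, finrank_utq K p n q⟩
  have := charP_utq K p n q
  obtain ⟨g', T⟩ := exists_isTwistPair K p n q k
  obtain ⟨g₂', T₂⟩ := exists_isTwistPair K p n q m
  have C := pairsCommute K p n q hp hkm
  have he := isPrimitive_eA_mul_tA K p n q k
  have he₂ := isPrimitive_eA_mul_tA K p n q m
  rw [basicTwist_eq_twistSum, basicTwist_eq_twistSum]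
  have hF := isDrinfeldTwist_mul T T₂ C (isPrimitive_ιA K p n q _) he
    (isPrimitive_ιA K p n q _) he₂
  set F₁ := twistSum (Kt K p q) p (hA K p n q k) (oneSub K p n q k)
  set F₂ := twistSum (Kt K p q) p (hA K p n q m) (oneSub K p n q m)
  set G₁ := twistSum (Kt K p q) p (hA K p n q k) (oneSub K p n q k)⁻¹
  set G₂ := twistSum (Kt K p q) p (hA K p n q m) (oneSub K p n q m)⁻¹
  have h1 : F₁ * G₁ = 1 := twistSum_mul_twistSum_inv T.pow_h T.pow_g
  have h1' : G₁ * F₁ = 1 := twistSum_inv_mul_twistSum T.pow_h T.pow_g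
  have h2 : F₂ * G₂ = 1 := twistSum_mul_twistSum_inv T₂.pow_h T₂.pow_g
  have h2' : G₂ * F₂ = 1 := twistSum_inv_mul_twistSum T₂.pow_h T₂.pow_g
  have hFG : F₂ * F₁ * (G₁ * G₂) = 1 := by
    rw [mul_assoc, ← mul_assoc F₁, h1, one_mul, h2]
  have hGF : G₁ * G₂ * (F₂ * F₁) = 1 := by
    rw [mul_assoc, ← mul_assoc G₂, h2', one_mul, h1']
  have hcomul (x : W K p n) {z} := twistHopf_comul_eq hF hFG hGF (isPrimitive_ιA K p n q x) (z := z)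
  refine ⟨twistHopf hF hFG hGF, isTwisting_twistHopf hF hFG hGF, fun α i _ => ?_,
    ⟨_, _, hA_mul_eA_ne K p n q hp k⟩, hA K p n q k, ?_⟩
  · have hx := mul_ιA_of_lie_eq K p n q (lie_hW_xD K p n k i α)
    have hx₂ := mul_ιA_of_lie_eq K p n q (lie_hW_xD K p n m i α)
    refine ⟨?_, ?_, twistHopf_counit_eq hF hFG hGF (isPrimitive_ιA K p n q _)⟩
    · refine (hcomul _ (twistSum_mul_twistSum_mul (K := K) hp T T₂ C hx hx₂)).trans ?_
      simp only [divAd_divAd_ιA, ← mul_assoc]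
    · refine (twistHopf_antipode_eq hF hFG hGF (isPrimitive_ιA K p n q _)
        (mulAntipodeRight_twistSum_mul_twistSum T T₂ C he he₂)
        (antipodeSum_mul_antipodeSum_mul (K := K) T T₂ C hx hx₂)).trans ?_
      rw [neg_sub, neg_sub]
      congr 2
      refine Finset.sum_congr rfl fun l _ => Finset.sum_congr rfl fun s _ => ?_
      have ht (x : utq K p n q) : tA K p n q ^ (l + s) * x = x * tA K p n q ^ (l + s) :=
        ((commute_tA K p n q x).pow_right _).eq.symm
      rw [divAd_divAd_ιA, mul_assoc, mul_assoc, ht, ← mul_assoc, ← mul_assoc]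
  -- Noncocommutativity is witnessed by `h(k)`: the symmetric part `h ⊗ 1 + 1 ⊗ h` cancels and
  -- `hA_tmul_ne` excludes symmetry of the rest.
  · have h3 := hcomul (hW K p n k) (twistSum_mul_twistSum_mul_toral K hp T T₂ C)
    change TensorProduct.comm _ _ _ ((twistHopf hF hFG hGF).comul (ιA K p n q (hW K p n k))) ≠
      (twistHopf hF hFG hGF).comul (ιA K p n q (hW K p n k))
    rw [h3, map_add, map_add, TensorProduct.comm_tmul, TensorProduct.comm_tmul,
      TensorProduct.comm_tmul, add_comm ((1 : utq K p n q) ⊗ₜ[Kt K p q] _)]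
    intro h4
    exact hA_tmul_ne K p n q hp k (add_left_cancel h4).symm
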